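/- **Setting.** Fix integers $K\ge 2$ (arms), $T\ge 2$ (rounds), a dimension $d$, a measurable context space $\mathcal X$ with a probability measure $\mathcal G$, sets $\mathcal Z,\Theta\subseteq\mathbb R^d$ with $|\langle z,\theta\rangle|\le 1$ for all $z\in\mathcal Z,\theta\in\Theta$, and a known feature map $\phi:[K]\times\mathcal X\to\mathcal Z$. In round $t=1,\dots,T$, nature chooses $\theta_t\in\Theta$ from a $\sigma$-algebra $\mathcal F_{t-1}$ which contains the history $(X_s,A_s,\ell_s(A_s,X_s))_{s<t}$; a context $X_t\sim\mathcal G$ is drawn independently of $\mathcal F_{t-1}$; the losses are $\ell_t(a,x)=\langle\phi(a,x),\theta_t\rangle+\varepsilon_t(a)\in[-1,1]$ with $\mathbb E[\varepsilon_t(a)\mid X_t,\mathcal F_{t-1}]=0$; the learner draws $A_t$ from $\pi_t(\cdot\mid X_t)$, independently of $\varepsilon_t$ given $(X_t,\mathcal F_{t-1})$, and observes $\ell_t(A_t,X_t)$. The regret is $$R_T=\max_{\rho:\mathcal X\to[K]}\mathbb E\Big[\sum_{t=1}^T\big(\ell_t(A_t,X_t)-\ell_t(\rho(X_t),X_t)\big)\Big],$$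 and $\rho^*_T$ is a minimiser over $\rho:\mathcal X\to[K]$ of $\mathbb E[\sum_{t=1}^T\langle\phi(\rho(X_t),X_t),\theta_t\rangle]$. For a policy $p$ (a map $x\mapsto p(\cdot\mid x)$ into the probability simplex $\mathcal P_K$) let $\Sigma(p)=\mathbb E_{X_0\sim\mathcal G,\,a\sim p(\cdot\mid X_0)}[\phi(a,X_0)\phi(a,X_0)^\top]$. Assume that an exploration policy $e^*$ and a constant $\lambda>0$ are known such that $\Sigma(e^*)$ is invertible and $z^\top\Sigma(e^*)^{-1}z\le 1/\lambda$ for all $z\in\mathcal Z$. **Algorithm (BoBW-RealFTRL with arm-dependent features).** With the Shannon entropy $H(q)=\sum_a q(a)\log(1/q(a))$, set $q_1(x)=(1/K,\dots,1/K)$ and $$\pi_t(x)=(1-\gamma_t)q_t(x)+\gamma_te^*(x),\qquad \gamma_t=\frac{\eta_t}{\lambda},\qquad \widehat\theta_t=\Sigma(\pi_t)^{-1}\phi(A_t,X_t)\,\ell_t(A_t,X_t),$$ $$q_t(x)\in\operatorname*{argmin}_{q\in\mathcal P_K}\Big\{\sum_{s<t}\sum_{a}q(a)\langle\widehat\theta_s,\phi(a,x)\rangle-\frac1{\eta_t}H(q)\Big\}\quad(t\ge2),$$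 $$\frac1{\eta_1}=\sqrt{\frac{(1/\lambda+d)\log T}{\log K}},\qquad \frac1{\eta_{t+1}}=\frac1{\eta_t}+\frac1{\eta_1}\Big(1+\frac1{\log K}\sum_{s=1}^tH(q_s(X_s))\Big)^{-1/2}.$$ Assume $\gamma_1\le1$. Since $\gamma_t$ is non-increasing in $t$, every $\pi_t(x)$ is then a probability vector. **Self-bounding regime.** Let $\Delta_*>0$ and $C\ge0$, and assume the $(\Delta_*,C,T)$-self-bounding constraint $$R_T\ \ge\ \Delta_*\,\mathbb E\Big[\sum_{t=1}^T\big(1-\pi_t(\rho^*_T(X_t)\mid X_t)\big)\Big]-C .$$ (It holds in particular if $R_T\ge\mathbb E[\sum_{t=1}^T\sum_{a\ne\rho^*_T(X_t)}\Delta_t(a\mid X_t)\pi_t(a\mid X_t)]-C$, where $\Delta_t(a\mid x)=\langle\phi(a,x)-\phi(\rho^*_T(x),x),\theta_t\rangle\ge\Delta_*$ for all $t$, $x$ and $a\ne\rho^*_T(x)$.) **Theorem.** There is a universal constant $c>0$, independent of $K,d,T,\lambda,\Delta_*,C$ and of the problem instance, such that in every instance as above $$R_T\ \le\ c\left(\frac{(\frac1\lambda+d)\log(T)\log(KT)}{\Delta_*}+\sqrt{\frac{C(\frac1\lambda+d)\log(T)\log(KT)}{\Delta_*}}\right).$$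 In particular, apart from $\log(KT)$, the bound has no factor depending on $K$. -/

import Mathlib

open MeasureTheory ProbabilityTheory Finset
open scoped Matrix

noncomputable section

namespace BobwFTRL

/-- What the learner knows before round 1: the feature map, the context distribution, the
exploration policy `e*`, the exploration constant `λ` and the horizon `T`. -/
structure Input (𝒳 : Type*) [MeasurableSpace 𝒳] (K d : ℕ) where
  φ : Fin K → 𝒳 → Fin d → ℝ
  G : Measure 𝒳
  eStar : 𝒳 → Fin K → ℝ
  lam : ℝ
  T : ℕ

/-- Shannon entropy `H(q) = ∑ a, q a * log (1 / q a)` (with `0 log 0 = 0`). -/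
def entropy {K : ℕ} (q : Fin K → ℝ) : ℝ := ∑ a, Real.negMulLog (q a)

/-- The FTRL objective `⟨L, q⟩ + β * ψ(q)` with the negative entropy `ψ = -H` and `β = 1/η`. -/
def ftrlObjective {K : ℕ} (L : Fin K → ℝ) (β : ℝ) (q : Fin K → ℝ) : ℝ :=
  L ⬝ᵥ q + β * (-entropy q)

/-- An element of `argmin_{q ∈ P_K} ⟨L, q⟩ + β ψ(q)` (see `ftrlArgmin_spec`). -/
def ftrlArgmin {K : ℕ} (L : Fin K → ℝ) (β : ℝ) : Fin K → ℝ :=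
  Classical.epsilon fun q =>
    q ∈ stdSimplex ℝ (Fin K) ∧ IsMinOn (ftrlObjective L β) (stdSimplex ℝ (Fin K)) q

theorem ftrlArgmin_spec {K : ℕ} (hK : 0 < K) (L : Fin K → ℝ) (β : ℝ) :
    ftrlArgmin L β ∈ stdSimplex ℝ (Fin K) ∧
      IsMinOn (ftrlObjective L β) (stdSimplex ℝ (Fin K)) (ftrlArgmin L β) := by
  have : Nonempty (Fin K) := ⟨⟨0, hK⟩⟩
  have hne : (stdSimplex ℝ (Fin K)).Nonempty :=
    ⟨_, single_mem_stdSimplex ℝ (⟨0, hK⟩ : Fin K)⟩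
  have hc : Continuous (ftrlObjective L β) := by
    unfold ftrlObjective entropy dotProduct
    have := Real.continuous_negMulLog
    fun_prop
  obtain ⟨q, hq, hmin⟩ := (isCompact_stdSimplex ℝ (Fin K)).exists_isMinOn hne hc.continuousOn
  exact Classical.epsilon_spec
    (p := fun q => q ∈ stdSimplex ℝ (Fin K) ∧
      IsMinOn (ftrlObjective L β) (stdSimplex ℝ (Fin K)) q) ⟨q, hq, hmin⟩

/-- The variables with which the algorithm enters a round `t`: the function
`x ↦ ∑_{s<t} ℓ̂_s(x)`, the inverse learning rate `1/η_t`, the sum `∑_{s<t} H(q_s(X_s))`,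
and `q_t`. -/
structure State (𝒳 : Type*) (K : ℕ) where
  cumLoss : 𝒳 → Fin K → ℝ
  invRate : ℝ
  cumEntropy : ℝ
  q : 𝒳 → Fin K → ℝ

variable {𝒳 : Type*} [MeasurableSpace 𝒳] {K d : ℕ}

namespace Input

/-- `Σ(p) = E_{X₀ ∼ G, a ∼ p(X₀)} [φ(a, X₀) φ(a, X₀)ᵀ]`. -/
def designMatrix (P : Input 𝒳 K d) (p : 𝒳 → Fin K → ℝ) : Matrix (Fin d) (Fin d) ℝ :=
  Matrix.of fun i j => ∫ x, ∑ a, p x a * (P.φ a x i * P.φ a x j) ∂P.G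

/-- `1/η_1 = √((1/λ + d) log T / log K)`. -/
def invRateOne (P : Input 𝒳 K d) : ℝ :=
  √((1 / P.lam + d) * Real.log P.T / Real.log K)

/-- The mixing weight `γ = η/λ` for the inverse learning rate `β = 1/η`. -/
def mixing (P : Input 𝒳 K d) (β : ℝ) : ℝ := (1 / β) / P.lam

/-- The played policy `π_t(x) = (1 - γ_t) q_t(x) + γ_t e*(x)`. -/
def policy (P : Input 𝒳 K d) (s : State 𝒳 K) (x : 𝒳) (a : Fin K) : ℝ :=
  (1 - P.mixing s.invRate) * s.q x a + P.mixing s.invRate * P.eStar x a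

/-- `θ̂_t = Σ(π_t)⁻¹ φ(A_t, X_t) ℓ_t(A_t, X_t)` for context `x`, arm `a` and observed loss `y`. -/
def thetaHat (P : Input 𝒳 K d) (s : State 𝒳 K) (x : 𝒳) (a : Fin K) (y : ℝ) : Fin d → ℝ :=
  y • ((P.designMatrix (P.policy s))⁻¹ *ᵥ P.φ a x)

/-- The state in round 1; `q_1` is uniform. -/
def init (P : Input 𝒳 K d) : State 𝒳 K where
  cumLoss := 0
  invRate := P.invRateOne
  cumEntropy := 0
  q := fun _ _ => 1 / K

/-- One round: from the state of round `t`, the context `x`, the arm `a` and the observed loss `y`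
to the state of round `t + 1`. Here `ℓ̂_t(a', x') = ⟨φ(a', x'), θ̂_t⟩` and
`1/η_{t+1} = 1/η_t + (1/η_1) / √(1 + (log K)⁻¹ ∑_{s≤t} H(q_s(X_s)))`. -/
def step (P : Input 𝒳 K d) (s : State 𝒳 K) (x : 𝒳) (a : Fin K) (y : ℝ) : State 𝒳 K :=
  let cumLoss' : 𝒳 → Fin K → ℝ := fun x' a' =>
    s.cumLoss x' a' + P.φ a' x' ⬝ᵥ P.thetaHat s x a y
  let cumEntropy' : ℝ := s.cumEntropy + entropy (s.q x)
  let invRate' : ℝ :=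
    s.invRate + P.invRateOne * (1 / √(1 + (Real.log K)⁻¹ * cumEntropy'))
  { cumLoss := cumLoss'
    invRate := invRate'
    cumEntropy := cumEntropy'
    q := fun x' => ftrlArgmin (cumLoss' x') invRate' }

/-- `P.run X A y t` is the state in which the BoBW-RealFTRL enters round `t + 1`, when the contexts,
arms and losses of the rounds `1, …, t` were `X s`, `A s`, `y s`. -/
def run (P : Input 𝒳 K d) (X : ℕ → 𝒳) (A : ℕ → Fin K) (y : ℕ → ℝ) : ℕ → State 𝒳 K
  | 0 => P.init
  | t + 1 => P.step (run P X A y t) (X (t + 1)) (A (t + 1)) (y (t + 1))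

/-- The exploration-policy assumption for the feature space `Z`. -/
structure IsExploration (P : Input 𝒳 K d) (Z : Set (Fin d → ℝ)) : Prop where
  lam_pos : 0 < P.lam
  measurable_eStar : ∀ a, Measurable fun x => P.eStar x a
  eStar_mem : ∀ x, P.eStar x ∈ stdSimplex ℝ (Fin K)
  posDef : (P.designMatrix P.eStar).PosDef
  le_inv_lam : ∀ z ∈ Z, z ⬝ᵥ ((P.designMatrix P.eStar)⁻¹ *ᵥ z) ≤ 1 / P.lam

end Input

/-- The random variables of a bandit interaction, indexed by the rounds `1, 2, …`. -/
structure Bandit (Ω 𝒳 : Type*) (K d : ℕ) where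
  X : ℕ → Ω → 𝒳
  A : ℕ → Ω → Fin K
  θ : ℕ → Ω → Fin d → ℝ
  ε : ℕ → Ω → Fin K → ℝ

variable {Ω : Type*}

namespace Bandit

/-- `ℓ_t(a, x) = ⟨φ(a, x), θ_t⟩ + ε_t(a)`. -/
def loss (B : Bandit Ω 𝒳 K d) (P : Input 𝒳 K d) (t : ℕ) (ω : Ω) (a : Fin K) (x : 𝒳) : ℝ :=
  P.φ a x ⬝ᵥ B.θ t ω + B.ε t ω a

/-- The policy `π_{t+1}` of the BoBW-RealFTRL, computed from the observations
`X_s, A_s, ℓ_s(A_s, X_s)`, `s ≤ t`. -/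
def nextPolicy (B : Bandit Ω 𝒳 K d) (P : Input 𝒳 K d) (t : ℕ) (ω : Ω) : 𝒳 → Fin K → ℝ :=
  P.policy (P.run (fun s => B.X s ω) (fun s => B.A s ω)
    (fun s => B.loss P s ω (B.A s ω) (B.X s ω)) t)

variable [mΩ : MeasurableSpace Ω]

/-- The protocol and the boundedness assumption, when the learner runs the BoBW-RealFTRL. The
σ-algebra `ℱ t` contains the history `X_s, A_s, ℓ_s(A_s, X_s)`, `s ≤ t` (it may be larger, so that
nature may randomise). In round `t + 1`, `θ` is chosen from `ℱ t`, the context is drawn from `G`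
independently of `ℱ t`, the noise is conditionally centred, and the arm is drawn from
`π_{t+1}(X_{t+1})` without knowledge of the noise. -/
structure IsInteraction (B : Bandit Ω 𝒳 K d) (P : Input 𝒳 K d) (Z Θ : Set (Fin d → ℝ))
    (ℱ : Filtration ℕ mΩ) (μ : Measure Ω) : Prop where
  measurable_φ : ∀ a, Measurable (P.φ a)
  φ_mem : ∀ a x, P.φ a x ∈ Z
  inner_bound : ∀ z ∈ Z, ∀ θ ∈ Θ, |z ⬝ᵥ θ| ≤ 1
  measurable_X : ∀ t < P.T, Measurable[ℱ (t + 1)] (B.X (t + 1))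
  measurable_A : ∀ t < P.T, Measurable[ℱ (t + 1)] (B.A (t + 1))
  measurable_obs : ∀ t < P.T, Measurable[ℱ (t + 1)]
    fun ω => B.loss P (t + 1) ω (B.A (t + 1) ω) (B.X (t + 1) ω)
  measurable_θ : ∀ t < P.T, Measurable[ℱ t] (B.θ (t + 1))
  measurable_ε : ∀ t < P.T, Measurable (B.ε (t + 1))
  θ_mem : ∀ t < P.T, ∀ᵐ ω ∂μ, B.θ (t + 1) ω ∈ Θ
  loss_bound : ∀ t < P.T, ∀ᵐ ω ∂μ, ∀ a x, |B.loss P (t + 1) ω a x| ≤ 1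
  law_X : ∀ t < P.T, μ.map (B.X (t + 1)) = P.G
  indep_X : ∀ t < P.T, Indep (MeasurableSpace.comap (B.X (t + 1)) inferInstance) (ℱ t) μ
  noise : ∀ t < P.T, ∀ a,
    μ[fun ω => B.ε (t + 1) ω a | ℱ t ⊔ MeasurableSpace.comap (B.X (t + 1)) inferInstance]
      =ᵐ[μ] 0
  arm : ∀ t < P.T, ∀ a,
    μ[(B.A (t + 1) ⁻¹' {a}).indicator (fun _ => (1 : ℝ)) |
        ℱ t ⊔ MeasurableSpace.comap (B.X (t + 1)) inferInstance
          ⊔ MeasurableSpace.comap (B.ε (t + 1)) inferInstance]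
      =ᵐ[μ] fun ω => B.nextPolicy P t ω (B.X (t + 1) ω) a

/-- `R_T = max_ρ E[∑_{t=1}^T (ℓ_t(A_t, X_t) - ℓ_t(ρ(X_t), X_t))]` over measurable `ρ : 𝒳 → [K]`. -/
def regret (B : Bandit Ω 𝒳 K d) (P : Input 𝒳 K d) (μ : Measure Ω) : ℝ :=
  ⨆ ρ : {ρ : 𝒳 → Fin K // Measurable ρ},
    ∫ ω, ∑ t ∈ range P.T,
      (B.loss P (t + 1) ω (B.A (t + 1) ω) (B.X (t + 1) ω)
        - B.loss P (t + 1) ω (ρ.1 (B.X (t + 1) ω)) (B.X (t + 1) ω)) ∂μ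

/-- `ρ` is an optimal policy `ρ*_T ∈ argmin_ρ E[∑_{t=1}^T ⟨φ(ρ(X_t), X_t), θ_t⟩]`. -/
def IsOptimal (B : Bandit Ω 𝒳 K d) (P : Input 𝒳 K d) (μ : Measure Ω) (ρ : 𝒳 → Fin K) : Prop :=
  Measurable ρ ∧ ∀ ρ' : 𝒳 → Fin K, Measurable ρ' →
    ∫ ω, ∑ t ∈ range P.T, P.φ (ρ (B.X (t + 1) ω)) (B.X (t + 1) ω) ⬝ᵥ B.θ (t + 1) ω ∂μ ≤
      ∫ ω, ∑ t ∈ range P.T, P.φ (ρ' (B.X (t + 1) ω)) (B.X (t + 1) ω) ⬝ᵥ B.θ (t + 1) ω ∂μ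

/-- The `(Δ_*, C, T)`-self-bounding constraint
`R_T ≥ Δ_* E[∑_{t=1}^T (1 - π_t(ρ*(X_t) | X_t))] - C`. Lower bounds on the regret through gaps that
are at least `Δ_*` are special cases, see `isSelfBounding_of_gaps`. -/
def IsSelfBounding (B : Bandit Ω 𝒳 K d) (P : Input 𝒳 K d) (μ : Measure Ω) (ρ : 𝒳 → Fin K)
    (Δ C : ℝ) : Prop :=
  Δ * (∫ ω, ∑ t ∈ range P.T,
      (1 - B.nextPolicy P t ω (B.X (t + 1) ω) (ρ (B.X (t + 1) ω))) ∂μ) - C ≤ B.regret P μ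

/-- The gap `Δ_t(a | x) = ⟨φ(a, x), θ_t⟩ - ⟨φ(ρ(x), x), θ_t⟩`. -/
def gap (B : Bandit Ω 𝒳 K d) (P : Input 𝒳 K d) (ρ : 𝒳 → Fin K) (t : ℕ) (ω : Ω) (a : Fin K)
    (x : 𝒳) : ℝ :=
  P.φ a x ⬝ᵥ B.θ t ω - P.φ (ρ x) x ⬝ᵥ B.θ t ω

theorem measurable_comp_policy (P : Input 𝒳 K d) (hφ : ∀ a, Measurable (P.φ a)) {ρ : 𝒳 → Fin K}
    (hρ : Measurable ρ) : Measurable fun x => P.φ (ρ x) x := by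
  have h : Measurable fun p : Fin K × 𝒳 => P.φ p.1 p.2 := measurable_from_prod_countable_right hφ
  exact h.comp (hρ.prodMk measurable_id)

/-- If `Δ_t(a | x) ≥ Δ_*` for all `x` and all `a ≠ ρ(x)`, and
`R_T ≥ E[∑_t ∑_{a ≠ ρ(X_t)} Δ_t(a | X_t) π_t(a | X_t)] - C`, then the self-bounding constraint
holds. -/
theorem isSelfBounding_of_gaps {B : Bandit Ω 𝒳 K d} {P : Input 𝒳 K d} {Z Θ : Set (Fin d → ℝ)}
    {ℱ : Filtration ℕ mΩ} {μ : Measure Ω} [IsProbabilityMeasure μ]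
    (hB : B.IsInteraction P Z Θ ℱ μ) {ρ : 𝒳 → Fin K} (hρ : Measurable ρ) {Δ C : ℝ}
    (hgap : ∀ t < P.T, ∀ᵐ ω ∂μ, ∀ x a, a ≠ ρ x → Δ ≤ B.gap P ρ (t + 1) ω a x)
    (hreg : (∫ ω, ∑ t ∈ range P.T, ∑ a ∈ univ.filter (fun a => a ≠ ρ (B.X (t + 1) ω)),
        B.gap P ρ (t + 1) ω a (B.X (t + 1) ω) * B.nextPolicy P t ω (B.X (t + 1) ω) a ∂μ) - C
      ≤ B.regret P μ) :
    B.IsSelfBounding P μ ρ Δ C := by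
  have hX : ∀ t < P.T, Measurable (B.X (t + 1)) := fun t ht =>
    (hB.measurable_X t ht).mono (ℱ.le _) le_rfl
  have hA : ∀ t < P.T, Measurable (B.A (t + 1)) := fun t ht =>
    (hB.measurable_A t ht).mono (ℱ.le _) le_rfl
  have hθ : ∀ t < P.T, Measurable (B.θ (t + 1)) := fun t ht =>
    (hB.measurable_θ t ht).mono (ℱ.le _) le_rfl
  have hint : ∀ t < P.T, ∀ a,
      Integrable (fun ω => B.nextPolicy P t ω (B.X (t + 1) ω) a) μ := fun t ht a =>
    integrable_condExp.congr (hB.arm t ht a)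
  have hind : ∀ t < P.T, ∀ a,
      Integrable ((B.A (t + 1) ⁻¹' {a}).indicator (fun _ => (1 : ℝ))) μ := fun t ht a =>
    (integrable_const (1 : ℝ)).indicator (hA t ht (measurableSet_singleton a))
  have hnn : ∀ t < P.T, ∀ᵐ ω ∂μ, ∀ a, 0 ≤ B.nextPolicy P t ω (B.X (t + 1) ω) a := by
    intro t ht
    rw [ae_all_iff]
    intro a
    have h0 : 0 ≤ᵐ[μ] (B.A (t + 1) ⁻¹' {a}).indicator (fun _ => (1 : ℝ)) :=
      Filter.Eventually.of_forall fun ω => Set.indicator_nonneg (fun _ _ => zero_le_one) ω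
    filter_upwards [hB.arm t ht a, condExp_nonneg (m := ℱ t ⊔
        MeasurableSpace.comap (B.X (t + 1)) inferInstance
          ⊔ MeasurableSpace.comap (B.ε (t + 1)) inferInstance) h0] with ω h1 h2
    rw [← h1]
    exact h2
  have hsum : ∀ t < P.T, ∀ᵐ ω ∂μ, ∑ a, B.nextPolicy P t ω (B.X (t + 1) ω) a = 1 := by
    intro t ht
    have hle : ℱ t ⊔ MeasurableSpace.comap (B.X (t + 1)) inferInstance
        ⊔ MeasurableSpace.comap (B.ε (t + 1)) inferInstance ≤ mΩ :=
      sup_le (sup_le (ℱ.le t) (hX t ht).comap_le) (hB.measurable_ε t ht).comap_le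
    have hone : (∑ a, (B.A (t + 1) ⁻¹' {a}).indicator (fun _ => (1 : ℝ))) = fun _ => (1 : ℝ) := by
      ext ω
      rw [Finset.sum_apply, Finset.sum_eq_single_of_mem (B.A (t + 1) ω) (mem_univ _)]
      · exact Set.indicator_of_mem (s := B.A (t + 1) ⁻¹' {B.A (t + 1) ω}) rfl _
      · intro b _ hb
        exact Set.indicator_of_notMem (s := B.A (t + 1) ⁻¹' {b})
          (fun h => hb (Set.mem_singleton_iff.1 h).symm) _
    have h := condExp_finsetSum (μ := μ) (s := univ) (fun a _ => hind t ht a)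
      (ℱ t ⊔ MeasurableSpace.comap (B.X (t + 1)) inferInstance
        ⊔ MeasurableSpace.comap (B.ε (t + 1)) inferInstance)
    rw [hone, condExp_const hle] at h
    have harm := ae_all_iff.2 (hB.arm t ht)
    filter_upwards [h, harm] with ω h1 h2
    rw [Finset.sum_apply] at h1
    rw [h1]
    exact Finset.sum_congr rfl fun a _ => (h2 a).symm
  have hset : ∀ t < P.T, ∀ a, MeasurableSet {ω | a ≠ ρ (B.X (t + 1) ω)} := fun t ht a =>
    ((measurableSet_singleton a).compl).preimage (hρ.comp (hX t ht)) |>.congr (by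
      ext ω; simp [eq_comm])
  have hgm : ∀ t < P.T, ∀ a,
      AEStronglyMeasurable (fun ω => B.gap P ρ (t + 1) ω a (B.X (t + 1) ω)) μ := by
    intro t ht a
    have h1 : Measurable fun ω => P.φ a (B.X (t + 1) ω) := (hB.measurable_φ a).comp (hX t ht)
    have h2 : Measurable fun ω => P.φ (ρ (B.X (t + 1) ω)) (B.X (t + 1) ω) :=
      (measurable_comp_policy P hB.measurable_φ hρ).comp (hX t ht)
    have h3 := hθ t ht
    refine Measurable.aestronglyMeasurable ?_
    unfold gap dotProduct
    fun_prop
  have hgb : ∀ t < P.T, ∀ a, ∀ᵐ ω ∂μ, ‖B.gap P ρ (t + 1) ω a (B.X (t + 1) ω)‖ ≤ 2 := by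
    intro t ht a
    filter_upwards [hB.θ_mem t ht] with ω hω
    have h1 := hB.inner_bound _ (hB.φ_mem a (B.X (t + 1) ω)) _ hω
    have h2 := hB.inner_bound _ (hB.φ_mem (ρ (B.X (t + 1) ω)) (B.X (t + 1) ω)) _ hω
    rw [Real.norm_eq_abs]
    unfold gap
    rw [abs_le] at *
    constructor <;> linarith
  have hint2 : ∀ t < P.T, ∀ f : Fin K → Ω → ℝ, (∀ a, Integrable (f a) μ) →
      Integrable (fun ω => ∑ a ∈ univ.filter (fun a => a ≠ ρ (B.X (t + 1) ω)), f a ω) μ := by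
    intro t ht f hf
    have : (fun ω => ∑ a ∈ univ.filter (fun a => a ≠ ρ (B.X (t + 1) ω)), f a ω) =
        fun ω => ∑ a, ({ω | a ≠ ρ (B.X (t + 1) ω)}.indicator (f a)) ω := by
      ext ω
      rw [Finset.sum_filter]
      exact Finset.sum_congr rfl fun a _ => by simp [Set.indicator_apply]
    rw [this]
    exact integrable_finsetSum _ fun a _ => (hf a).indicator (hset t ht a)
  have hcompl : ∀ t < P.T, ∀ᵐ ω ∂μ,
      1 - B.nextPolicy P t ω (B.X (t + 1) ω) (ρ (B.X (t + 1) ω)) =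
        ∑ a ∈ univ.filter (fun a => a ≠ ρ (B.X (t + 1) ω)),
          B.nextPolicy P t ω (B.X (t + 1) ω) a := by
    intro t ht
    filter_upwards [hsum t ht] with ω h1
    rw [Finset.filter_ne', ← h1, ← Finset.add_sum_erase _ _ (mem_univ (ρ (B.X (t + 1) ω)))]
    ring
  refine le_trans ?_ hreg
  gcongr
  rw [← integral_const_mul]
  refine integral_mono_ae ?_ ?_ ?_
  · refine Integrable.const_mul (integrable_finsetSum _ fun t ht => ?_) _
    have ht' := Finset.mem_range.1 ht
    exact (hint2 t ht' _ (hint t ht')).congr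
      ((hcompl t ht').mono fun ω h => h.symm)
  · refine integrable_finsetSum _ fun t ht => ?_
    have ht' := Finset.mem_range.1 ht
    exact hint2 t ht' (fun a ω => B.gap P ρ (t + 1) ω a (B.X (t + 1) ω) *
      B.nextPolicy P t ω (B.X (t + 1) ω) a)
      fun a => (hint t ht' a).bdd_mul (hgm t ht' a) (hgb t ht' a)
  · have hall : ∀ᵐ ω ∂μ, ∀ t ∈ range P.T,
        Δ * (1 - B.nextPolicy P t ω (B.X (t + 1) ω) (ρ (B.X (t + 1) ω))) ≤
          ∑ a ∈ univ.filter (fun a => a ≠ ρ (B.X (t + 1) ω)),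
            B.gap P ρ (t + 1) ω a (B.X (t + 1) ω) *
              B.nextPolicy P t ω (B.X (t + 1) ω) a := by
      refine (ae_ball_iff (range P.T).countable_toSet).2 fun t ht => ?_
      have ht' := Finset.mem_range.1 ht
      filter_upwards [hcompl t ht', hgap t ht', hnn t ht'] with ω h1 h2 h3
      rw [h1, Finset.mul_sum]
      exact Finset.sum_le_sum fun a ha =>
        mul_le_mul_of_nonneg_right (h2 _ a (Finset.mem_filter.1 ha).2) (h3 a)
    filter_upwards [hall] with ω hω
    rw [Finset.mul_sum]
    exact Finset.sum_le_sum hω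

end Bandit

end BobwFTRL

end

/-! The regret is bounded by the square root of the total entropy of the iterates, and that entropy
is bounded by the probability of leaving the optimal arms. The self-bounding constraint then turns
this into a quadratic inequality for the regret.

For a fixed context `x`, the iterates `q_t(x)` are Gibbs distributions of the estimated losses.
Following the free energy through loss updates and rate changes gives `ftrl_regret_le`: the regret
is at most a sum of stability terms `η_t ∑ q_t ℓ̂_t²`, plus `log K / η_1`, plus penalties
`(1/η_{t+1} - 1/η_t) H(q_{t+1}(x))`. This needs `|ℓ̂_t| ≤ 1/η_t`, which the mixing weight `γ_t = η_t
/ λ` ensures (`posDef_and_bound`).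

The inequality is integrated over an independent ghost context `x` drawn from `G`. Since `X_t` is
independent of the past, a quantity determined by the past has the same mean at `x` as at `X_t`
(`integral_comp_X`). The estimates are unbiased (`integral_mul_estLoss`), and their second moment
under the played policy is at most the trace of `Σ⁻¹Σ`, which is `d` rather than a multiple of `K`
(`integral_kernel_sq`). Exploration costs `2γ_t` per round. The penalties pass from the ghost
context to the real one (`integral_penalty`), where the learning rates control them pathwise:
`rate_bounds` and `total_error_le` show that all errors together are of the order `√((1/λ + d) log T
∑ H(q_t(X_t)))`, and Jensen's inequality gives `regret_le_sqrt`.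

By `entropy_le_of_weight`, `H(q) ≤ 2/T + (1 - q(a₀)) log(KT)`. Summed over the rounds this leaves an
additive `O(log(KT))`, which is absorbed: after a single round of losses of size at most `1/η_1`, no
arm can carry almost all the weight, so round 2 alone contributes a constant to `∑ (1 -
π_t(ρ(X_t)))`. Hence the entropy is at most `70 log(KT)` times that sum (`ae_cumEntropy_le`). If `V`
is the expected sum, then `R² ≤ c (1/λ + d) log(T) log(KT) V` and `V ≤ (R + C)/Δ`; solving for `R`
finishes the proof. -/

noncomputable section

namespace BobwFTRL

variable {K : ℕ}

/-! ### Entropy-regularised minimisation over the simplex -/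

/-- The Gibbs distribution `q a ∝ exp (-L a / β)`. -/
def gibbs (L : Fin K → ℝ) (β : ℝ) (a : Fin K) : ℝ :=
  Real.exp (-L a / β) / ∑ b, Real.exp (-L b / β)

/-- The minimal value `-β log ∑ a, exp (-L a / β)` of the FTRL objective. -/
def freeEnergy (L : Fin K → ℝ) (β : ℝ) : ℝ := -β * Real.log (∑ b, Real.exp (-L b / β))

theorem sum_exp_pos (hK : 0 < K) (L : Fin K → ℝ) (β : ℝ) :
    0 < ∑ b, Real.exp (-L b / β) :=
  Finset.sum_pos (fun _ _ => Real.exp_pos _) ⟨⟨0, hK⟩, mem_univ _⟩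

theorem gibbs_pos (hK : 0 < K) (L : Fin K → ℝ) (β : ℝ) (a : Fin K) : 0 < gibbs L β a :=
  div_pos (Real.exp_pos _) (sum_exp_pos hK L β)

theorem sum_gibbs (hK : 0 < K) (L : Fin K → ℝ) (β : ℝ) : ∑ a, gibbs L β a = 1 := by
  unfold gibbs
  rw [← Finset.sum_div, div_self (sum_exp_pos hK L β).ne']

theorem gibbs_mem_stdSimplex (hK : 0 < K) (L : Fin K → ℝ) (β : ℝ) :
    gibbs L β ∈ stdSimplex ℝ (Fin K) :=
  ⟨fun a => (gibbs_pos hK L β a).le, sum_gibbs hK L β⟩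

/-- Gibbs variational principle: the excess over the minimum is `β` times the relative entropy of
`q` with respect to the Gibbs distribution. Written with `klFun`, every summand is nonnegative and
vanishes only where the two weights agree, so minimality and uniqueness can both be read off. -/
theorem ftrlObjective_eq_freeEnergy_add (hK : 0 < K) (L : Fin K → ℝ) {β : ℝ} (hβ : 0 < β)
    {q : Fin K → ℝ} (hq : q ∈ stdSimplex ℝ (Fin K)) :
    ftrlObjective L β q = freeEnergy L β +
      β * ∑ a, gibbs L β a * InformationTheory.klFun (q a / gibbs L β a) := by
  have key : ∀ a, gibbs L β a * InformationTheory.klFun (q a / gibbs L β a) =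
      (L a * q a) / β + q a * Real.log (∑ b, Real.exp (-L b / β)) - Real.negMulLog (q a)
        + gibbs L β a - q a := by
    intro a
    have hg := gibbs_pos hK L β a
    rw [InformationTheory.klFun_apply, Real.negMulLog]
    rcases eq_or_ne (q a) 0 with h0 | h0
    · simp [h0]
    · rw [Real.log_div h0 hg.ne']
      have : Real.log (gibbs L β a) = -L a / β - Real.log (∑ b, Real.exp (-L b / β)) := by
        rw [gibbs, Real.log_div (Real.exp_pos _).ne' (sum_exp_pos hK L β).ne', Real.log_exp]
      rw [this]
      field_simp
      ring
  simp_rw [key]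
  rw [Finset.sum_sub_distrib, Finset.sum_add_distrib, Finset.sum_sub_distrib,
    Finset.sum_add_distrib, ← Finset.sum_mul, hq.2, sum_gibbs hK, ← Finset.sum_div]
  unfold ftrlObjective freeEnergy entropy dotProduct
  field_simp
  ring

theorem freeEnergy_le_ftrlObjective (hK : 0 < K) (L : Fin K → ℝ) {β : ℝ} (hβ : 0 < β)
    {q : Fin K → ℝ} (hq : q ∈ stdSimplex ℝ (Fin K)) :
    freeEnergy L β ≤ ftrlObjective L β q := by
  rw [ftrlObjective_eq_freeEnergy_add hK L hβ hq]
  have : 0 ≤ ∑ a, gibbs L β a * InformationTheory.klFun (q a / gibbs L β a) :=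
    Finset.sum_nonneg fun a _ => mul_nonneg (gibbs_pos hK L β a).le
      (InformationTheory.klFun_nonneg (div_nonneg (hq.1 a) (gibbs_pos hK L β a).le))
  nlinarith [mul_nonneg hβ.le this]

theorem ftrlObjective_gibbs (hK : 0 < K) (L : Fin K → ℝ) {β : ℝ} (hβ : 0 < β) :
    ftrlObjective L β (gibbs L β) = freeEnergy L β := by
  rw [ftrlObjective_eq_freeEnergy_add hK L hβ (gibbs_mem_stdSimplex hK L β)]
  simp [div_self (gibbs_pos hK L β _).ne', InformationTheory.klFun_one]

/-- The minimiser in the algorithm is picked by choice; only uniqueness makes it an explicit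
function of the losses, which both the measurability and the regret analysis require. -/
theorem ftrlArgmin_eq_gibbs (hK : 0 < K) (L : Fin K → ℝ) {β : ℝ} (hβ : 0 < β) :
    ftrlArgmin L β = gibbs L β := by
  obtain ⟨hq, hmin⟩ := ftrlArgmin_spec hK L β
  have h1 := hmin (gibbs_mem_stdSimplex hK L β)
  simp only [Set.mem_ofPred_eq] at h1
  rw [ftrlObjective_gibbs hK L hβ, ftrlObjective_eq_freeEnergy_add hK L hβ hq] at h1
  have hnn : ∀ a ∈ univ, 0 ≤ gibbs L β a *
      InformationTheory.klFun (ftrlArgmin L β a / gibbs L β a) := fun a _ =>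
    mul_nonneg (gibbs_pos hK L β a).le
      (InformationTheory.klFun_nonneg (div_nonneg (hq.1 a) (gibbs_pos hK L β a).le))
  have h0 : ∑ a, gibbs L β a * InformationTheory.klFun (ftrlArgmin L β a / gibbs L β a) = 0 := by
    refine le_antisymm ?_ (Finset.sum_nonneg hnn)
    by_contra! h
    nlinarith [mul_pos hβ h]
  ext a
  have h2 := (Finset.sum_eq_zero_iff_of_nonneg hnn).1 h0 a (mem_univ a)
  have hg := gibbs_pos hK L β a
  have h3 := (InformationTheory.klFun_eq_zero_iff (div_nonneg (hq.1 a) hg.le)).1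
    ((mul_eq_zero.1 h2).resolve_left hg.ne')
  rwa [div_eq_one_iff_eq hg.ne'] at h3

theorem gibbs_zero (β : ℝ) : gibbs (0 : Fin K → ℝ) β = fun _ => 1 / (K : ℝ) := by
  ext a
  simp [gibbs]

theorem freeEnergy_zero (β : ℝ) : freeEnergy (0 : Fin K → ℝ) β = -β * Real.log K := by
  simp [freeEnergy]

theorem entropy_nonneg {q : Fin K → ℝ} (hq : q ∈ stdSimplex ℝ (Fin K)) : 0 ≤ entropy q :=
  Finset.sum_nonneg fun a _ => Real.negMulLog_nonneg (hq.1 a) (mem_Icc_of_mem_stdSimplex hq a).2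

theorem entropy_le_log (hK : 0 < K) {q : Fin K → ℝ} (hq : q ∈ stdSimplex ℝ (Fin K)) :
    entropy q ≤ Real.log K := by
  have h := freeEnergy_le_ftrlObjective hK 0 one_pos hq
  rw [freeEnergy_zero, ftrlObjective] at h
  simp at h
  exact h

theorem entropy_uniform (hK : 0 < K) : entropy (fun _ : Fin K => 1 / (K : ℝ)) = Real.log K := by
  have hK' : (K : ℝ) ≠ 0 := by positivity
  simp only [entropy, Real.negMulLog, Finset.sum_const, Finset.card_univ, Fintype.card_fin,
    nsmul_eq_mul, one_div, Real.log_inv]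
  field_simp

/-- A probability vector that is nearly concentrated on one arm has small entropy. -/
theorem entropy_le_of_weight (hK : 2 ≤ K) {T : ℕ} (hT : 2 ≤ T) {q : Fin K → ℝ}
    (hq : q ∈ stdSimplex ℝ (Fin K)) (a₀ : Fin K) :
    entropy q ≤ 2 / T + (1 - q a₀) * Real.log (K * T) := by
  have hK0 : 0 < K := by omega
  have hT' : (2 : ℝ) ≤ T := by exact_mod_cast hT
  have hK' : (2 : ℝ) ≤ K := by exact_mod_cast hK
  have hlog : 0 < Real.log (K * T) := Real.log_pos (by nlinarith)
  -- compare with the losses `log (K T)` off `a₀`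
  set L : Fin K → ℝ := fun a => if a = a₀ then 0 else Real.log (K * T) with hL
  have h := freeEnergy_le_ftrlObjective hK0 L one_pos hq
  -- Each of the `K - 1` other arms has weight `1 / (K T)`, so the free energy is at least `-1 / T`.
  have hZ : ∑ b, Real.exp (-L b / 1) ≤ 1 + 1 / T := by
    rw [← Finset.add_sum_erase _ _ (mem_univ a₀)]
    have h1 : Real.exp (-L a₀ / 1) = 1 := by simp [hL]
    have h2 : ∑ b ∈ univ.erase a₀, Real.exp (-L b / 1) =
        ∑ b ∈ univ.erase a₀, (1 / (K * T) : ℝ) := by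
      refine Finset.sum_congr rfl fun b hb => ?_
      simp only [hL, if_neg (Finset.ne_of_mem_erase hb)]
      rw [div_one, Real.exp_neg, Real.exp_log (by positivity), one_div]
    rw [h1, h2, Finset.sum_const, Finset.card_erase_of_mem (mem_univ _), Finset.card_univ,
      Fintype.card_fin, nsmul_eq_mul, Nat.cast_sub (by omega)]
    have : ((K : ℝ) - (1 : ℕ)) * (1 / (K * T)) ≤ 1 / T := by
      have e : (1 : ℝ) / T = K * (1 / (K * T)) := by field_simp
      rw [e]
      gcongr
      simp
    linarith
  have hlogZ : Real.log (∑ b, Real.exp (-L b / 1)) ≤ 1 / T := by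
    have := Real.log_le_sub_one_of_pos (sum_exp_pos hK0 L 1)
    linarith
  have hdot : L ⬝ᵥ q = (1 - q a₀) * Real.log (K * T) := by
    have e : ∀ a, L a * q a = Real.log (K * T) * q a -
        (if a = a₀ then Real.log (K * T) * q a else 0) := by
      intro a
      by_cases ha : a = a₀ <;> simp [hL, ha]
    simp only [dotProduct, e]
    rw [Finset.sum_sub_distrib, ← Finset.mul_sum, hq.2, Finset.sum_ite_eq' univ a₀]
    simp
    ring
  rw [ftrlObjective, freeEnergy, hdot] at h
  have h2T : (2 : ℝ) / T = 1 / T + 1 / T := by ring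
  have : (0 : ℝ) ≤ 1 / T := by positivity
  linarith

/-! ### The FTRL regret bound on one sequence of losses -/

/-- The ratio of the two partition functions is the Gibbs mean of `exp (-l / β)`. As `l / β` lies in
`[-1, 1]`, `exp (-x) ≤ 1 - x + x²` applies, followed by `log y ≤ y - 1`. Losses of either sign are
allowed, as the estimates require. -/
theorem freeEnergy_add_ge (hK : 0 < K) (L l : Fin K → ℝ) {β : ℝ} (hβ : 0 < β)
    (hl : ∀ a, |l a| ≤ β) :
    gibbs L β ⬝ᵥ l - (1 / β) * ∑ a, gibbs L β a * l a ^ 2 ≤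
      freeEnergy (L + l) β - freeEnergy L β := by
  have hexp : ∀ a, Real.exp (-l a / β) ≤ 1 - l a / β + (l a / β) ^ 2 := by
    intro a
    have h1 : |-l a / β| ≤ 1 := by
      rw [abs_div, abs_neg, abs_of_pos hβ, div_le_one hβ]
      exact hl a
    have h2 := (abs_le.1 (Real.abs_exp_sub_one_sub_id_le h1)).2
    have : (-l a / β) ^ 2 = (l a / β) ^ 2 := by ring
    rw [this] at h2
    have e : -l a / β = -(l a / β) := by ring
    linarith [e ▸ h2]
  have hZ : ∑ a, Real.exp (-(L + l) a / β) =
      (∑ b, Real.exp (-L b / β)) * ∑ a, gibbs L β a * Real.exp (-l a / β) := by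
    rw [Finset.mul_sum]
    refine Finset.sum_congr rfl fun a _ => ?_
    rw [gibbs, ← mul_assoc, mul_div_cancel₀ _ (sum_exp_pos hK L β).ne', ← Real.exp_add]
    congr 1
    simp
    ring
  have hpos : 0 < ∑ a, gibbs L β a * Real.exp (-l a / β) :=
    Finset.sum_pos (fun a _ => mul_pos (gibbs_pos hK L β a) (Real.exp_pos _)) ⟨⟨0, hK⟩, mem_univ _⟩
  have hle : ∑ a, gibbs L β a * Real.exp (-l a / β) ≤
      1 - (gibbs L β ⬝ᵥ l) / β + (1 / β ^ 2) * ∑ a, gibbs L β a * l a ^ 2 := by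
    calc _ ≤ ∑ a, (gibbs L β a - (gibbs L β a * l a) / β
            + (1 / β ^ 2) * (gibbs L β a * l a ^ 2)) := by
          refine Finset.sum_le_sum fun a _ => ?_
          refine (mul_le_mul_of_nonneg_left (hexp a) (gibbs_pos hK L β a).le).trans (le_of_eq ?_)
          field_simp
      _ = _ := by
          rw [Finset.sum_add_distrib, Finset.sum_sub_distrib, sum_gibbs hK, ← Finset.sum_div,
            ← Finset.mul_sum]
          rfl
  have hlog := Real.log_le_sub_one_of_pos hpos
  rw [freeEnergy, freeEnergy, hZ, Real.log_mul (sum_exp_pos hK L β).ne' hpos.ne']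
  have h3 : β * Real.log (∑ a, gibbs L β a * Real.exp (-l a / β)) ≤
      β * (-((gibbs L β ⬝ᵥ l) / β) + (1 / β ^ 2) * ∑ a, gibbs L β a * l a ^ 2) :=
    mul_le_mul_of_nonneg_left (by linarith) hβ.le
  have h4 : β * (-((gibbs L β ⬝ᵥ l) / β) + (1 / β ^ 2) * ∑ a, gibbs L β a * l a ^ 2) =
      -(gibbs L β ⬝ᵥ l) + (1 / β) * ∑ a, gibbs L β a * l a ^ 2 := by
    field_simp
  linarith

/-- Test the minimum at rate `β` with the minimiser at rate `β'`: only the entropy term changes. The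
entropy that appears is that of the new iterate. -/
theorem freeEnergy_sub_le (hK : 0 < K) (L : Fin K → ℝ) {β β' : ℝ} (hβ : 0 < β) (hβ' : 0 < β') :
    freeEnergy L β - freeEnergy L β' ≤ (β' - β) * entropy (gibbs L β') := by
  have h1 := freeEnergy_le_ftrlObjective hK L hβ (gibbs_mem_stdSimplex hK L β')
  have h2 := ftrlObjective_gibbs hK L hβ'
  rw [ftrlObjective] at h1 h2
  linarith

theorem freeEnergy_le_apply (L : Fin K → ℝ) {β : ℝ} (hβ : 0 < β) (a : Fin K) :
    freeEnergy L β ≤ L a := by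
  have hK : 0 < K := a.pos
  have h := freeEnergy_le_ftrlObjective hK L hβ (single_mem_stdSimplex ℝ a)
  have h2 := entropy_nonneg (single_mem_stdSimplex ℝ a)
  rw [ftrlObjective] at h
  have h3 : L ⬝ᵥ Pi.single a 1 = L a := by simp
  rw [h3] at h
  nlinarith [mul_nonneg hβ.le h2]

/-- The regret of FTRL with the entropy regulariser against a fixed arm. -/
theorem ftrl_regret_le (hK : 0 < K) (L : ℕ → Fin K → ℝ) (β : ℕ → ℝ) (n : ℕ) (hL : L 0 = 0)
    (hβ : ∀ t, 0 < β t) (hl : ∀ t ≤ n, ∀ a, |L (t + 1) a - L t a| ≤ β t) (a₀ : Fin K) :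
    ∑ t ∈ range (n + 1), (gibbs (L t) (β t) ⬝ᵥ (L (t + 1) - L t) - (L (t + 1) - L t) a₀) ≤
      ∑ t ∈ range (n + 1), (1 / β t) * ∑ a, gibbs (L t) (β t) a * (L (t + 1) a - L t a) ^ 2
        + β 0 * Real.log K
        + ∑ t ∈ range n, (β (t + 1) - β t) * entropy (gibbs (L (t + 1)) (β (t + 1))) := by
  have hstep : ∀ t ≤ n, gibbs (L t) (β t) ⬝ᵥ (L (t + 1) - L t)
      ≤ (1 / β t) * ∑ a, gibbs (L t) (β t) a * (L (t + 1) a - L t a) ^ 2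
        + freeEnergy (L (t + 1)) (β t) - freeEnergy (L t) (β t) := by
    intro t ht
    have h := freeEnergy_add_ge hK (L t) (L (t + 1) - L t) (hβ t) (fun a => hl t ht a)
    rw [add_sub_cancel] at h
    simp only [Pi.sub_apply] at h
    linarith
  have hind : ∀ m ≤ n, ∑ t ∈ range m, gibbs (L t) (β t) ⬝ᵥ (L (t + 1) - L t) ≤
      ∑ t ∈ range m, (1 / β t) * ∑ a, gibbs (L t) (β t) a * (L (t + 1) a - L t a) ^ 2
        + β 0 * Real.log K
        + ∑ t ∈ range m, (β (t + 1) - β t) * entropy (gibbs (L (t + 1)) (β (t + 1)))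
        + freeEnergy (L m) (β m) := by
    intro m
    induction m with
    | zero => intro _; simp [hL, freeEnergy_zero]
    | succ m ih =>
      intro hm
      have h1 := ih (by omega)
      have h2 := hstep m (by omega)
      have h3 := freeEnergy_sub_le hK (L (m + 1)) (hβ m) (hβ (m + 1))
      simp only [Finset.sum_range_succ]
      linarith
  have h1 := hind n le_rfl
  have h2 := hstep n le_rfl
  -- After the last round the rate stays at `β n`: there are `n + 1` stability terms but only `n`
  -- penalties.
  have h3 := freeEnergy_le_apply (L (n + 1)) (hβ n) a₀
  have h4 : ∑ t ∈ range (n + 1), (L (t + 1) - L t) a₀ = L (n + 1) a₀ := by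
    simp only [Pi.sub_apply]
    rw [Finset.sum_range_sub (fun t => L t a₀), hL]
    simp
  rw [Finset.sum_sub_distrib, h4]
  rw [Finset.sum_range_succ (fun t => gibbs (L t) (β t) ⬝ᵥ (L (t + 1) - L t)),
    Finset.sum_range_succ (fun t => (1 / β t) * ∑ a, gibbs (L t) (β t) a * (L (t + 1) a - L t a) ^ 2)]
  linarith

/-- With losses in `[-β, β]` no arm has almost all of the Gibbs weight. -/
theorem one_sub_gibbs_ge (hK : 2 ≤ K) (L : Fin K → ℝ) {β : ℝ} (hβ : 0 < β)
    (hL : ∀ a, |L a| ≤ β) (a₀ : Fin K) : 1 / 10 ≤ 1 - gibbs L β a₀ := by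
  have hK0 : 0 < K := by omega
  obtain ⟨b, hb⟩ : ∃ b : Fin K, b ≠ a₀ := by
    have : Nontrivial (Fin K) := Fin.nontrivial_iff_two_le.2 hK
    exact exists_ne a₀
  have hsum : gibbs L β a₀ + gibbs L β b ≤ 1 := by
    rw [← sum_gibbs hK0 L β, ← Finset.sum_pair hb.symm]
    exact Finset.sum_le_sum_of_subset_of_nonneg (subset_univ _)
      fun a _ _ => (gibbs_pos hK0 L β a).le
  have hratio : gibbs L β a₀ ≤ Real.exp 2 * gibbs L β b := by
    rw [gibbs, gibbs, ← mul_div_assoc, ← Real.exp_add]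
    have := sum_exp_pos hK0 L β
    gcongr
    have h1 : -L a₀ / β ≤ 1 := by
      rw [div_le_one hβ]; linarith [(abs_le.1 (hL a₀)).1]
    have h2 : -1 ≤ -L b / β := by
      rw [le_div_iff₀ hβ]; linarith [(abs_le.1 (hL b)).2]
    linarith
  -- The weight of `a₀` is then at most nine times that of `b`, hence at most `9 / 10`.
  have he : Real.exp 2 ≤ 9 := by
    have h := Real.exp_one_lt_d9
    have : Real.exp 2 = Real.exp 1 * Real.exp 1 := by rw [← Real.exp_add]; norm_num
    rw [this]
    nlinarith [Real.exp_pos 1]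
  have := gibbs_pos hK0 L β b
  nlinarith

/-! ### The learning rates -/

/-- The rate increment is fixed before the entropy `h` of the next round is known. The `1 +` under
the root makes up for this, since `h ≤ 1`, and the penalties telescope to `√S`. -/
theorem div_sqrt_one_add_le {S h : ℝ} (hS : 0 ≤ S) (h0 : 0 ≤ h) (h1 : h ≤ 1) :
    h * (1 / √(1 + S)) ≤ 2 * (√(S + h) - √S) := by
  have hp : 0 < √(1 + S) := Real.sqrt_pos.2 (by linarith)
  have e1 : √(S + h) ≤ √(1 + S) := Real.sqrt_le_sqrt (by linarith)
  have e2 : √S ≤ √(S + h) := Real.sqrt_le_sqrt (by linarith)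
  have e3 : (√(S + h) - √S) * (√(S + h) + √S) = h := by
    have := Real.mul_self_sqrt hS
    have := Real.mul_self_sqrt (show 0 ≤ S + h by linarith)
    nlinarith
  rw [mul_one_div, div_le_iff₀ hp]
  nlinarith [Real.sqrt_nonneg S]

/-- The entropy penalties and the learning rates, for `S_t = ∑_{s<t} h_s`. -/
theorem rate_bounds (β S h : ℕ → ℝ) (n : ℕ) (hβ0 : 0 < β 0) (hS0 : S 0 = 0)
    (hh : ∀ t, 0 ≤ h t ∧ h t ≤ 1) (hS : ∀ t, S (t + 1) = S t + h t)
    (hβ : ∀ t, β (t + 1) = β t + β 0 * (1 / √(1 + S (t + 1)))) :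
    ∑ t ∈ range n, (β (t + 1) - β t) * h (t + 1) ≤ 2 * β 0 * √(S (n + 1)) ∧
    ∑ t ∈ range (n + 1), 1 / β t ≤
      √(1 + S (n + 1)) / β 0 * (1 + Real.log (n + 1 : ℕ)) := by
  have hmono : Monotone S := monotone_nat_of_le_succ fun t => by rw [hS]; linarith [(hh t).1]
  have hSnn : ∀ t, 0 ≤ S t := fun t => hS0 ▸ hmono (Nat.zero_le t)
  constructor
  · have hind : ∀ m, ∑ t ∈ range m, (β (t + 1) - β t) * h (t + 1) ≤
        2 * β 0 * √(S (m + 1)) := by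
      intro m
      induction m with
      | zero => simp; positivity
      | succ m ih =>
        rw [Finset.sum_range_succ]
        have h1 := div_sqrt_one_add_le (hSnn (m + 1)) (hh (m + 1)).1 (hh (m + 1)).2
        rw [← hS] at h1
        have h2 : β (m + 1) - β m = β 0 * (1 / √(1 + S (m + 1))) := by rw [hβ m]; ring
        rw [h2]
        nlinarith [mul_le_mul_of_nonneg_left h1 hβ0.le]
    exact hind n
  · have hp : 0 < √(1 + S (n + 1)) := Real.sqrt_pos.2 (by linarith [hSnn (n + 1)])
    -- Every increment is at least the one with the final entropy sum, so `β` grows at least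
    -- linearly and `∑ 1 / β` is compared with a harmonic sum.
    have hlow : ∀ t ≤ n, β 0 / √(1 + S (n + 1)) * (t + 1) ≤ β t := by
      intro t
      induction t with
      | zero =>
        intro _
        have : 1 ≤ √(1 + S (n + 1)) := Real.one_le_sqrt.2 (by linarith [hSnn (n + 1)])
        simpa using div_le_self hβ0.le this
      | succ t ih =>
        intro ht
        have h1 := ih (by omega)
        have h2 : β 0 / √(1 + S (n + 1)) ≤ β 0 * (1 / √(1 + S (t + 1))) := by
          rw [mul_one_div]
          have : 0 < √(1 + S (t + 1)) := Real.sqrt_pos.2 (by linarith [hSnn (t + 1)])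
          gcongr
          exact hmono (by omega)
        rw [hβ t]
        push_cast
        linarith
    have hterm : ∀ t ∈ range (n + 1), 1 / β t ≤ √(1 + S (n + 1)) / β 0 * ((t + 1 : ℕ) : ℝ)⁻¹ := by
      intro t ht
      have h1 := hlow t (by rw [Finset.mem_range] at ht; omega)
      have h2 : 0 < β 0 / √(1 + S (n + 1)) * (t + 1) := by positivity
      refine (one_div_le_one_div_of_le h2 h1).trans (le_of_eq ?_)
      push_cast
      field_simp
    refine (Finset.sum_le_sum hterm).trans ?_
    rw [← Finset.mul_sum]
    have hharm := harmonic_le_one_add_log (n + 1)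
    rw [harmonic] at hharm
    push_cast at hharm
    push_cast
    gcongr

/-- All the error terms together are at most of the order `β log K √S`. -/
theorem total_error_le (β S h : ℕ → ℝ) {K n : ℕ} {D D' : ℝ} (hK : 2 ≤ K) (hn : 1 ≤ n)
    (hβ0 : 0 < β 0) (hS0 : S 0 = 0) (hh0 : h 0 = 1)
    (hh : ∀ t, 0 ≤ h t ∧ h t ≤ 1) (hS : ∀ t, S (t + 1) = S t + h t)
    (hβ : ∀ t, β (t + 1) = β t + β 0 * (1 / √(1 + S (t + 1))))
    (hD : β 0 ^ 2 * Real.log K = D * Real.log (n + 1 : ℕ)) (hβpos : ∀ t, 0 < β t)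
    (hDD : D' ≤ 5 / 2 * D) :
    D' * ∑ t ∈ range (n + 1), 1 / β t + β 0 + β 0 * Real.log K
      + Real.log K * ∑ t ∈ range n, (β (t + 1) - β t) * h (t + 1) ≤
      20 * β 0 * Real.log K * √(S (n + 1)) := by
  obtain ⟨h1, h2⟩ := rate_bounds β S h n hβ0 hS0 hh hS hβ
  have hlK : 0.69 ≤ Real.log K :=
    (by linarith [Real.log_two_gt_d9] : (0.69 : ℝ) ≤ Real.log 2).trans
      (Real.log_le_log (by norm_num) (by exact_mod_cast hK))
  have hlT : 0.69 ≤ Real.log (n + 1 : ℕ) :=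
    (by linarith [Real.log_two_gt_d9] : (0.69 : ℝ) ≤ Real.log 2).trans
      (Real.log_le_log (by norm_num) (by exact_mod_cast (by omega : 2 ≤ n + 1)))
  have hmono : Monotone S := monotone_nat_of_le_succ fun t => by rw [hS]; linarith [(hh t).1]
  -- The uniform first iterate has normalised entropy `1`; this lets the terms free of `S` be
  -- absorbed into `√S`.
  have hS1 : 1 ≤ S (n + 1) := by
    have : S 1 = 1 := by rw [hS, hS0, hh0]; ring
    rw [← this]
    exact hmono (by omega)
  set s := √(S (n + 1)) with hs
  have hs1 : 1 ≤ s := Real.one_le_sqrt.2 hS1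
  have hs2 : √(1 + S (n + 1)) ≤ 3 / 2 * s := by
    rw [Real.sqrt_le_left (by positivity), mul_pow, hs, Real.sq_sqrt (by linarith)]
    linarith
  set lT := Real.log (n + 1 : ℕ)
  set lK := Real.log K
  have hDeq : D = β 0 ^ 2 * lK / lT := by
    rw [hD]; field_simp
  have hD0 : 0 ≤ D := by rw [hDeq]; positivity
  have hA : D' * ∑ t ∈ range (n + 1), 1 / β t ≤ 10 * β 0 * lK * s := by
    have hsum0 : 0 ≤ ∑ t ∈ range (n + 1), 1 / β t :=
      Finset.sum_nonneg fun t _ => (one_div_pos.2 (hβpos t)).le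
    calc D' * ∑ t ∈ range (n + 1), 1 / β t ≤ (5 / 2 * D) * (3 / 2 * s / β 0 * (1 + lT)) := by
          refine mul_le_mul hDD (h2.trans ?_) hsum0 (by positivity)
          gcongr
      _ = (β 0 * lK * s) * (15 / 4 * ((1 + lT) / lT)) := by
          rw [hDeq]; field_simp; ring
      _ ≤ (β 0 * lK * s) * 10 := by
          refine mul_le_mul_of_nonneg_left ?_ (by positivity)
          have : (1 + lT) / lT ≤ 5 / 2 := by
            rw [div_le_iff₀ (by linarith)]; linarith
          linarith
      _ = _ := by ring
  have hB : lK * ∑ t ∈ range n, (β (t + 1) - β t) * h (t + 1) ≤ lK * (2 * β 0 * s) :=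
    mul_le_mul_of_nonneg_left h1 (by linarith)
  have hb : 0 < β 0 * lK := by positivity
  -- In units of `β 0 * lK * s`, the four terms are at most `10`, `3 / 2`, `1` and `2`, which is
  -- below `20`.
  have hC : β 0 ≤ 3 / 2 * (β 0 * lK) := by nlinarith
  have hE : β 0 * lK ≤ β 0 * lK * s := by nlinarith
  nlinarith

end BobwFTRL

end

noncomputable section

namespace BobwFTRL

/-! ### Matrices -/

section Matrices

variable {d : ℕ}

theorem dotProduct_mulVec_sq_le {A : Matrix (Fin d) (Fin d) ℝ} (hA : A.PosSemidef)
    (x y : Fin d → ℝ) :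
    (x ⬝ᵥ (A *ᵥ y)) ^ 2 ≤ (x ⬝ᵥ (A *ᵥ x)) * (y ⬝ᵥ (A *ᵥ y)) := by
  have hsymm : ∀ x y : Fin d → ℝ, x ⬝ᵥ (A *ᵥ y) = y ⬝ᵥ (A *ᵥ x) := by
    intro x y
    have hT : Aᵀ = A := by simpa using hA.isHermitian.eq
    rw [Matrix.dotProduct_mulVec, ← Matrix.mulVec_transpose, hT, dotProduct_comm]
  have h := LinearMap.BilinForm.apply_mul_apply_le_of_forall_zero_le (Matrix.toLinearMap₂' ℝ A)
    (fun x => by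
      rw [Matrix.toLinearMap₂'_apply']
      simpa using hA.dotProduct_mulVec_nonneg x) x y
  simp only [Matrix.toLinearMap₂'_apply'] at h
  rw [hsymm y x] at h
  rw [sq]
  exact h

/-- Inversion reverses the order `γ M ≤ N`, tested on one vector. With `v = N⁻¹ z`, Cauchy–Schwarz
for `M` gives `(v·z)² ≤ (vᵀMv)(zᵀM⁻¹z) ≤ (v·z) r / γ`, and one factor `v·z` cancels. -/
theorem dotProduct_inv_mulVec_le {M N : Matrix (Fin d) (Fin d) ℝ} (hM : M.PosDef) (hN : N.PosDef)
    {γ r : ℝ} (hγ : 0 < γ) (hMN : ∀ v : Fin d → ℝ, γ * (v ⬝ᵥ (M *ᵥ v)) ≤ v ⬝ᵥ (N *ᵥ v))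
    {z : Fin d → ℝ} (hz : z ⬝ᵥ (M⁻¹ *ᵥ z) ≤ r) :
    z ⬝ᵥ (N⁻¹ *ᵥ z) ≤ r / γ := by
  set v := N⁻¹ *ᵥ z with hv
  have hNv : N *ᵥ v = z := by
    rw [hv, Matrix.mulVec_mulVec, Matrix.mul_nonsing_inv _ hN.det_pos.ne'.isUnit, Matrix.one_mulVec]
  have hMz : M *ᵥ (M⁻¹ *ᵥ z) = z := by
    rw [Matrix.mulVec_mulVec, Matrix.mul_nonsing_inv _ hM.det_pos.ne'.isUnit, Matrix.one_mulVec]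
  have h1 := dotProduct_mulVec_sq_le hM.posSemidef v (M⁻¹ *ᵥ z)
  rw [hMz, dotProduct_comm (M⁻¹ *ᵥ z) z] at h1
  have h2 := hMN v
  rw [hNv] at h2
  have h3 : 0 ≤ v ⬝ᵥ (M *ᵥ v) := by simpa using hM.posSemidef.dotProduct_mulVec_nonneg v
  have h4 : (v ⬝ᵥ z) ^ 2 ≤ (v ⬝ᵥ (M *ᵥ v)) * r := h1.trans (mul_le_mul_of_nonneg_left hz h3)
  have h5 : 0 ≤ v ⬝ᵥ z := (mul_nonneg hγ.le h3).trans h2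
  have hr : 0 ≤ r := le_trans (by
    simpa using hM.inv.posSemidef.dotProduct_mulVec_nonneg z) hz
  rw [dotProduct_comm z v, le_div_iff₀ hγ]
  rcases h5.eq_or_lt with h0 | h0
  · rw [← h0]; simpa using hr
  · have : (v ⬝ᵥ z) * (v ⬝ᵥ z * γ) ≤ (v ⬝ᵥ z) * r := by nlinarith
    exact le_of_mul_le_mul_left this h0

theorem abs_dotProduct_inv_mulVec_le {M N : Matrix (Fin d) (Fin d) ℝ} (hM : M.PosDef)
    (hN : N.PosDef) {γ r : ℝ} (hγ : 0 < γ)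
    (hMN : ∀ v : Fin d → ℝ, γ * (v ⬝ᵥ (M *ᵥ v)) ≤ v ⬝ᵥ (N *ᵥ v))
    {z w : Fin d → ℝ} (hz : z ⬝ᵥ (M⁻¹ *ᵥ z) ≤ r) (hw : w ⬝ᵥ (M⁻¹ *ᵥ w) ≤ r) :
    |z ⬝ᵥ (N⁻¹ *ᵥ w)| ≤ r / γ := by
  have h1 := dotProduct_mulVec_sq_le hN.inv.posSemidef z w
  have h2 := dotProduct_inv_mulVec_le hM hN hγ hMN hz
  have h3 := dotProduct_inv_mulVec_le hM hN hγ hMN hw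
  have h4 : 0 ≤ z ⬝ᵥ (N⁻¹ *ᵥ z) := by
    simpa using hN.inv.posSemidef.dotProduct_mulVec_nonneg z
  have h5 : 0 ≤ w ⬝ᵥ (N⁻¹ *ᵥ w) := by
    simpa using hN.inv.posSemidef.dotProduct_mulVec_nonneg w
  refine abs_le_of_sq_le_sq (h1.trans ?_) (h4.trans h2)
  rw [sq]
  exact mul_le_mul h2 h3 h5 (h4.trans h2)

/-- Cauchy–Schwarz for `M` at `e_i` and `M⁻¹ z`. The feature set is not assumed bounded; its
boundedness, needed for integrability, is drawn from the exploration policy in this way. -/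
theorem abs_apply_le_of_dotProduct_inv {M : Matrix (Fin d) (Fin d) ℝ} (hM : M.PosDef) {r : ℝ}
    {z : Fin d → ℝ} (hz : z ⬝ᵥ (M⁻¹ *ᵥ z) ≤ r) (i : Fin d) :
    |z i| ≤ √(M i i * r) := by
  have hMz : M *ᵥ (M⁻¹ *ᵥ z) = z := by
    rw [Matrix.mulVec_mulVec, Matrix.mul_nonsing_inv _ hM.det_pos.ne'.isUnit, Matrix.one_mulVec]
  have h1 := dotProduct_mulVec_sq_le hM.posSemidef (Pi.single i 1) (M⁻¹ *ᵥ z)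
  rw [hMz, dotProduct_comm (M⁻¹ *ᵥ z) z] at h1
  have h2 : (Pi.single i 1 : Fin d → ℝ) ⬝ᵥ (M *ᵥ Pi.single i 1) = M i i := by simp
  rw [h2, single_one_dotProduct] at h1
  refine Real.abs_le_sqrt (h1.trans ?_)
  exact mul_le_mul_of_nonneg_left hz hM.diag_pos.le

/-- Adjugate over determinant; with `0⁻¹ = 0` the formula also covers singular matrices. -/
theorem measurable_inv_apply {Ω' : Type*} [MeasurableSpace Ω'] {N : Ω' → Matrix (Fin d) (Fin d) ℝ}
    (hN : ∀ i j, Measurable fun ω => N ω i j) (i j : Fin d) :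
    Measurable fun ω => (N ω)⁻¹ i j := by
  have hdet : ∀ N' : Ω' → Matrix (Fin d) (Fin d) ℝ, (∀ i j, Measurable fun ω => N' ω i j) →
      Measurable fun ω => (N' ω).det := by
    intro N' hN'
    simp only [Matrix.det_apply']
    fun_prop
  have hadj : Measurable fun ω => (N ω).adjugate i j := by
    simp only [Matrix.adjugate_apply]
    refine hdet _ fun k l => ?_
    simp only [Matrix.updateRow_apply]
    split_ifs
    · exact measurable_const
    · exact hN k l
  simp only [Matrix.inv_def, Matrix.smul_apply, Ring.inverse_eq_inv', smul_eq_mul]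
  exact (hdet N hN).inv.mul hadj

theorem measurable_dotProduct_mulVec {Ω' : Type*} [MeasurableSpace Ω']
    {N : Ω' → Matrix (Fin d) (Fin d) ℝ} {v w : Ω' → Fin d → ℝ}
    (hN : ∀ i j, Measurable fun ω => N ω i j) (hv : Measurable v) (hw : Measurable w) :
    Measurable fun ω => v ω ⬝ᵥ (N ω *ᵥ w ω) := by
  unfold dotProduct Matrix.mulVec dotProduct
  fun_prop

end Matrices

/-! ### The design matrix -/

namespace Input

variable {𝒳 : Type*} [MeasurableSpace 𝒳] {K d : ℕ}

theorem measurable_designMatrix {Ω' : Type*} [MeasurableSpace Ω'] (P : Input 𝒳 K d) [SFinite P.G]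
    (hφ : ∀ a, Measurable (P.φ a)) {p : Ω' → 𝒳 → Fin K → ℝ}
    (hp : ∀ a, Measurable fun z : Ω' × 𝒳 => p z.1 z.2 a) (i j : Fin d) :
    Measurable fun ω => P.designMatrix (p ω) i j := by
  simp only [designMatrix, Matrix.of_apply]
  have : Measurable fun z : Ω' × 𝒳 => ∑ a, p z.1 z.2 a * (P.φ a z.2 i * P.φ a z.2 j) := by
    have h : ∀ a (i : Fin d), Measurable fun z : Ω' × 𝒳 => P.φ a z.2 i := fun a i =>
      (measurable_pi_apply i).comp ((hφ a).comp measurable_snd)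
    fun_prop
  exact this.stronglyMeasurable.integral_prod_right.measurable

theorem integrable_weighted (P : Input 𝒳 K d) [IsFiniteMeasure P.G]
    (hφ : ∀ a, Measurable (P.φ a)) {M : ℝ} (hM : ∀ a x i, |P.φ a x i| ≤ M) {p : 𝒳 → Fin K → ℝ}
    (hp : ∀ a, Measurable fun x => p x a) (hps : ∀ x, p x ∈ stdSimplex ℝ (Fin K)) (i j : Fin d)
    (a : Fin K) : Integrable (fun x => p x a * (P.φ a x i * P.φ a x j)) P.G := by
  have h : ∀ i : Fin d, Measurable fun x => P.φ a x i := fun i =>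
    (measurable_pi_apply i).comp (hφ a)
  have hp' := hp a
  have hi := h i
  have hj := h j
  refine Integrable.of_bound (C := 1 * (M * M)) (by fun_prop) (.of_forall fun x => ?_)
  have hM0 : 0 ≤ M := (abs_nonneg _).trans (hM a x i)
  rw [Real.norm_eq_abs, abs_mul, abs_mul]
  have h1 : |p x a| ≤ 1 := by
    rw [abs_of_nonneg ((hps x).1 a)]; exact (mem_Icc_of_mem_stdSimplex (hps x) a).2
  exact mul_le_mul h1 (mul_le_mul (hM a x i) (hM a x j) (abs_nonneg _) hM0) (by positivity)
    (by norm_num)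

/-- `∫ ∑ₐ p(a|x) ⟨C, φ(a,x) φ(a,x)ᵀ⟩ = ⟨C, Σ(p)⟩`. -/
theorem integral_weighted (P : Input 𝒳 K d) [IsFiniteMeasure P.G]
    (hφ : ∀ a, Measurable (P.φ a)) {M : ℝ} (hM : ∀ a x i, |P.φ a x i| ≤ M) {p : 𝒳 → Fin K → ℝ}
    (hp : ∀ a, Measurable fun x => p x a) (hps : ∀ x, p x ∈ stdSimplex ℝ (Fin K))
    (c : Fin d → Fin d → ℝ) :
    ∫ x, ∑ a, p x a * ∑ i, ∑ j, c i j * (P.φ a x i * P.φ a x j) ∂P.G =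
      ∑ i, ∑ j, c i j * P.designMatrix p i j := by
  have hint := P.integrable_weighted hφ hM hp hps
  have e : ∀ x, ∑ a, p x a * ∑ i, ∑ j, c i j * (P.φ a x i * P.φ a x j) =
      ∑ i, ∑ j, c i j * ∑ a, p x a * (P.φ a x i * P.φ a x j) := by
    intro x
    simp only [Finset.mul_sum]
    rw [Finset.sum_comm]
    refine Finset.sum_congr rfl fun i _ => ?_
    rw [Finset.sum_comm]
    refine Finset.sum_congr rfl fun j _ => Finset.sum_congr rfl fun a _ => by ring
  simp only [e]
  have hs : ∀ i j, Integrable (fun x => c i j * ∑ a, p x a * (P.φ a x i * P.φ a x j)) P.G :=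
    fun i j => (integrable_finsetSum _ fun a _ => hint i j a).const_mul _
  rw [integral_finsetSum _ fun i _ => integrable_finsetSum _ fun j _ => hs i j]
  refine Finset.sum_congr rfl fun i _ => ?_
  rw [integral_finsetSum _ fun j _ => hs i j]
  refine Finset.sum_congr rfl fun j _ => ?_
  rw [integral_const_mul]
  rfl

theorem integral_weighted_mul (P : Input 𝒳 K d) [IsFiniteMeasure P.G]
    (hφ : ∀ a, Measurable (P.φ a)) {M : ℝ} (hM : ∀ a x i, |P.φ a x i| ≤ M) {p : 𝒳 → Fin K → ℝ}
    (hp : ∀ a, Measurable fun x => p x a) (hps : ∀ x, p x ∈ stdSimplex ℝ (Fin K))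
    (v w : Fin d → ℝ) :
    ∫ x, ∑ a, p x a * ((v ⬝ᵥ P.φ a x) * (P.φ a x ⬝ᵥ w)) ∂P.G =
      v ⬝ᵥ (P.designMatrix p *ᵥ w) := by
  have h := P.integral_weighted hφ hM hp hps fun i j => v i * w j
  have e1 : ∀ x a, ∑ i, ∑ j, v i * w j * (P.φ a x i * P.φ a x j) =
      (v ⬝ᵥ P.φ a x) * (P.φ a x ⬝ᵥ w) := by
    intro x a
    simp only [dotProduct, Finset.sum_mul_sum]
    exact Finset.sum_congr rfl fun i _ => Finset.sum_congr rfl fun j _ => by ring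
  simp only [e1] at h
  rw [h]
  simp only [dotProduct, Matrix.mulVec, Finset.mul_sum]
  exact Finset.sum_congr rfl fun i _ => Finset.sum_congr rfl fun j _ => by ring

theorem designMatrix_isSymm (P : Input 𝒳 K d) (p : 𝒳 → Fin K → ℝ) :
    (P.designMatrix p)ᵀ = P.designMatrix p := by
  ext i j
  simp only [designMatrix, Matrix.transpose_apply, Matrix.of_apply]
  congr 1
  ext x
  exact Finset.sum_congr rfl fun a _ => by ring

/-- The integral is the trace of `Σ(p)⁻¹ Σ(p)`. This is where the dimension `d` enters in place of
the number of arms. -/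
theorem integral_weighted_inv (P : Input 𝒳 K d) [IsFiniteMeasure P.G]
    (hφ : ∀ a, Measurable (P.φ a)) {M : ℝ} (hM : ∀ a x i, |P.φ a x i| ≤ M) {p : 𝒳 → Fin K → ℝ}
    (hp : ∀ a, Measurable fun x => p x a) (hps : ∀ x, p x ∈ stdSimplex ℝ (Fin K))
    (hpos : (P.designMatrix p).PosDef) :
    ∫ x, ∑ a, p x a * (P.φ a x ⬝ᵥ ((P.designMatrix p)⁻¹ *ᵥ P.φ a x)) ∂P.G = d := by
  have h := P.integral_weighted hφ hM hp hps fun i j => (P.designMatrix p)⁻¹ i j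
  have e1 : ∀ x a, ∑ i, ∑ j, (P.designMatrix p)⁻¹ i j * (P.φ a x i * P.φ a x j) =
      P.φ a x ⬝ᵥ ((P.designMatrix p)⁻¹ *ᵥ P.φ a x) := by
    intro x a
    simp only [dotProduct, Matrix.mulVec, Finset.mul_sum]
    exact Finset.sum_congr rfl fun i _ => Finset.sum_congr rfl fun j _ => by ring
  simp only [e1] at h
  rw [h]
  have h2 : ((P.designMatrix p)⁻¹ * (P.designMatrix p)ᵀ).trace = d := by
    rw [P.designMatrix_isSymm, Matrix.nonsing_inv_mul _ hpos.det_pos.ne'.isUnit, Matrix.trace_one,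
      Fintype.card_fin]
  rw [← h2]
  rfl

/-- Mixing in the exploration policy keeps the design matrix positive definite, and bounds its
inverse on the features. -/
theorem designMatrix_mixture (P : Input 𝒳 K d) [IsFiniteMeasure P.G]
    (hφ : ∀ a, Measurable (P.φ a)) {M : ℝ} (hM : ∀ a x i, |P.φ a x i| ≤ M) {p e : 𝒳 → Fin K → ℝ}
    (hp : ∀ a, Measurable fun x => p x a) (hps : ∀ x, p x ∈ stdSimplex ℝ (Fin K))
    (he : ∀ a, Measurable fun x => e x a) (hes : ∀ x, e x ∈ stdSimplex ℝ (Fin K))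
    (hpos : (P.designMatrix e).PosDef) {γ : ℝ} (hγ : 0 < γ) (hpe : ∀ x a, γ * e x a ≤ p x a) :
    (P.designMatrix p).PosDef ∧
    ∀ v : Fin d → ℝ, γ * (v ⬝ᵥ (P.designMatrix e *ᵥ v)) ≤ v ⬝ᵥ (P.designMatrix p *ᵥ v) := by
  have key : ∀ v : Fin d → ℝ,
      γ * (v ⬝ᵥ (P.designMatrix e *ᵥ v)) ≤ v ⬝ᵥ (P.designMatrix p *ᵥ v) := by
    intro v
    have hint : ∀ r : 𝒳 → Fin K → ℝ, (∀ a, Measurable fun x => r x a) →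
        (∀ x, r x ∈ stdSimplex ℝ (Fin K)) →
        Integrable (fun x => ∑ a, r x a * ((v ⬝ᵥ P.φ a x) * (P.φ a x ⬝ᵥ v))) P.G := by
      intro r hr hrs
      refine integrable_finsetSum _ fun a _ => ?_
      have e1 : ∀ x, r x a * ((v ⬝ᵥ P.φ a x) * (P.φ a x ⬝ᵥ v)) =
          ∑ i, ∑ j, v i * v j * (r x a * (P.φ a x i * P.φ a x j)) := by
        intro x
        simp only [dotProduct]
        rw [Finset.sum_mul_sum, Finset.mul_sum]
        refine Finset.sum_congr rfl fun i _ => ?_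
        rw [Finset.mul_sum]
        exact Finset.sum_congr rfl fun j _ => by ring
      simp only [e1]
      exact integrable_finsetSum _ fun i _ => integrable_finsetSum _ fun j _ =>
        (P.integrable_weighted hφ hM hr hrs i j a).const_mul _
    rw [← P.integral_weighted_mul hφ hM hp hps, ← P.integral_weighted_mul hφ hM he hes,
      ← integral_const_mul]
    refine integral_mono ((hint e he hes).const_mul _) (hint p hp hps) fun x => ?_
    simp only [Finset.mul_sum]
    refine Finset.sum_le_sum fun a _ => ?_
    rw [dotProduct_comm (P.φ a x) v, ← mul_assoc]
    exact mul_le_mul_of_nonneg_right (hpe x a) (mul_self_nonneg _)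
  refine ⟨Matrix.PosDef.of_dotProduct_mulVec_pos ?_ fun v hv => ?_, key⟩
  · simpa [Matrix.IsHermitian] using P.designMatrix_isSymm p
  · have h1 := hpos.dotProduct_mulVec_pos hv
    simp only [star_trivial] at h1 ⊢
    exact lt_of_lt_of_le (mul_pos hγ h1) (key v)

end Input

end BobwFTRL

end

noncomputable section

namespace BobwFTRL

variable {𝒳 : Type*} [MeasurableSpace 𝒳] {K d : ℕ}

/-! ### The states of the algorithm -/

namespace Input

/-- The calibration of `η_1` that makes the sum of the learning rates, weighted by `1/λ + d`, of the
same order as the entropy penalties. -/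
theorem invRateOne_sq (P : Input 𝒳 K d) (hK : 2 ≤ K) (hT : 2 ≤ P.T) (hlam : 0 < P.lam) :
    P.invRateOne ^ 2 * Real.log K = (1 / P.lam + d) * Real.log P.T ∧ 0 < P.invRateOne := by
  have hlK : 0 < Real.log K := Real.log_pos (by exact_mod_cast hK)
  have hlT : 0 < Real.log P.T := Real.log_pos (by exact_mod_cast hT)
  have hD : 0 < 1 / P.lam + d := by positivity
  have hpos : 0 < (1 / P.lam + d) * Real.log P.T / Real.log K := by positivity
  refine ⟨?_, Real.sqrt_pos.2 hpos⟩
  rw [invRateOne, Real.sq_sqrt hpos.le]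
  field_simp

section Run

variable (P : Input 𝒳 K d) (X : ℕ → 𝒳) (A : ℕ → Fin K) (y : ℕ → ℝ)

theorem run_invRate_succ (t : ℕ) : (P.run X A y (t + 1)).invRate = (P.run X A y t).invRate +
    P.invRateOne * (1 / √(1 + (Real.log K)⁻¹ * (P.run X A y (t + 1)).cumEntropy)) := rfl

theorem invRateOne_nonneg : 0 ≤ P.invRateOne := Real.sqrt_nonneg _

theorem invRateOne_le_run_invRate (t : ℕ) : P.invRateOne ≤ (P.run X A y t).invRate := by
  induction t with
  | zero => exact le_rfl
  | succ t ih =>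
    rw [run_invRate_succ]
    have := mul_nonneg P.invRateOne_nonneg (one_div_nonneg.2 (Real.sqrt_nonneg
      (1 + (Real.log K)⁻¹ * (P.run X A y (t + 1)).cumEntropy)))
    linarith

theorem run_q_eq_gibbs (hK : 0 < K) (hβ : 0 < P.invRateOne) (t : ℕ) (x : 𝒳) :
    (P.run X A y t).q x = gibbs ((P.run X A y t).cumLoss x) (P.run X A y t).invRate := by
  cases t with
  | zero => exact (gibbs_zero _).symm
  | succ t =>
    exact ftrlArgmin_eq_gibbs hK _ (hβ.trans_le (P.invRateOne_le_run_invRate X A y (t + 1)))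

theorem run_q_mem (hK : 0 < K) (hβ : 0 < P.invRateOne) (t : ℕ) (x : 𝒳) :
    (P.run X A y t).q x ∈ stdSimplex ℝ (Fin K) := by
  rw [P.run_q_eq_gibbs X A y hK hβ]
  exact gibbs_mem_stdSimplex hK _ _

end Run

end Input

/-! ### Measurability of the states -/

/-- Joint measurability of the components of a random state. -/
structure MeasurableState {Ω' : Type*} [MeasurableSpace Ω']
    (s : Ω' → State 𝒳 K) : Prop where
  cumLoss : ∀ a, Measurable fun z : Ω' × 𝒳 => (s z.1).cumLoss z.2 a
  invRate : Measurable fun ω => (s ω).invRate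
  cumEntropy : Measurable fun ω => (s ω).cumEntropy
  q : ∀ a, Measurable fun z : Ω' × 𝒳 => (s z.1).q z.2 a

theorem MeasurableState.mono {Ω' : Type*} {m m' : MeasurableSpace Ω'}
    (hm : m ≤ m') {s : Ω' → State 𝒳 K} (hs : @MeasurableState 𝒳 _ K Ω' m s) :
    @MeasurableState 𝒳 _ K Ω' m' s := by
  have h : m.prod ‹MeasurableSpace 𝒳› ≤ m'.prod ‹MeasurableSpace 𝒳› :=
    sup_le_sup (MeasurableSpace.comap_mono hm) le_rfl
  refine @MeasurableState.mk 𝒳 _ K Ω' m' s ?_ ?_ ?_ ?_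
  · exact fun a => (@MeasurableState.cumLoss 𝒳 _ K Ω' m s hs a).mono h le_rfl
  · exact (@MeasurableState.invRate 𝒳 _ K Ω' m s hs).mono hm le_rfl
  · exact (@MeasurableState.cumEntropy 𝒳 _ K Ω' m s hs).mono hm le_rfl
  · exact fun a => (@MeasurableState.q 𝒳 _ K Ω' m s hs a).mono h le_rfl

namespace Input

section Measurability

variable {Ω' : Type*} [MeasurableSpace Ω'] (P : Input 𝒳 K d) {s : Ω' → State 𝒳 K}

theorem measurable_mixing (hs : MeasurableState s) :
    Measurable fun ω => P.mixing (s ω).invRate := by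
  have := hs.invRate
  unfold mixing
  fun_prop

theorem measurable_policy (he : ∀ a, Measurable fun x => P.eStar x a) (hs : MeasurableState s)
    (a : Fin K) : Measurable fun z : Ω' × 𝒳 => P.policy (s z.1) z.2 a := by
  have h1 : Measurable fun z : Ω' × 𝒳 => P.mixing (s z.1).invRate :=
    (P.measurable_mixing hs).comp measurable_fst
  have h2 := hs.q a
  have h3 : Measurable fun z : Ω' × 𝒳 => P.eStar z.2 a := (he a).comp measurable_snd
  unfold policy
  fun_prop

theorem measurable_policy_inv [SFinite P.G] (hφ : ∀ a, Measurable (P.φ a))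
    (he : ∀ a, Measurable fun x => P.eStar x a) (hs : MeasurableState s) (i j : Fin d) :
    Measurable fun ω => (P.designMatrix (P.policy (s ω)))⁻¹ i j :=
  measurable_inv_apply (P.measurable_designMatrix hφ (P.measurable_policy he hs)) i j

theorem measurable_feature {Ω' : Type*} [MeasurableSpace Ω'] (hφ : ∀ a, Measurable (P.φ a))
    {A : Ω' → Fin K} {X : Ω' → 𝒳} (hA : Measurable A) (hX : Measurable X) :
    Measurable fun ω => P.φ (A ω) (X ω) := by
  have h : Measurable fun p : Fin K × 𝒳 => P.φ p.1 p.2 := measurable_from_prod_countable_right hφ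
  exact h.comp (hA.prodMk hX)

/-- The delicate component is `q`, defined by choice; it is measurable because it equals the Gibbs
formula, which needs a positive inverse rate. -/
theorem measurableState_step [SFinite P.G] (hK : 0 < K) (hβ : 0 < P.invRateOne)
    (hφ : ∀ a, Measurable (P.φ a)) (he : ∀ a, Measurable fun x => P.eStar x a)
    (hs : MeasurableState s) (hinv : ∀ ω, P.invRateOne ≤ (s ω).invRate)
    {X : Ω' → 𝒳} {A : Ω' → Fin K} {y : Ω' → ℝ}
    (hX : Measurable X) (hA : Measurable A) (hy : Measurable y) :
    MeasurableState fun ω => P.step (s ω) (X ω) (A ω) (y ω) := by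
  have hcum : ∀ a, Measurable fun z : Ω' × 𝒳 =>
      (P.step (s z.1) (X z.1) (A z.1) (y z.1)).cumLoss z.2 a := by
    intro a
    refine (hs.cumLoss a).add ?_
    have h1 : Measurable fun z : Ω' × 𝒳 => P.φ a z.2 ⬝ᵥ
        ((P.designMatrix (P.policy (s z.1)))⁻¹ *ᵥ P.φ (A z.1) (X z.1)) :=
      measurable_dotProduct_mulVec
        (fun i j => (P.measurable_policy_inv hφ he hs i j).comp measurable_fst)
        ((hφ a).comp measurable_snd) ((P.measurable_feature hφ hA hX).comp measurable_fst)
    simp only [thetaHat, dotProduct_smul]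
    exact (hy.comp measurable_fst).mul h1
  have hent : Measurable fun ω => (P.step (s ω) (X ω) (A ω) (y ω)).cumEntropy := by
    refine hs.cumEntropy.add ?_
    unfold entropy
    refine Finset.measurable_sum _ fun a _ => Real.continuous_negMulLog.measurable.comp ?_
    exact (hs.q a).comp (measurable_id.prodMk hX)
  have hrate : Measurable fun ω => (P.step (s ω) (X ω) (A ω) (y ω)).invRate := by
    refine hs.invRate.add ?_
    change Measurable fun ω => P.invRateOne * (1 / √(1 + (Real.log K)⁻¹ *
      (P.step (s ω) (X ω) (A ω) (y ω)).cumEntropy))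
    fun_prop
  refine ⟨hcum, hrate, hent, fun a => ?_⟩
  have hpos : ∀ ω, 0 < (P.step (s ω) (X ω) (A ω) (y ω)).invRate := fun ω =>
    add_pos_of_pos_of_nonneg (hβ.trans_le (hinv ω))
      (mul_nonneg hβ.le (one_div_nonneg.2 (Real.sqrt_nonneg _)))
  have e : (fun z : Ω' × 𝒳 => (P.step (s z.1) (X z.1) (A z.1) (y z.1)).q z.2 a) = fun z =>
      gibbs ((P.step (s z.1) (X z.1) (A z.1) (y z.1)).cumLoss z.2)
        (P.step (s z.1) (X z.1) (A z.1) (y z.1)).invRate a := by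
    ext z
    rw [← ftrlArgmin_eq_gibbs hK _ (hpos z.1)]
    rfl
  rw [e]
  unfold gibbs
  have hrate' : Measurable fun z : Ω' × 𝒳 => (P.step (s z.1) (X z.1) (A z.1) (y z.1)).invRate :=
    hrate.comp measurable_fst
  generalize hR : (fun z : Ω' × 𝒳 => (P.step (s z.1) (X z.1) (A z.1) (y z.1)).invRate) = R
    at hrate'
  generalize hC : (fun (a : Fin K) (z : Ω' × 𝒳) =>
    (P.step (s z.1) (X z.1) (A z.1) (y z.1)).cumLoss z.2 a) = C
  have hcum' : ∀ a, Measurable (C a) := fun a => by rw [← hC]; exact hcum a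
  have e2 : (fun z : Ω' × 𝒳 =>
      Real.exp (-(P.step (s z.1) (X z.1) (A z.1) (y z.1)).cumLoss z.2 a /
        (P.step (s z.1) (X z.1) (A z.1) (y z.1)).invRate) /
      ∑ b, Real.exp (-(P.step (s z.1) (X z.1) (A z.1) (y z.1)).cumLoss z.2 b /
        (P.step (s z.1) (X z.1) (A z.1) (y z.1)).invRate)) =
      fun z => Real.exp (-C a z / R z) / ∑ b, Real.exp (-C b z / R z) := by
    rw [← hR, ← hC]
  rw [e2]
  fun_prop

end Measurability

theorem measurableState_init {Ω' : Type*} [MeasurableSpace Ω'] (P : Input 𝒳 K d) :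
    MeasurableState fun _ : Ω' => P.init :=
  ⟨fun _ => measurable_const, measurable_const, measurable_const, fun _ => measurable_const⟩

end Input

namespace Bandit

variable {Ω : Type*}

/-- The state in which the algorithm enters round `t + 1`. -/
def state (B : Bandit Ω 𝒳 K d) (P : Input 𝒳 K d) (t : ℕ) (ω : Ω) : State 𝒳 K :=
  P.run (fun s => B.X s ω) (fun s => B.A s ω) (fun s => B.loss P s ω (B.A s ω) (B.X s ω)) t

theorem nextPolicy_eq (B : Bandit Ω 𝒳 K d) (P : Input 𝒳 K d) (t : ℕ) (ω : Ω) :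
    B.nextPolicy P t ω = P.policy (B.state P t ω) := rfl

theorem measurableState_state [mΩ : MeasurableSpace Ω] {B : Bandit Ω 𝒳 K d} {P : Input 𝒳 K d}
    [SFinite P.G] {Z Θ : Set (Fin d → ℝ)} {ℱ : Filtration ℕ mΩ} {μ : Measure Ω}
    (hK : 0 < K) (hβ : 0 < P.invRateOne) (hE : P.IsExploration Z)
    (hB : B.IsInteraction P Z Θ ℱ μ) {t : ℕ} (ht : t ≤ P.T) :
    @MeasurableState 𝒳 _ K Ω (ℱ t) (B.state P t) := by
  induction t with
  | zero => exact @Input.measurableState_init 𝒳 _ K d Ω (ℱ 0) P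
  | succ t ih =>
    have h := (ih (by omega)).mono (ℱ.mono (Nat.le_succ t))
    exact @Input.measurableState_step 𝒳 _ K d Ω (ℱ (t + 1)) P (B.state P t) _ hK hβ
      hB.measurable_φ hE.measurable_eStar h (fun ω => P.invRateOne_le_run_invRate _ _ _ t)
      _ _ _ (hB.measurable_X t ht) (hB.measurable_A t ht) (hB.measurable_obs t ht)

end Bandit

end BobwFTRL

end

noncomputable section

namespace BobwFTRL

variable {𝒳 : Type*} [MeasurableSpace 𝒳] {K d : ℕ}

/-! ### Integration against an independent copy -/

section Independent

variable {Ω : Type*} {m mΩ : MeasurableSpace Ω} {μ : Measure Ω}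

/-- `Ω₀` is meant to be `Ω` with a smaller σ-algebra and `i` the identity, so that independence from
a σ-algebra becomes independence of two maps. -/
theorem integral_comp_indepFun [IsProbabilityMeasure μ] {Ω₀ : Type*} [MeasurableSpace Ω₀]
    {i : Ω → Ω₀} (hi : Measurable i)
    {X : Ω → 𝒳} (hX : Measurable X) (hind : IndepFun i X μ) {F : Ω₀ × 𝒳 → ℝ} (hF : Measurable F) :
    ∫ ω, F (i ω, X ω) ∂μ = ∫ z, F (i z.1, z.2) ∂(μ.prod (μ.map X)) := by
  have := Measure.isProbabilityMeasure_map (μ := μ) hX.aemeasurable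
  have e1 := integral_map (μ := μ) (hi.prodMk hX).aemeasurable (f := F) hF.aestronglyMeasurable
  have e2 := integral_map (μ := μ.prod (μ.map X)) (hi.prodMap measurable_id).aemeasurable (f := F)
    hF.aestronglyMeasurable
  rw [(indepFun_iff_map_prod_eq_prod_map_map hi.aemeasurable hX.aemeasurable).1 hind] at e1
  rw [← Measure.map_prod_map _ _ hi measurable_id, Measure.map_id] at e2
  exact e1.symm.trans e2

/-- If `X` is independent of `m`, then in `F (ω, X ω)`, with `F` measurable for `m` in the first
variable, `X` may be replaced by an independent copy. -/
theorem integral_comp_indep [IsProbabilityMeasure μ] (hm : m ≤ mΩ) {X : Ω → 𝒳} (hX : Measurable X)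
    (hind : Indep (MeasurableSpace.comap X inferInstance) m μ) {F : Ω × 𝒳 → ℝ}
    (hF : Measurable[m.prod ‹MeasurableSpace 𝒳›] F) :
    ∫ ω, F (ω, X ω) ∂μ = ∫ z, F z ∂(μ.prod (μ.map X)) := by
  have hindf : @IndepFun Ω Ω 𝒳 mΩ m _ id X μ := by
    rw [@IndepFun_iff_Indep Ω Ω 𝒳 mΩ m _ id X μ, MeasurableSpace.comap_id]
    exact hind.symm
  exact @integral_comp_indepFun 𝒳 _ Ω mΩ μ _ Ω m id (measurable_id'' hm) X hX hindf F hF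

theorem measurable_comp_sup_comap {X : Ω → 𝒳} {F : Ω × 𝒳 → ℝ}
    (hF : Measurable[m.prod ‹MeasurableSpace 𝒳›] F) :
    Measurable[m ⊔ MeasurableSpace.comap X inferInstance] fun ω => F (ω, X ω) := by
  have h1 : Measurable[m ⊔ MeasurableSpace.comap X inferInstance, m] (id : Ω → Ω) :=
    measurable_id'' le_sup_left
  have h2 : Measurable[m ⊔ MeasurableSpace.comap X inferInstance] X :=
    (comap_measurable X).mono le_sup_right le_rfl
  exact hF.comp (@Measurable.prodMk Ω (m ⊔ MeasurableSpace.comap X inferInstance) Ω 𝒳 m _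
    id X h1 h2)

theorem measurable_prod_mono (hm : m ≤ mΩ) {F : Ω × 𝒳 → ℝ}
    (hF : Measurable[m.prod ‹MeasurableSpace 𝒳›] F) : Measurable F :=
  hF.mono (sup_le_sup (MeasurableSpace.comap_mono hm) le_rfl) le_rfl

theorem ae_prod_of_ae_fst {ν : Measure 𝒳} [IsProbabilityMeasure ν] {p : Ω → Prop}
    (hp : ∀ᵐ ω ∂μ, p ω) : ∀ᵐ z ∂(μ.prod ν), p z.1 :=
  Measure.quasiMeasurePreserving_fst.ae hp

theorem integrable_prod_of_bound [IsProbabilityMeasure μ] {ν : Measure 𝒳} [IsProbabilityMeasure ν]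
    {F : Ω × 𝒳 → ℝ}
    (hF : Measurable F) {C : ℝ} (hC : ∀ᵐ ω ∂μ, ∀ x, |F (ω, x)| ≤ C) :
    Integrable F (μ.prod ν) :=
  Integrable.of_bound hF.aestronglyMeasurable C ((ae_prod_of_ae_fst hC).mono fun z h => h z.2)

theorem integral_mul_eq_of_condExp [IsFiniteMeasure μ] (hm : m ≤ mΩ) {f g h : Ω → ℝ}
    (hf : Measurable[m] f)
    (hg : Integrable g μ) (hfg : Integrable (f * g) μ) (hh : μ[g | m] =ᵐ[μ] h) :
    ∫ ω, f ω * g ω ∂μ = ∫ ω, f ω * h ω ∂μ := by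
  have h1 := condExp_mul_of_stronglyMeasurable_left (m := m) (μ := μ) (f := f) (g := g)
    hf.stronglyMeasurable hfg hg
  have h2 := integral_condExp (μ := μ) (f := f * g) hm
  rw [← integral_congr_ae (f := (f * g : Ω → ℝ)) (g := fun ω => f ω * g ω) (.of_forall fun _ => rfl),
    ← h2]
  refine integral_congr_ae ?_
  filter_upwards [h1, hh] with ω h3 h4
  rw [h3, Pi.mul_apply, h4]

end Independent

/-! ### Pathwise bounds on rates, mixing weights, policies and features -/

namespace Bandit

variable {Ω : Type*}

theorem invRateOne_le_state (P : Input 𝒳 K d) (B : Bandit Ω 𝒳 K d) (t : ℕ) (ω : Ω) :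
    P.invRateOne ≤ (B.state P t ω).invRate :=
  P.invRateOne_le_run_invRate _ _ _ t

variable [mΩ : MeasurableSpace Ω]

/-- The assumptions of the regret analysis. -/
structure IsRun (B : Bandit Ω 𝒳 K d) (P : Input 𝒳 K d) (Z Θ : Set (Fin d → ℝ))
    (ℱ : Filtration ℕ mΩ) (μ : Measure Ω) : Prop where
  two_le_K : 2 ≤ K
  two_le_T : 2 ≤ P.T
  exploration : P.IsExploration Z
  mixing_le : P.mixing P.invRateOne ≤ 1
  interaction : B.IsInteraction P Z Θ ℱ μ

namespace IsRun

variable {B : Bandit Ω 𝒳 K d} {P : Input 𝒳 K d} {Z Θ : Set (Fin d → ℝ)} {ℱ : Filtration ℕ mΩ}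
  {μ : Measure Ω}

theorem K_pos (h : B.IsRun P Z Θ ℱ μ) : 0 < K := by have := h.two_le_K; omega

theorem invRateOne_pos (h : B.IsRun P Z Θ ℱ μ) : 0 < P.invRateOne :=
  (P.invRateOne_sq h.two_le_K h.two_le_T h.exploration.lam_pos).2

theorem measurable_X (h : B.IsRun P Z Θ ℱ μ) {t : ℕ} (ht : t < P.T) : Measurable (B.X (t + 1)) :=
  (h.interaction.measurable_X t ht).mono (ℱ.le _) le_rfl

theorem measurable_A (h : B.IsRun P Z Θ ℱ μ) {t : ℕ} (ht : t < P.T) : Measurable (B.A (t + 1)) :=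
  (h.interaction.measurable_A t ht).mono (ℱ.le _) le_rfl

theorem measurable_θ (h : B.IsRun P Z Θ ℱ μ) {t : ℕ} (ht : t < P.T) : Measurable (B.θ (t + 1)) :=
  (h.interaction.measurable_θ t ht).mono (ℱ.le _) le_rfl

theorem invRate_pos (h : B.IsRun P Z Θ ℱ μ) (t : ℕ) (ω : Ω) : 0 < (B.state P t ω).invRate :=
  h.invRateOne_pos.trans_le (invRateOne_le_state P B t ω)

theorem q_mem (h : B.IsRun P Z Θ ℱ μ) (t : ℕ) (ω : Ω) (x : 𝒳) :
    (B.state P t ω).q x ∈ stdSimplex ℝ (Fin K) :=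
  P.run_q_mem _ _ _ h.K_pos h.invRateOne_pos t x

theorem q_eq_gibbs (h : B.IsRun P Z Θ ℱ μ) (t : ℕ) (ω : Ω) (x : 𝒳) :
    (B.state P t ω).q x = gibbs ((B.state P t ω).cumLoss x) (B.state P t ω).invRate :=
  P.run_q_eq_gibbs _ _ _ h.K_pos h.invRateOne_pos t x

theorem cumEntropy_nonneg (h : B.IsRun P Z Θ ℱ μ) (t : ℕ) (ω : Ω) :
    0 ≤ (B.state P t ω).cumEntropy := by
  induction t with
  | zero => exact le_rfl
  | succ t ih => exact add_nonneg ih (entropy_nonneg (h.q_mem t ω _))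

theorem invRate_le (h : B.IsRun P Z Θ ℱ μ) (t : ℕ) (ω : Ω) :
    (B.state P t ω).invRate ≤ P.invRateOne * (t + 1) := by
  induction t with
  | zero => simp [state, Input.run, Input.init]
  | succ t ih =>
    have hlK : 0 ≤ (Real.log K)⁻¹ := inv_nonneg.2 (Real.log_natCast_nonneg K)
    have h1 : 1 / √(1 + (Real.log K)⁻¹ * (B.state P (t + 1) ω).cumEntropy) ≤ 1 := by
      have : 1 ≤ √(1 + (Real.log K)⁻¹ * (B.state P (t + 1) ω).cumEntropy) := Real.one_le_sqrt.2
        (le_add_of_nonneg_right (mul_nonneg hlK (h.cumEntropy_nonneg (t + 1) ω)))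
      exact (div_le_one (by linarith)).2 this
    have h2 := mul_le_mul_of_nonneg_left h1 h.invRateOne_pos.le
    have h3 : (B.state P (t + 1) ω).invRate = (B.state P t ω).invRate + P.invRateOne *
        (1 / √(1 + (Real.log K)⁻¹ * (B.state P (t + 1) ω).cumEntropy)) :=
      P.run_invRate_succ _ _ _ t
    rw [h3]
    push_cast
    linarith

theorem mixing_pos (h : B.IsRun P Z Θ ℱ μ) (t : ℕ) (ω : Ω) :
    0 < P.mixing (B.state P t ω).invRate :=
  div_pos (one_div_pos.2 (h.invRate_pos t ω)) h.exploration.lam_pos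

theorem mixing_state_le_one (h : B.IsRun P Z Θ ℱ μ) (t : ℕ) (ω : Ω) :
    P.mixing (B.state P t ω).invRate ≤ 1 := by
  refine le_trans ?_ h.mixing_le
  unfold Input.mixing
  have := h.exploration.lam_pos
  have := h.invRateOne_pos
  gcongr
  exact invRateOne_le_state P B t ω

/-- From the second round on the algorithm explores with probability at most `3/5`. -/
theorem mixing_state_le (h : B.IsRun P Z Θ ℱ μ) {t : ℕ} (ht : 1 ≤ t) (ω : Ω) :
    P.mixing (B.state P t ω).invRate ≤ 3 / 5 := by
  have hβ := h.invRateOne_pos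
  have hlam := h.exploration.lam_pos
  have hK := h.two_le_K
  have hmono : ∀ s, (B.state P s ω).invRate ≤ (B.state P (s + 1) ω).invRate := fun s => by
    have h3 : (B.state P (s + 1) ω).invRate = (B.state P s ω).invRate + P.invRateOne *
        (1 / √(1 + (Real.log K)⁻¹ * (B.state P (s + 1) ω).cumEntropy)) :=
      P.run_invRate_succ _ _ _ s
    rw [h3]
    exact le_add_of_nonneg_right (mul_nonneg hβ.le (one_div_nonneg.2 (Real.sqrt_nonneg _)))
  -- The uniform first iterate has entropy `log K`, so the first increment is `invRateOne / √2`, and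
  -- `1 + 1 / √2 ≥ 5 / 3`.
  have h1 : P.invRateOne * (5 / 3) ≤ (B.state P t ω).invRate := by
    refine le_trans ?_ (monotone_nat_of_le_succ hmono ht)
    have h3 : (B.state P 1 ω).invRate = P.invRateOne + P.invRateOne *
        (1 / √(1 + (Real.log K)⁻¹ * (0 + entropy (fun _ : Fin K => 1 / (K : ℝ))))) := rfl
    rw [h3, entropy_uniform h.K_pos, zero_add,
      inv_mul_cancel₀ (Real.log_pos (by exact_mod_cast hK)).ne']
    have h4 : √(1 + 1) ≤ 3 / 2 := by
      rw [Real.sqrt_le_left (by norm_num)]; norm_num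
    have h5 : 2 / 3 ≤ 1 / √(1 + 1 : ℝ) := by
      rw [le_div_iff₀ (Real.sqrt_pos.2 (by norm_num))]; linarith
    nlinarith
  have h2 : P.mixing (B.state P t ω).invRate ≤ P.mixing (P.invRateOne * (5 / 3)) := by
    unfold Input.mixing
    gcongr
  have h6 : P.mixing (P.invRateOne * (5 / 3)) = 3 / 5 * P.mixing P.invRateOne := by
    unfold Input.mixing
    field_simp
  linarith [h.mixing_le]

theorem policy_mem (h : B.IsRun P Z Θ ℱ μ) (t : ℕ) (ω : Ω) (x : 𝒳) :
    B.nextPolicy P t ω x ∈ stdSimplex ℝ (Fin K) :=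
  convex_stdSimplex ℝ (Fin K) (h.q_mem t ω x) (h.exploration.eStar_mem x)
    (sub_nonneg.2 (h.mixing_state_le_one t ω)) (h.mixing_pos t ω).le (by ring)

theorem mul_q_le_policy (h : B.IsRun P Z Θ ℱ μ) (t : ℕ) (ω : Ω) (x : 𝒳) (a : Fin K) :
    (1 - P.mixing (B.state P t ω).invRate) * (B.state P t ω).q x a ≤ B.nextPolicy P t ω x a :=
  le_add_of_nonneg_right (mul_nonneg (h.mixing_pos t ω).le ((h.exploration.eStar_mem x).1 a))

theorem mul_eStar_le_policy (h : B.IsRun P Z Θ ℱ μ) (t : ℕ) (ω : Ω) (x : 𝒳) (a : Fin K) :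
    P.mixing (B.state P t ω).invRate * P.eStar x a ≤ B.nextPolicy P t ω x a :=
  le_add_of_nonneg_left (mul_nonneg (sub_nonneg.2 (h.mixing_state_le_one t ω))
    ((h.q_mem t ω x).1 a))

theorem exists_feature_bound (h : B.IsRun P Z Θ ℱ μ) :
    ∃ M : ℝ, ∀ a x i, |P.φ a x i| ≤ M := by
  refine ⟨∑ j, √(P.designMatrix P.eStar j j * (1 / P.lam)), fun a x i => ?_⟩
  refine (abs_apply_le_of_dotProduct_inv h.exploration.posDef
    (h.exploration.le_inv_lam _ (h.interaction.φ_mem a x)) i).trans ?_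
  exact Finset.single_le_sum (f := fun j => √(P.designMatrix P.eStar j j * (1 / P.lam)))
    (fun _ _ => Real.sqrt_nonneg _) (mem_univ i)

theorem ae_inner_le (h : B.IsRun P Z Θ ℱ μ) {t : ℕ} (ht : t < P.T) :
    ∀ᵐ ω ∂μ, ∀ a x, |P.φ a x ⬝ᵥ B.θ (t + 1) ω| ≤ 1 := by
  filter_upwards [h.interaction.θ_mem t ht] with ω hω a x
  exact h.interaction.inner_bound _ (h.interaction.φ_mem a x) _ hω

theorem ae_noise_le (h : B.IsRun P Z Θ ℱ μ) {t : ℕ} (ht : t < P.T) :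
    ∀ᵐ ω ∂μ, ∀ a, |B.ε (t + 1) ω a| ≤ 2 := by
  filter_upwards [h.ae_inner_le ht, h.interaction.loss_bound t ht] with ω h1 h2 a
  have h3 := abs_le.1 (h1 a (B.X (t + 1) ω))
  have h4 := h2 a (B.X (t + 1) ω)
  rw [loss] at h4
  rw [abs_le] at h4 ⊢
  constructor <;> linarith

theorem measurable_inner (h : B.IsRun P Z Θ ℱ μ) {t : ℕ} (ht : t < P.T) (a : Fin K) :
    Measurable[(ℱ t).prod ‹MeasurableSpace 𝒳›]
      fun z : Ω × 𝒳 => P.φ a z.2 ⬝ᵥ B.θ (t + 1) z.1 := by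
  have h1 : @Measurable _ _ ((ℱ t).prod ‹MeasurableSpace 𝒳›) _ fun z : Ω × 𝒳 => P.φ a z.2 :=
    (h.interaction.measurable_φ a).comp (@measurable_snd Ω 𝒳 (ℱ t) _)
  have h2 : @Measurable _ _ ((ℱ t).prod ‹MeasurableSpace 𝒳›) _
      fun z : Ω × 𝒳 => B.θ (t + 1) z.1 :=
    (h.interaction.measurable_θ t ht).comp (@measurable_fst Ω 𝒳 (ℱ t) _)
  unfold dotProduct
  fun_prop

variable [IsProbabilityMeasure μ]

theorem isProbabilityMeasure (h : B.IsRun P Z Θ ℱ μ) : IsProbabilityMeasure P.G := by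
  have h0 : 0 < P.T := by have := h.two_le_T; omega
  rw [← h.interaction.law_X 0 h0]
  exact Measure.isProbabilityMeasure_map (h.measurable_X h0).aemeasurable

theorem measurableState (h : B.IsRun P Z Θ ℱ μ) {t : ℕ} (ht : t ≤ P.T) :
    @MeasurableState 𝒳 _ K Ω (ℱ t) (B.state P t) := by
  have := h.isProbabilityMeasure
  exact measurableState_state h.K_pos h.invRateOne_pos h.exploration h.interaction ht

theorem measurable_policy (h : B.IsRun P Z Θ ℱ μ) {t : ℕ} (ht : t ≤ P.T) (a : Fin K) :
    Measurable[(ℱ t).prod ‹MeasurableSpace 𝒳›] fun z : Ω × 𝒳 => B.nextPolicy P t z.1 z.2 a :=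
  @Input.measurable_policy 𝒳 _ K d Ω (ℱ t) P _ h.exploration.measurable_eStar
    (h.measurableState ht) a

theorem measurable_policy_section (h : B.IsRun P Z Θ ℱ μ) {t : ℕ} (ht : t ≤ P.T) (ω : Ω)
    (a : Fin K) : Measurable fun x => B.nextPolicy P t ω x a := by
  have h1 : Measurable fun z : Ω × 𝒳 => B.nextPolicy P t z.1 z.2 a :=
    measurable_prod_mono (ℱ.le t) (h.measurable_policy ht a)
  exact h1.of_uncurry_left (f := fun ω x => B.nextPolicy P t ω x a) (x := ω)

/-- Since `Σ(π_t) ≥ γ_t Σ(e*)`, the form is bounded by `(1/λ) / γ_t`, and `γ_t = η_t / λ` is chosen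
to make this exactly `1/η_t`, the size of losses that the entropy regulariser tolerates. -/
theorem posDef_and_bound (h : B.IsRun P Z Θ ℱ μ) {t : ℕ} (ht : t ≤ P.T) (ω : Ω) :
    (P.designMatrix (B.nextPolicy P t ω)).PosDef ∧
    ∀ a x a' x', |P.φ a x ⬝ᵥ ((P.designMatrix (B.nextPolicy P t ω))⁻¹ *ᵥ P.φ a' x')| ≤
      (B.state P t ω).invRate := by
  have := h.isProbabilityMeasure
  obtain ⟨M, hM⟩ := h.exists_feature_bound
  obtain ⟨h1, h2⟩ := P.designMatrix_mixture h.interaction.measurable_φ hM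
    (h.measurable_policy_section ht ω) (h.policy_mem t ω) h.exploration.measurable_eStar
    h.exploration.eStar_mem h.exploration.posDef (h.mixing_pos t ω) (h.mul_eStar_le_policy t ω)
  refine ⟨h1, fun a x a' x' => ?_⟩
  have h3 := abs_dotProduct_inv_mulVec_le h.exploration.posDef h1 (h.mixing_pos t ω) h2
    (h.exploration.le_inv_lam _ (h.interaction.φ_mem a x))
    (h.exploration.le_inv_lam _ (h.interaction.φ_mem a' x'))
  refine h3.trans (le_of_eq ?_)
  have := h.exploration.lam_pos
  have := h.invRate_pos t ω
  unfold Input.mixing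
  field_simp

end IsRun

end Bandit

end BobwFTRL

end

noncomputable section

namespace BobwFTRL

namespace Bandit

variable {𝒳 : Type*} [MeasurableSpace 𝒳] {K d : ℕ} {Ω : Type*}

/-! ### One round of the interaction -/

/-- The estimated loss `⟨φ(a, x), θ̂_{t+1}⟩`. -/
def estLoss (B : Bandit Ω 𝒳 K d) (P : Input 𝒳 K d) (t : ℕ) (ω : Ω) (x : 𝒳) (a : Fin K) : ℝ :=
  P.φ a x ⬝ᵥ P.thetaHat (B.state P t ω) (B.X (t + 1) ω) (B.A (t + 1) ω)
    (B.loss P (t + 1) ω (B.A (t + 1) ω) (B.X (t + 1) ω))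

/-- `φ(a, x)ᵀ Σ(π_{t+1})⁻¹ φ(b, x')`. -/
def kernel (B : Bandit Ω 𝒳 K d) (P : Input 𝒳 K d) (t : ℕ) (ω : Ω) (a : Fin K) (x : 𝒳)
    (b : Fin K) (x' : 𝒳) : ℝ :=
  P.φ a x ⬝ᵥ ((P.designMatrix (B.nextPolicy P t ω))⁻¹ *ᵥ P.φ b x')

theorem estLoss_eq (B : Bandit Ω 𝒳 K d) (P : Input 𝒳 K d) (t : ℕ) (ω : Ω) (x : 𝒳) (a : Fin K) :
    B.estLoss P t ω x a = B.loss P (t + 1) ω (B.A (t + 1) ω) (B.X (t + 1) ω) *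
      B.kernel P t ω a x (B.A (t + 1) ω) (B.X (t + 1) ω) := by
  rw [estLoss, Input.thetaHat, dotProduct_smul]
  rfl

theorem cumLoss_succ (B : Bandit Ω 𝒳 K d) (P : Input 𝒳 K d) (t : ℕ) (ω : Ω) (x : 𝒳) (a : Fin K) :
    (B.state P (t + 1) ω).cumLoss x a = (B.state P t ω).cumLoss x a + B.estLoss P t ω x a := rfl

variable [mΩ : MeasurableSpace Ω]

namespace IsRun

variable {B : Bandit Ω 𝒳 K d} {P : Input 𝒳 K d} {Z Θ : Set (Fin d → ℝ)} {ℱ : Filtration ℕ mΩ}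
  {μ : Measure Ω}

theorem sigma_le (h : B.IsRun P Z Θ ℱ μ) {t : ℕ} (ht : t < P.T) :
    ℱ t ⊔ MeasurableSpace.comap (B.X (t + 1)) inferInstance ≤ mΩ :=
  sup_le (ℱ.le t) (h.measurable_X ht).comap_le

theorem sigma_noise_le (h : B.IsRun P Z Θ ℱ μ) {t : ℕ} (ht : t < P.T) :
    ℱ t ⊔ MeasurableSpace.comap (B.X (t + 1)) inferInstance
      ⊔ MeasurableSpace.comap (B.ε (t + 1)) inferInstance ≤ mΩ :=
  sup_le (h.sigma_le ht) (h.interaction.measurable_ε t ht).comap_le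

theorem measurable_noise (h : B.IsRun P Z Θ ℱ μ) {t : ℕ} (ht : t < P.T) (a : Fin K) :
    Measurable fun ω => B.ε (t + 1) ω a :=
  (measurable_pi_apply a).comp (h.interaction.measurable_ε t ht)

theorem abs_policy_le (h : B.IsRun P Z Θ ℱ μ) (t : ℕ) (ω : Ω) (x : 𝒳) (a : Fin K) :
    |B.nextPolicy P t ω x a| ≤ 1 := by
  rw [abs_of_nonneg ((h.policy_mem t ω x).1 a)]
  exact (mem_Icc_of_mem_stdSimplex (h.policy_mem t ω x) a).2

variable [IsProbabilityMeasure μ]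

theorem integral_comp_X (h : B.IsRun P Z Θ ℱ μ) {t : ℕ} (ht : t < P.T) {F : Ω × 𝒳 → ℝ}
    (hF : Measurable[(ℱ t).prod ‹MeasurableSpace 𝒳›] F) :
    ∫ ω, F (ω, B.X (t + 1) ω) ∂μ = ∫ z, F z ∂(μ.prod P.G) := by
  rw [integral_comp_indep (ℱ.le t) (h.measurable_X ht) (h.interaction.indep_X t ht) hF,
    h.interaction.law_X t ht]

theorem integrable_noise_mul (h : B.IsRun P Z Θ ℱ μ) {t : ℕ} (ht : t < P.T) (a : Fin K)
    {g : Ω → ℝ} (hg : Measurable g) {C : ℝ} (hC : ∀ ω, |g ω| ≤ C) :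
    Integrable (fun ω => g ω * B.ε (t + 1) ω a) μ := by
  refine Integrable.of_bound (hg.mul (h.measurable_noise ht a)).aestronglyMeasurable (C * 2) ?_
  filter_upwards [h.ae_noise_le ht] with ω hω
  rw [Real.norm_eq_abs, abs_mul]
  exact mul_le_mul (hC ω) (hω a) (abs_nonneg _) ((abs_nonneg _).trans (hC ω))

theorem integral_mul_noise (h : B.IsRun P Z Θ ℱ μ) {t : ℕ} (ht : t < P.T) (a : Fin K)
    {g : Ω → ℝ} (hg : Measurable[ℱ t ⊔ MeasurableSpace.comap (B.X (t + 1)) inferInstance] g)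
    {C : ℝ} (hC : ∀ ω, |g ω| ≤ C) :
    ∫ ω, g ω * B.ε (t + 1) ω a ∂μ = 0 := by
  have hle := h.sigma_le ht
  have hε : Integrable (fun ω => B.ε (t + 1) ω a) μ := by
    simpa using h.integrable_noise_mul ht a (g := fun _ => 1) measurable_const (C := 1) (by simp)
  have := integral_mul_eq_of_condExp hle hg hε
    (h.integrable_noise_mul ht a (hg.mono hle le_rfl) hC) (h.interaction.noise t ht a)
  simpa using this

theorem integral_indicator_arm (h : B.IsRun P Z Θ ℱ μ) {t : ℕ} (ht : t < P.T) (a : Fin K)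
    {f : Ω → ℝ} (hf : Measurable[ℱ t ⊔ MeasurableSpace.comap (B.X (t + 1)) inferInstance
      ⊔ MeasurableSpace.comap (B.ε (t + 1)) inferInstance] f) (hfi : Integrable f μ) :
    Integrable (fun ω => f ω * (B.A (t + 1) ⁻¹' {a}).indicator (fun _ => (1 : ℝ)) ω) μ ∧
    ∫ ω, f ω * (B.A (t + 1) ⁻¹' {a}).indicator (fun _ => (1 : ℝ)) ω ∂μ =
      ∫ ω, f ω * B.nextPolicy P t ω (B.X (t + 1) ω) a ∂μ := by
  have hA := h.measurable_A ht (measurableSet_singleton a)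
  have hind : Integrable ((B.A (t + 1) ⁻¹' {a}).indicator (fun _ => (1 : ℝ))) μ :=
    (integrable_const (1 : ℝ)).indicator hA
  have hmul : Integrable (f * (B.A (t + 1) ⁻¹' {a}).indicator (fun _ => (1 : ℝ))) μ := by
    have : f * (B.A (t + 1) ⁻¹' {a}).indicator (fun _ => (1 : ℝ)) =
        (B.A (t + 1) ⁻¹' {a}).indicator f := by
      ext ω
      by_cases hω : B.A (t + 1) ω = a <;> simp [Set.indicator, hω]
    rw [this]
    exact hfi.indicator hA
  exact ⟨hmul, integral_mul_eq_of_condExp (h.sigma_noise_le ht) hf hind hmul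
    (h.interaction.arm t ht a)⟩

/-- Split according to the drawn arm and condition. The integrands may depend on the noise of the
round, because the arm is drawn without knowledge of it. -/
theorem integral_comp_arm (h : B.IsRun P Z Θ ℱ μ) {t : ℕ} (ht : t < P.T)
    {f : Fin K → Ω → ℝ} (hf : ∀ a, Measurable[ℱ t ⊔
      MeasurableSpace.comap (B.X (t + 1)) inferInstance
      ⊔ MeasurableSpace.comap (B.ε (t + 1)) inferInstance] (f a))
    (hfi : ∀ a, Integrable (f a) μ) :
    ∫ ω, f (B.A (t + 1) ω) ω ∂μ =
      ∑ a, ∫ ω, f a ω * B.nextPolicy P t ω (B.X (t + 1) ω) a ∂μ := by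
  have e : ∀ ω, f (B.A (t + 1) ω) ω =
      ∑ a, f a ω * (B.A (t + 1) ⁻¹' {a}).indicator (fun _ => (1 : ℝ)) ω := by
    intro ω
    rw [Finset.sum_eq_single_of_mem (B.A (t + 1) ω) (mem_univ _)]
    · simp
    · intro b _ hb
      simp [hb.symm]
  simp only [e]
  rw [integral_finsetSum _ fun a _ => (h.integral_indicator_arm ht a (hf a) (hfi a)).1]
  exact Finset.sum_congr rfl fun a _ => (h.integral_indicator_arm ht a (hf a) (hfi a)).2

/-- Drawing the arm and the context of a round. -/
theorem integral_arm_context (h : B.IsRun P Z Θ ℱ μ) {t : ℕ} (ht : t < P.T)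
    {u : Fin K → Ω × 𝒳 → ℝ} (hu : ∀ a, Measurable[(ℱ t).prod ‹MeasurableSpace 𝒳›] (u a))
    {C : ℝ} (hC : ∀ a z, |u a z| ≤ C) :
    ∫ ω, u (B.A (t + 1) ω) (ω, B.X (t + 1) ω) ∂μ =
      ∫ z, ∑ a, B.nextPolicy P t z.1 z.2 a * u a z ∂(μ.prod P.G) := by
  have := h.isProbabilityMeasure
  have hm1 : ∀ a, Measurable[ℱ t ⊔ MeasurableSpace.comap (B.X (t + 1)) inferInstance]
      fun ω => u a (ω, B.X (t + 1) ω) := fun a => measurable_comp_sup_comap (hu a)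
  have hint : ∀ a, Integrable (fun ω => u a (ω, B.X (t + 1) ω)) μ := fun a =>
    Integrable.of_bound ((hm1 a).mono (h.sigma_le ht) le_rfl).aestronglyMeasurable C
      (.of_forall fun ω => hC a _)
  rw [h.integral_comp_arm ht (f := fun a ω => u a (ω, B.X (t + 1) ω))
    (fun a => (hm1 a).mono le_sup_left le_rfl) hint]
  have hmeas : ∀ a, Measurable[(ℱ t).prod ‹MeasurableSpace 𝒳›]
      fun z : Ω × 𝒳 => B.nextPolicy P t z.1 z.2 a * u a z := fun a =>
    Measurable.mul (h.measurable_policy ht.le a) (hu a)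
  rw [integral_finsetSum]
  · refine Finset.sum_congr rfl fun a _ => ?_
    rw [← h.integral_comp_X ht (hmeas a)]
    exact integral_congr_ae (.of_forall fun ω => mul_comm _ _)
  · intro a _
    refine integrable_prod_of_bound (measurable_prod_mono (ℱ.le t) (hmeas a)) (C := 1 * C)
      (.of_forall fun ω x => ?_)
    rw [abs_mul]
    exact mul_le_mul (h.abs_policy_le t ω x a) (hC a _) (abs_nonneg _) zero_le_one

/-- Drawing the arm, the context and the noise of a round. -/
theorem integral_arm_loss (h : B.IsRun P Z Θ ℱ μ) {t : ℕ} (ht : t < P.T)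
    {u : Fin K → Ω × 𝒳 → ℝ} (hu : ∀ a, Measurable[(ℱ t).prod ‹MeasurableSpace 𝒳›] (u a))
    {C : ℝ} (hC : ∀ a z, |u a z| ≤ C) :
    Integrable (fun z => ∑ a, B.nextPolicy P t z.1 z.2 a *
      (u a z * (P.φ a z.2 ⬝ᵥ B.θ (t + 1) z.1))) (μ.prod P.G) ∧
    ∫ ω, u (B.A (t + 1) ω) (ω, B.X (t + 1) ω) *
        B.loss P (t + 1) ω (B.A (t + 1) ω) (B.X (t + 1) ω) ∂μ =
      ∫ z, ∑ a, B.nextPolicy P t z.1 z.2 a *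
        (u a z * (P.φ a z.2 ⬝ᵥ B.θ (t + 1) z.1)) ∂(μ.prod P.G) := by
  have := h.isProbabilityMeasure
  have hm1 : ∀ a, Measurable[ℱ t ⊔ MeasurableSpace.comap (B.X (t + 1)) inferInstance]
      fun ω => u a (ω, B.X (t + 1) ω) := fun a => measurable_comp_sup_comap (hu a)
  have hπ1 : ∀ a, Measurable[ℱ t ⊔ MeasurableSpace.comap (B.X (t + 1)) inferInstance]
      fun ω => B.nextPolicy P t ω (B.X (t + 1) ω) a := fun a =>
    measurable_comp_sup_comap (h.measurable_policy ht.le a)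
  have hv : ∀ a, Measurable[(ℱ t).prod ‹MeasurableSpace 𝒳›]
      fun z : Ω × 𝒳 => u a z * (P.φ a z.2 ⬝ᵥ B.θ (t + 1) z.1) := fun a =>
    Measurable.mul (hu a) (h.measurable_inner ht a)
  have hvb : ∀ᵐ ω ∂μ, ∀ a x, |u a (ω, x) * (P.φ a x ⬝ᵥ B.θ (t + 1) ω)| ≤ C * 1 := by
    filter_upwards [h.ae_inner_le ht] with ω hω a x
    rw [abs_mul]
    exact mul_le_mul (hC a _) (hω a x) (abs_nonneg _) ((abs_nonneg _).trans (hC a (ω, x)))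
  have hv1 : ∀ a, Measurable[ℱ t ⊔ MeasurableSpace.comap (B.X (t + 1)) inferInstance]
      fun ω => u a (ω, B.X (t + 1) ω) * (P.φ a (B.X (t + 1) ω) ⬝ᵥ B.θ (t + 1) ω) := fun a =>
    measurable_comp_sup_comap (hv a)
  have hvi : ∀ a, Integrable
      (fun ω => u a (ω, B.X (t + 1) ω) * (P.φ a (B.X (t + 1) ω) ⬝ᵥ B.θ (t + 1) ω)) μ := fun a =>
    Integrable.of_bound ((hv1 a).mono (h.sigma_le ht) le_rfl).aestronglyMeasurable (C * 1)
      (hvb.mono fun ω hω => hω a _)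
  have hεi : ∀ a, Integrable (fun ω => u a (ω, B.X (t + 1) ω) * B.ε (t + 1) ω a) μ := fun a =>
    h.integrable_noise_mul ht a ((hm1 a).mono (h.sigma_le ht) le_rfl) fun ω => hC a _
  have hε2 : ∀ a, Measurable[ℱ t ⊔ MeasurableSpace.comap (B.X (t + 1)) inferInstance
      ⊔ MeasurableSpace.comap (B.ε (t + 1)) inferInstance] fun ω => B.ε (t + 1) ω a := fun a =>
    (measurable_pi_apply a).comp ((comap_measurable (B.ε (t + 1))).mono le_sup_right le_rfl)
  have hmeas : ∀ a, Measurable[(ℱ t).prod ‹MeasurableSpace 𝒳›]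
      fun z : Ω × 𝒳 => B.nextPolicy P t z.1 z.2 a * (u a z * (P.φ a z.2 ⬝ᵥ B.θ (t + 1) z.1)) :=
    fun a => Measurable.mul (h.measurable_policy ht.le a) (hv a)
  have hmi : ∀ a, Integrable (fun z : Ω × 𝒳 => B.nextPolicy P t z.1 z.2 a *
      (u a z * (P.φ a z.2 ⬝ᵥ B.θ (t + 1) z.1))) (μ.prod P.G) := by
    intro a
    refine integrable_prod_of_bound (measurable_prod_mono (ℱ.le t) (hmeas a)) (C := 1 * (C * 1)) ?_
    filter_upwards [hvb] with ω hω x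
    rw [abs_mul]
    exact mul_le_mul (h.abs_policy_le t ω x a) (hω a x) (abs_nonneg _) zero_le_one
  refine ⟨integrable_finsetSum _ fun a _ => hmi a, ?_⟩
  have hsplit : ∀ a ω, u a (ω, B.X (t + 1) ω) * B.loss P (t + 1) ω a (B.X (t + 1) ω) =
      u a (ω, B.X (t + 1) ω) * (P.φ a (B.X (t + 1) ω) ⬝ᵥ B.θ (t + 1) ω) +
        u a (ω, B.X (t + 1) ω) * B.ε (t + 1) ω a := fun a ω => by rw [loss]; ring
  rw [h.integral_comp_arm ht
    (f := fun a ω => u a (ω, B.X (t + 1) ω) * B.loss P (t + 1) ω a (B.X (t + 1) ω))]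
  · rw [integral_finsetSum _ fun a _ => hmi a]
    refine Finset.sum_congr rfl fun a _ => ?_
    rw [← h.integral_comp_X ht (hmeas a)]
    have e : ∀ ω, u a (ω, B.X (t + 1) ω) * B.loss P (t + 1) ω a (B.X (t + 1) ω) *
        B.nextPolicy P t ω (B.X (t + 1) ω) a =
        B.nextPolicy P t ω (B.X (t + 1) ω) a *
          (u a (ω, B.X (t + 1) ω) * (P.φ a (B.X (t + 1) ω) ⬝ᵥ B.θ (t + 1) ω)) +
        B.nextPolicy P t ω (B.X (t + 1) ω) a * u a (ω, B.X (t + 1) ω) * B.ε (t + 1) ω a :=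
      fun ω => by rw [hsplit]; ring
    -- Once the arm is averaged out, the factor of the noise is determined by `ℱ t` and the context,
    -- so the centred noise contributes nothing.
    have hg1 : Measurable[ℱ t ⊔ MeasurableSpace.comap (B.X (t + 1)) inferInstance]
        fun ω => B.nextPolicy P t ω (B.X (t + 1) ω) a * u a (ω, B.X (t + 1) ω) :=
      Measurable.mul (hπ1 a) (hm1 a)
    have hg2 : ∀ ω, |B.nextPolicy P t ω (B.X (t + 1) ω) a * u a (ω, B.X (t + 1) ω)| ≤ 1 * C := by
      intro ω
      rw [abs_mul]
      exact mul_le_mul (h.abs_policy_le t ω _ a) (hC a _) (abs_nonneg _) zero_le_one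
    simp only [e]
    rw [integral_add, h.integral_mul_noise ht a hg1 hg2, add_zero]
    · exact (hvi a).bdd_mul ((hπ1 a).mono (h.sigma_le ht) le_rfl).aestronglyMeasurable
        (.of_forall fun ω => h.abs_policy_le t ω _ a)
    · exact h.integrable_noise_mul ht a (hg1.mono (h.sigma_le ht) le_rfl) hg2
  · intro a
    simp only [hsplit]
    exact ((hv1 a).mono le_sup_left le_rfl).add
      (((hm1 a).mono le_sup_left le_rfl).mul (hε2 a))
  · intro a
    simp only [hsplit]
    exact (hvi a).add (hεi a)

/-- The expected loss of a fixed policy in one round. -/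
theorem integral_loss_policy (h : B.IsRun P Z Θ ℱ μ) {t : ℕ} (ht : t < P.T) {ρ : 𝒳 → Fin K}
    (hρ : Measurable ρ) :
    Integrable (fun ω => B.loss P (t + 1) ω (ρ (B.X (t + 1) ω)) (B.X (t + 1) ω)) μ ∧
    ∫ ω, B.loss P (t + 1) ω (ρ (B.X (t + 1) ω)) (B.X (t + 1) ω) ∂μ =
      ∫ z, P.φ (ρ z.2) z.2 ⬝ᵥ B.θ (t + 1) z.1 ∂(μ.prod P.G) ∧
    Integrable (fun z : Ω × 𝒳 => P.φ (ρ z.2) z.2 ⬝ᵥ B.θ (t + 1) z.1) (μ.prod P.G) ∧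
    ∫ ω, P.φ (ρ (B.X (t + 1) ω)) (B.X (t + 1) ω) ⬝ᵥ B.θ (t + 1) ω ∂μ =
      ∫ z, P.φ (ρ z.2) z.2 ⬝ᵥ B.θ (t + 1) z.1 ∂(μ.prod P.G) ∧
    Integrable (fun ω => P.φ (ρ (B.X (t + 1) ω)) (B.X (t + 1) ω) ⬝ᵥ B.θ (t + 1) ω) μ := by
  have := h.isProbabilityMeasure
  have hm : Measurable[(ℱ t).prod ‹MeasurableSpace 𝒳›]
      fun z : Ω × 𝒳 => P.φ (ρ z.2) z.2 ⬝ᵥ B.θ (t + 1) z.1 := by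
    have h1 : @Measurable _ _ ((ℱ t).prod ‹MeasurableSpace 𝒳›) _
        fun z : Ω × 𝒳 => P.φ (ρ z.2) z.2 :=
      (measurable_comp_policy P h.interaction.measurable_φ hρ).comp (@measurable_snd Ω 𝒳 (ℱ t) _)
    have h2 : @Measurable _ _ ((ℱ t).prod ‹MeasurableSpace 𝒳›) _
        fun z : Ω × 𝒳 => B.θ (t + 1) z.1 :=
      (h.interaction.measurable_θ t ht).comp (@measurable_fst Ω 𝒳 (ℱ t) _)
    unfold dotProduct
    fun_prop
  have hX := h.measurable_X ht
  have hi1 : Integrable (fun z : Ω × 𝒳 => P.φ (ρ z.2) z.2 ⬝ᵥ B.θ (t + 1) z.1) (μ.prod P.G) :=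
    integrable_prod_of_bound (measurable_prod_mono (ℱ.le t) hm) (C := 1)
      ((h.ae_inner_le ht).mono fun ω hω x => hω _ x)
  have hi2 : Integrable
      (fun ω => P.φ (ρ (B.X (t + 1) ω)) (B.X (t + 1) ω) ⬝ᵥ B.θ (t + 1) ω) μ :=
    Integrable.of_bound ((measurable_comp_sup_comap (X := B.X (t + 1)) hm).mono
      (h.sigma_le ht) le_rfl).aestronglyMeasurable 1
      ((h.ae_inner_le ht).mono fun ω hω => hω _ _)
  have he := h.integral_comp_X ht hm
  -- The noise is centred arm by arm; at the random arm `ρ(X)` it is expanded with weights that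
  -- depend on the context only.
  set g : Fin K → Ω → ℝ := fun a ω => if ρ (B.X (t + 1) ω) = a then 1 else 0 with hg
  have hgm : ∀ a, Measurable[ℱ t ⊔ MeasurableSpace.comap (B.X (t + 1)) inferInstance] (g a) := by
    intro a
    have h1 : Measurable fun x => if ρ x = a then (1 : ℝ) else 0 :=
      Measurable.ite (hρ (measurableSet_singleton a)) measurable_const measurable_const
    exact h1.comp ((comap_measurable (B.X (t + 1))).mono le_sup_right le_rfl)
  have hgb : ∀ a ω, |g a ω| ≤ 1 := by
    intro a ω
    simp only [hg]
    split_ifs <;> simp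
  have hεe : ∀ ω, B.ε (t + 1) ω (ρ (B.X (t + 1) ω)) = ∑ a, g a ω * B.ε (t + 1) ω a := by
    intro ω
    simp [hg]
  have hgi : ∀ a, Integrable (fun ω => g a ω * B.ε (t + 1) ω a) μ := fun a =>
    h.integrable_noise_mul ht a ((hgm a).mono (h.sigma_le ht) le_rfl) (hgb a)
  have hi3 : Integrable (fun ω => ∑ a, g a ω * B.ε (t + 1) ω a) μ :=
    integrable_finsetSum _ fun a _ => hgi a
  refine ⟨?_, ?_, hi1, he, hi2⟩
  · simp only [loss, hεe]
    exact hi2.add hi3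
  · simp only [loss, hεe]
    rw [integral_add hi2 hi3, integral_finsetSum _ fun a _ => hgi a, he]
    simp [h.integral_mul_noise ht _ (hgm _) (hgb _)]

/-! ### The loss estimates -/

theorem measurable_kernel (h : B.IsRun P Z Θ ℱ μ) {t : ℕ} (ht : t ≤ P.T) {Ω' : Type*}
    [MeasurableSpace Ω'] {i : Ω' → Ω} (hi : Measurable[_, ℱ t] i) {A A' : Ω' → Fin K}
    {X X' : Ω' → 𝒳} (hA : Measurable A) (hX : Measurable X) (hA' : Measurable A')
    (hX' : Measurable X') :
    Measurable fun ω => B.kernel P t (i ω) (A ω) (X ω) (A' ω) (X' ω) := by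
  have := h.isProbabilityMeasure
  have hN : ∀ j k, Measurable[ℱ t] fun ω => (P.designMatrix (B.nextPolicy P t ω))⁻¹ j k :=
    @Input.measurable_policy_inv 𝒳 _ K d Ω (ℱ t) P _ _ h.interaction.measurable_φ
      h.exploration.measurable_eStar (h.measurableState ht)
  exact measurable_dotProduct_mulVec (fun j k => (hN j k).comp hi)
    (P.measurable_feature h.interaction.measurable_φ hA hX)
    (P.measurable_feature h.interaction.measurable_φ hA' hX')

theorem abs_kernel_le (h : B.IsRun P Z Θ ℱ μ) {t : ℕ} (ht : t ≤ P.T) (ω : Ω) (a : Fin K) (x : 𝒳)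
    (b : Fin K) (x' : 𝒳) : |B.kernel P t ω a x b x'| ≤ (B.state P t ω).invRate :=
  (h.posDef_and_bound ht ω).2 a x b x'

theorem abs_kernel_le' (h : B.IsRun P Z Θ ℱ μ) {t : ℕ} (ht : t ≤ P.T) (ω : Ω) (a : Fin K) (x : 𝒳)
    (b : Fin K) (x' : 𝒳) : |B.kernel P t ω a x b x'| ≤ P.invRateOne * (t + 1) :=
  (h.abs_kernel_le ht ω a x b x').trans (h.invRate_le t ω)

theorem measurable_estLoss (h : B.IsRun P Z Θ ℱ μ) {t : ℕ} (ht : t < P.T) (a : Fin K) :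
    Measurable fun z : Ω × 𝒳 => B.estLoss P t z.1 z.2 a := by
  simp only [estLoss_eq]
  refine Measurable.mul ?_ ?_
  · exact ((h.interaction.measurable_obs t ht).mono (ℱ.le _) le_rfl).comp measurable_fst
  · exact h.measurable_kernel ht.le ((measurable_id'' (ℱ.le t)).comp measurable_fst)
      measurable_const measurable_snd ((h.measurable_A ht).comp measurable_fst)
      ((h.measurable_X ht).comp measurable_fst)

theorem ae_abs_estLoss_le (h : B.IsRun P Z Θ ℱ μ) {t : ℕ} (ht : t < P.T) :
    ∀ᵐ ω ∂μ, ∀ x a, |B.estLoss P t ω x a| ≤ (B.state P t ω).invRate := by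
  filter_upwards [h.interaction.loss_bound t ht] with ω hω x a
  rw [estLoss_eq, abs_mul]
  have h1 := hω (B.A (t + 1) ω) (B.X (t + 1) ω)
  have h2 := h.abs_kernel_le ht.le ω a x (B.A (t + 1) ω) (B.X (t + 1) ω)
  calc _ ≤ 1 * (B.state P t ω).invRate := mul_le_mul h1 h2 (abs_nonneg _) zero_le_one
    _ = _ := one_mul _

end IsRun

end Bandit

end BobwFTRL

end

/-! ### Unbiasedness, second moments and stability of the loss estimates -/

noncomputable section

namespace BobwFTRL

theorem abs_sum_mul_le {K : ℕ} {p c : Fin K → ℝ} (hp : p ∈ stdSimplex ℝ (Fin K)) {C : ℝ}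
    (hc : ∀ a, |c a| ≤ C) : |∑ a, p a * c a| ≤ C := by
  refine (Finset.abs_sum_le_sum_abs _ _).trans ?_
  calc ∑ a, |p a * c a| ≤ ∑ a, p a * C := Finset.sum_le_sum fun a _ => by
        rw [abs_mul, abs_of_nonneg (hp.1 a)]
        exact mul_le_mul_of_nonneg_left (hc a) (hp.1 a)
    _ = C := by rw [← Finset.sum_mul, hp.2, one_mul]

theorem stdSimplex_apply_le_one {K : ℕ} {p : Fin K → ℝ} (hp : p ∈ stdSimplex ℝ (Fin K))
    (a : Fin K) : p a ≤ 1 := (mem_Icc_of_mem_stdSimplex hp a).2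

namespace Bandit

variable {𝒳 : Type*} [MeasurableSpace 𝒳] {K d : ℕ} {Ω : Type*}

/-- The stability term of round `t + 1`. -/
def stability (B : Bandit Ω 𝒳 K d) (P : Input 𝒳 K d) (t : ℕ)
    (z : Ω × 𝒳) : ℝ :=
  (1 / (B.state P t z.1).invRate) *
    ∑ a, (B.state P t z.1).q z.2 a * B.estLoss P t z.1 z.2 a ^ 2

variable [mΩ : MeasurableSpace Ω]

namespace IsRun

variable {B : Bandit Ω 𝒳 K d} {P : Input 𝒳 K d} {Z Θ : Set (Fin d → ℝ)} {ℱ : Filtration ℕ mΩ}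
  {μ : Measure Ω} [IsProbabilityMeasure μ]

theorem integrable_mul_estLoss (h : B.IsRun P Z Θ ℱ μ) {t : ℕ} (ht : t < P.T) (a : Fin K)
    {w : Ω × 𝒳 → ℝ} (hw : Measurable w) {C : ℝ} (hC : ∀ z, |w z| ≤ C) :
    Integrable (fun z => w z * B.estLoss P t z.1 z.2 a) (μ.prod P.G) := by
  have := h.isProbabilityMeasure
  refine integrable_prod_of_bound (hw.mul (h.measurable_estLoss ht a))
    (C := C * (P.invRateOne * (t + 1))) ?_
  filter_upwards [h.ae_abs_estLoss_le ht] with ω hω x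
  rw [abs_mul]
  exact mul_le_mul (hC _) ((hω x a).trans (h.invRate_le t ω)) (abs_nonneg _)
    ((abs_nonneg _).trans (hC (ω, x)))

theorem integrable_mul_inner (h : B.IsRun P Z Θ ℱ μ) {t : ℕ} (ht : t < P.T) (a : Fin K)
    {w : Ω × 𝒳 → ℝ} (hw : Measurable w) {C : ℝ} (hC : ∀ z, |w z| ≤ C) :
    Integrable (fun z => w z * (P.φ a z.2 ⬝ᵥ B.θ (t + 1) z.1)) (μ.prod P.G) := by
  have := h.isProbabilityMeasure
  refine integrable_prod_of_bound
    (hw.mul (measurable_prod_mono (ℱ.le t) (h.measurable_inner ht a))) (C := C * 1) ?_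
  filter_upwards [h.ae_inner_le ht] with ω hω x
  rw [abs_mul]
  exact mul_le_mul (hC _) (hω a x) (abs_nonneg _) ((abs_nonneg _).trans (hC (ω, x)))

/-- The loss estimates are unbiased. -/
theorem integral_mul_estLoss (h : B.IsRun P Z Θ ℱ μ) {t : ℕ} (ht : t < P.T) (a : Fin K)
    {w : Ω × 𝒳 → ℝ} (hw : Measurable[(ℱ t).prod ‹MeasurableSpace 𝒳›] w)
    {C : ℝ} (hC : ∀ z, |w z| ≤ C) :
    ∫ z, w z * B.estLoss P t z.1 z.2 a ∂(μ.prod P.G) =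
      ∫ z, w z * (P.φ a z.2 ⬝ᵥ B.θ (t + 1) z.1) ∂(μ.prod P.G) := by
  have := h.isProbabilityMeasure
  obtain ⟨M, hM⟩ := h.exists_feature_bound
  have hw' := measurable_prod_mono (ℱ.le t) hw
  -- The ghost context `x` is fixed first; for fixed `x` the estimate depends on `ω` through the
  -- past, the drawn arm, its context and its loss, which `integral_arm_loss` averages.
  rw [integral_prod_symm _ (h.integrable_mul_estLoss ht a hw' hC),
    integral_prod_symm _ (h.integrable_mul_inner ht a hw' hC)]
  refine integral_congr_ae (.of_forall fun x => ?_)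
  simp only
  set u : Fin K → Ω × 𝒳 → ℝ := fun b z => w (z.1, x) * B.kernel P t z.1 a x b z.2 with hu
  have hfst : Measurable[(ℱ t).prod ‹MeasurableSpace 𝒳›, ℱ t] (Prod.fst : Ω × 𝒳 → Ω) :=
    @measurable_fst Ω 𝒳 (ℱ t) _
  have hsnd : Measurable[(ℱ t).prod ‹MeasurableSpace 𝒳›] (Prod.snd : Ω × 𝒳 → 𝒳) :=
    @measurable_snd Ω 𝒳 (ℱ t) _
  have hum : ∀ b, Measurable[(ℱ t).prod ‹MeasurableSpace 𝒳›] (u b) := by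
    intro b
    have h1 : Measurable[(ℱ t).prod ‹MeasurableSpace 𝒳›] fun z : Ω × 𝒳 => w (z.1, x) := by
      have h2 : Measurable[(ℱ t).prod ‹MeasurableSpace 𝒳›, (ℱ t).prod ‹MeasurableSpace 𝒳›]
          fun z : Ω × 𝒳 => (z.1, x) :=
        @Measurable.prodMk (Ω × 𝒳) ((ℱ t).prod _) Ω 𝒳 (ℱ t) _ Prod.fst (fun _ => x) hfst
          (@measurable_const _ _ _ ((ℱ t).prod _) x)
      exact hw.comp h2
    have h3 := @measurable_kernel 𝒳 _ K d Ω mΩ B P Z Θ ℱ μ _ h t ht.le (Ω × 𝒳) ((ℱ t).prod _)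
      Prod.fst hfst (fun _ => a) (fun _ => b) (fun _ => x) Prod.snd
      (@measurable_const _ _ _ ((ℱ t).prod _) a) (@measurable_const _ _ _ ((ℱ t).prod _) x)
      (@measurable_const _ _ _ ((ℱ t).prod _) b) hsnd
    exact Measurable.mul h1 h3
  have hub : ∀ b z, |u b z| ≤ C * (P.invRateOne * (t + 1)) := by
    intro b z
    rw [hu, abs_mul]
    exact mul_le_mul (hC _) (h.abs_kernel_le' ht.le z.1 a x b z.2) (abs_nonneg _)
      ((abs_nonneg _).trans (hC z))
  obtain ⟨h1, h2⟩ := h.integral_arm_loss ht hum hub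
  rw [integral_prod _ h1] at h2
  have e1 : ∀ ω, w (ω, x) * B.estLoss P t ω x a = u (B.A (t + 1) ω) (ω, B.X (t + 1) ω) *
      B.loss P (t + 1) ω (B.A (t + 1) ω) (B.X (t + 1) ω) := by
    intro ω
    rw [estLoss_eq, hu]
    ring
  simp only [e1]
  rw [h2]
  refine integral_congr_ae (.of_forall fun ω => ?_)
  simp only
  -- Averaging `φφᵀ` over the played policy produces `N`, which cancels the `N⁻¹` of the estimator.
  set N := P.designMatrix (B.nextPolicy P t ω) with hN
  have hpos : N.PosDef := (h.posDef_and_bound ht.le ω).1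
  have e2 : ∀ x', ∑ b, B.nextPolicy P t ω x' b *
      (u b (ω, x') * (P.φ b x' ⬝ᵥ B.θ (t + 1) ω)) =
      w (ω, x) * ∑ b, B.nextPolicy P t ω x' b *
        (((P.φ a x ᵥ* N⁻¹) ⬝ᵥ P.φ b x') * (P.φ b x' ⬝ᵥ B.θ (t + 1) ω)) := by
    intro x'
    rw [Finset.mul_sum]
    refine Finset.sum_congr rfl fun b _ => ?_
    rw [hu, ← Matrix.dotProduct_mulVec]
    simp only [kernel, ← hN]
    ring
  simp only [e2]
  rw [integral_const_mul, P.integral_weighted_mul h.interaction.measurable_φ hM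
    (h.measurable_policy_section ht.le ω) (h.policy_mem t ω), ← hN, ← Matrix.dotProduct_mulVec,
    Matrix.mulVec_mulVec, Matrix.nonsing_inv_mul _ hpos.det_pos.ne'.isUnit, Matrix.one_mulVec]

theorem measurable_invRate (h : B.IsRun P Z Θ ℱ μ) {t : ℕ} (ht : t ≤ P.T) :
    Measurable[ℱ t] fun ω => (B.state P t ω).invRate :=
  @MeasurableState.invRate 𝒳 _ K Ω (ℱ t) _ (h.measurableState ht)

theorem measurable_q (h : B.IsRun P Z Θ ℱ μ) {t : ℕ} (ht : t ≤ P.T) (a : Fin K) :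
    Measurable[(ℱ t).prod ‹MeasurableSpace 𝒳›] fun z : Ω × 𝒳 => (B.state P t z.1).q z.2 a :=
  @MeasurableState.q 𝒳 _ K Ω (ℱ t) _ (h.measurableState ht) a

theorem integrable_one_div_invRate (h : B.IsRun P Z Θ ℱ μ) {t : ℕ} (ht : t ≤ P.T) :
    Integrable (fun ω => 1 / (B.state P t ω).invRate) μ := by
  have h1 : Measurable fun ω => (B.state P t ω).invRate :=
    (h.measurable_invRate ht).mono (ℱ.le t) le_rfl
  refine Integrable.of_bound (C := 1 / P.invRateOne) (measurable_const.div h1).aestronglyMeasurable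
    (.of_forall fun ω => ?_)
  have h2 := h.invRate_pos t ω
  rw [Real.norm_eq_abs, abs_of_pos (one_div_pos.2 h2)]
  exact one_div_le_one_div_of_le h.invRateOne_pos (invRateOne_le_state P B t ω)

/-- The second moment of the loss estimates under the played policy. -/
theorem integral_kernel_sq (h : B.IsRun P Z Θ ℱ μ) {t : ℕ} (ht : t < P.T) :
    Integrable (fun z => (1 / (B.state P t z.1).invRate) * ∑ a, B.nextPolicy P t z.1 z.2 a *
      B.kernel P t z.1 a z.2 (B.A (t + 1) z.1) (B.X (t + 1) z.1) ^ 2) (μ.prod P.G) ∧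
    ∫ z, (1 / (B.state P t z.1).invRate) * ∑ a, B.nextPolicy P t z.1 z.2 a *
      B.kernel P t z.1 a z.2 (B.A (t + 1) z.1) (B.X (t + 1) z.1) ^ 2 ∂(μ.prod P.G) =
      d * ∫ ω, 1 / (B.state P t ω).invRate ∂μ := by
  have := h.isProbabilityMeasure
  obtain ⟨M, hM⟩ := h.exists_feature_bound
  have hA := h.measurable_A ht
  have hX := h.measurable_X ht
  have hinv : Measurable fun ω => (B.state P t ω).invRate :=
    (h.measurable_invRate ht.le).mono (ℱ.le t) le_rfl
  have hpol : ∀ a, Measurable fun z : Ω × 𝒳 => B.nextPolicy P t z.1 z.2 a := fun a =>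
    measurable_prod_mono (ℱ.le t) (h.measurable_policy ht.le a)
  have hk : ∀ a, Measurable fun z : Ω × 𝒳 =>
      B.kernel P t z.1 a z.2 (B.A (t + 1) z.1) (B.X (t + 1) z.1) := fun a =>
    h.measurable_kernel ht.le ((measurable_id'' (ℱ.le t)).comp measurable_fst)
      measurable_const measurable_snd (hA.comp measurable_fst) (hX.comp measurable_fst)
  have hint : Integrable (fun z => (1 / (B.state P t z.1).invRate) *
      ∑ a, B.nextPolicy P t z.1 z.2 a *
        B.kernel P t z.1 a z.2 (B.A (t + 1) z.1) (B.X (t + 1) z.1) ^ 2) (μ.prod P.G) := by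
    have hinv' : Measurable fun z : Ω × 𝒳 => (B.state P t z.1).invRate := hinv.comp measurable_fst
    refine integrable_prod_of_bound
      ((measurable_const.div hinv').mul (Finset.measurable_sum _ fun a _ =>
        (hpol a).mul ((hk a).pow_const 2)))
      (C := P.invRateOne * (t + 1)) (.of_forall fun ω x => ?_)
    have hb := h.invRate_pos t ω
    have h1 := abs_sum_mul_le (h.policy_mem t ω x) (C := (B.state P t ω).invRate ^ 2)
      (c := fun a => B.kernel P t ω a x (B.A (t + 1) ω) (B.X (t + 1) ω) ^ 2) fun a => by
        rw [abs_pow]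
        exact pow_le_pow_left₀ (abs_nonneg _) (h.abs_kernel_le ht.le ω a x _ _) 2
    rw [abs_mul, abs_of_pos (one_div_pos.2 hb)]
    refine (mul_le_mul_of_nonneg_left h1 (one_div_pos.2 hb).le).trans ?_
    refine le_trans (le_of_eq ?_) (h.invRate_le t ω)
    field_simp
  refine ⟨hint, ?_⟩
  rw [integral_prod _ hint]
  have e1 : ∀ ω, ∫ x, (1 / (B.state P t ω).invRate) * ∑ a, B.nextPolicy P t ω x a *
      B.kernel P t ω a x (B.A (t + 1) ω) (B.X (t + 1) ω) ^ 2 ∂P.G =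
      (1 / (B.state P t ω).invRate) *
        B.kernel P t ω (B.A (t + 1) ω) (B.X (t + 1) ω) (B.A (t + 1) ω) (B.X (t + 1) ω) := by
    intro ω
    rw [integral_const_mul]
    congr 1
    set N := P.designMatrix (B.nextPolicy P t ω) with hN
    have hpos : N.PosDef := (h.posDef_and_bound ht.le ω).1
    have h1 := P.integral_weighted_mul h.interaction.measurable_φ hM
      (h.measurable_policy_section ht.le ω) (h.policy_mem t ω)
      (N⁻¹ *ᵥ P.φ (B.A (t + 1) ω) (B.X (t + 1) ω)) (N⁻¹ *ᵥ P.φ (B.A (t + 1) ω) (B.X (t + 1) ω))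
    rw [← hN, Matrix.mulVec_mulVec, Matrix.mul_nonsing_inv _ hpos.det_pos.ne'.isUnit,
      Matrix.one_mulVec, dotProduct_comm] at h1
    rw [kernel, ← hN, ← h1]
    refine integral_congr_ae (.of_forall fun x => Finset.sum_congr rfl fun a _ => ?_)
    simp only [kernel, ← hN]
    rw [dotProduct_comm (N⁻¹ *ᵥ _) (P.φ a x), sq]
  simp only [e1]
  have hfst : Measurable[(ℱ t).prod ‹MeasurableSpace 𝒳›, ℱ t] (Prod.fst : Ω × 𝒳 → Ω) :=
    @measurable_fst Ω 𝒳 (ℱ t) _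
  have hsnd : Measurable[(ℱ t).prod ‹MeasurableSpace 𝒳›] (Prod.snd : Ω × 𝒳 → 𝒳) :=
    @measurable_snd Ω 𝒳 (ℱ t) _
  have hum : ∀ b, Measurable[(ℱ t).prod ‹MeasurableSpace 𝒳›] fun z : Ω × 𝒳 =>
      (1 / (B.state P t z.1).invRate) * B.kernel P t z.1 b z.2 b z.2 := by
    intro b
    have h1 : Measurable[(ℱ t).prod ‹MeasurableSpace 𝒳›]
        fun z : Ω × 𝒳 => (B.state P t z.1).invRate := (h.measurable_invRate ht.le).comp hfst
    have h3 := @measurable_kernel 𝒳 _ K d Ω mΩ B P Z Θ ℱ μ _ h t ht.le (Ω × 𝒳) ((ℱ t).prod _)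
      Prod.fst hfst (fun _ => b) (fun _ => b) Prod.snd Prod.snd
      (@measurable_const _ _ _ ((ℱ t).prod _) b) hsnd
      (@measurable_const _ _ _ ((ℱ t).prod _) b) hsnd
    exact Measurable.mul (Measurable.div (@measurable_const _ _ _ ((ℱ t).prod _) 1) h1) h3
  have hub : ∀ (b : Fin K) (z : Ω × 𝒳),
      |(1 / (B.state P t z.1).invRate) * B.kernel P t z.1 b z.2 b z.2| ≤ 1 := by
    intro b z
    have hb := h.invRate_pos t z.1
    rw [abs_mul, abs_of_pos (one_div_pos.2 hb), one_div_mul_eq_div, div_le_one hb]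
    exact h.abs_kernel_le ht.le z.1 b z.2 b z.2
  -- Averaging that diagonal form over the drawn arm and context gives the trace `d`.
  rw [h.integral_arm_context ht
    (u := fun b z => (1 / (B.state P t z.1).invRate) * B.kernel P t z.1 b z.2 b z.2) hum hub,
    integral_prod, ← integral_const_mul]
  · refine integral_congr_ae (.of_forall fun ω => ?_)
    simp only
    have e2 : ∀ x, ∑ a, B.nextPolicy P t ω x a *
        (1 / (B.state P t ω).invRate * B.kernel P t ω a x a x) =
        (1 / (B.state P t ω).invRate) * ∑ a, B.nextPolicy P t ω x a * B.kernel P t ω a x a x := by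
      intro x
      rw [Finset.mul_sum]
      exact Finset.sum_congr rfl fun a _ => by ring
    simp only [e2]
    rw [integral_const_mul, mul_comm (d : ℝ)]
    congr 1
    exact P.integral_weighted_inv h.interaction.measurable_φ hM
      (h.measurable_policy_section ht.le ω) (h.policy_mem t ω) (h.posDef_and_bound ht.le ω).1
  · refine integrable_prod_of_bound (measurable_prod_mono (ℱ.le t)
      (Finset.measurable_sum _ fun a _ => Measurable.mul (h.measurable_policy ht.le a) (hum a)))
      (C := 1) (.of_forall fun ω x => ?_)
    exact abs_sum_mul_le (h.policy_mem t ω x) fun a => hub a (ω, x)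

theorem ae_stability_le (h : B.IsRun P Z Θ ℱ μ) {t : ℕ} (ht : t < P.T) :
    ∀ᵐ ω ∂μ, ∀ x, |B.stability P t (ω, x)| ≤ (B.state P t ω).invRate := by
  filter_upwards [h.ae_abs_estLoss_le ht] with ω hω x
  have hb := h.invRate_pos t ω
  have h1 := abs_sum_mul_le (h.q_mem t ω x) (C := (B.state P t ω).invRate ^ 2)
    (c := fun a => B.estLoss P t ω x a ^ 2) fun a => by
      rw [abs_pow]
      exact pow_le_pow_left₀ (abs_nonneg _) (hω x a) 2
  rw [stability, abs_mul, abs_of_pos (one_div_pos.2 hb)]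
  refine (mul_le_mul_of_nonneg_left h1 (one_div_pos.2 hb).le).trans (le_of_eq ?_)
  field_simp

theorem integrable_stability (h : B.IsRun P Z Θ ℱ μ) {t : ℕ} (ht : t < P.T) :
    Integrable (B.stability P t) (μ.prod P.G) := by
  have := h.isProbabilityMeasure
  have hinv : Measurable fun z : Ω × 𝒳 => (B.state P t z.1).invRate :=
    ((h.measurable_invRate ht.le).mono (ℱ.le t) le_rfl).comp measurable_fst
  refine integrable_prod_of_bound ((measurable_const.div hinv).mul
    (Finset.measurable_sum _ fun a _ => (measurable_prod_mono (ℱ.le t) (h.measurable_q ht.le a)).mul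
      ((h.measurable_estLoss ht a).pow_const 2))) (C := P.invRateOne * (t + 1)) ?_
  filter_upwards [h.ae_stability_le ht] with ω hω x
  exact (hω x).trans (h.invRate_le t ω)

/-- In round 1 the mixing weight may equal `1`, and then `q` is not controlled by the played policy;
only the crude bound `|ℓ̂| ≤ 1/η_1` is available. -/
theorem integral_stability_zero_le (h : B.IsRun P Z Θ ℱ μ) :
    ∫ z, B.stability P 0 z ∂(μ.prod P.G) ≤ P.invRateOne := by
  have := h.isProbabilityMeasure
  have h0 : 0 < P.T := by have := h.two_le_T; omega
  have hle : ∀ᵐ z ∂(μ.prod P.G), B.stability P 0 z ≤ P.invRateOne :=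
    (ae_prod_of_ae_fst (h.ae_stability_le h0)).mono fun z hz => (le_abs_self _).trans (hz z.2)
  refine (integral_mono_ae (h.integrable_stability h0) (integrable_const _) hle).trans (le_of_eq ?_)
  simp

/-- The mixing weight is at most `3 / 5`, so `q ≤ (5 / 2) π` and the second moment under the played
policy applies. -/
theorem integral_stability_le (h : B.IsRun P Z Θ ℱ μ) {t : ℕ} (ht1 : 1 ≤ t) (ht : t < P.T) :
    ∫ z, B.stability P t z ∂(μ.prod P.G) ≤
      5 / 2 * d * ∫ ω, 1 / (B.state P t ω).invRate ∂μ := by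
  have := h.isProbabilityMeasure
  obtain ⟨h1, h2⟩ := h.integral_kernel_sq ht
  rw [mul_assoc, ← h2, ← integral_const_mul]
  refine integral_mono_ae (h.integrable_stability ht) (h1.const_mul _) ?_
  filter_upwards [ae_prod_of_ae_fst (h.interaction.loss_bound t ht)] with z hz
  have hb := h.invRate_pos t z.1
  rw [stability, mul_left_comm]
  refine mul_le_mul_of_nonneg_left ?_ (one_div_pos.2 hb).le
  rw [Finset.mul_sum]
  refine Finset.sum_le_sum fun a _ => ?_
  have hq := (h.q_mem t z.1 z.2).1 a
  have hπ := h.mul_q_le_policy t z.1 z.2 a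
  have hγ := h.mixing_state_le ht1 z.1
  have hqπ : (B.state P t z.1).q z.2 a ≤ 5 / 2 * B.nextPolicy P t z.1 z.2 a := by nlinarith
  have hsq : B.estLoss P t z.1 z.2 a ^ 2 ≤
      B.kernel P t z.1 a z.2 (B.A (t + 1) z.1) (B.X (t + 1) z.1) ^ 2 := by
    rw [estLoss_eq, mul_pow]
    have := hz (B.A (t + 1) z.1) (B.X (t + 1) z.1)
    have h3 : B.loss P (t + 1) z.1 (B.A (t + 1) z.1) (B.X (t + 1) z.1) ^ 2 ≤ 1 :=
      (sq_le_one_iff_abs_le_one _).2 this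
    exact mul_le_of_le_one_left (sq_nonneg _) h3
  rw [← mul_assoc]
  exact mul_le_mul hqπ hsq (sq_nonneg _) (hq.trans hqπ)

end IsRun

end Bandit

end BobwFTRL

end

/-! ### Total entropy and the regret bound in terms of it -/

noncomputable section

namespace BobwFTRL

namespace Bandit

variable {𝒳 : Type*} [MeasurableSpace 𝒳] {K d : ℕ} {Ω : Type*}

/-- The entropy of the iterate of round `t + 1` at the context of that round. -/
def roundEntropy (B : Bandit Ω 𝒳 K d) (P : Input 𝒳 K d) (t : ℕ)
    (ω : Ω) : ℝ :=
  entropy ((B.state P t ω).q (B.X (t + 1) ω))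

variable [mΩ : MeasurableSpace Ω]

namespace IsRun

variable {B : Bandit Ω 𝒳 K d} {P : Input 𝒳 K d} {Z Θ : Set (Fin d → ℝ)} {ℱ : Filtration ℕ mΩ}
  {μ : Measure Ω}

theorem cumEntropy_le (h : B.IsRun P Z Θ ℱ μ) (t : ℕ) (ω : Ω) :
    (B.state P t ω).cumEntropy ≤ t * Real.log K := by
  induction t with
  | zero => simp [state, Input.run, Input.init]
  | succ t ih =>
    have h1 : (B.state P (t + 1) ω).cumEntropy = (B.state P t ω).cumEntropy +
        entropy ((B.state P t ω).q (B.X (t + 1) ω)) := rfl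
    rw [h1]
    push_cast
    linarith [entropy_le_log h.K_pos (h.q_mem t ω (B.X (t + 1) ω))]

/-- The pathwise sum of all error terms. -/
theorem pathwise_error_le (h : B.IsRun P Z Θ ℱ μ) {n : ℕ} (hn : P.T = n + 1) (ω : Ω) :
    (2 / P.lam + 5 / 2 * d) * ∑ t ∈ range (n + 1), 1 / (B.state P t ω).invRate
      + P.invRateOne + P.invRateOne * Real.log K
      + ∑ t ∈ range n, ((B.state P (t + 1) ω).invRate - (B.state P t ω).invRate) *
        B.roundEntropy P (t + 1) ω ≤
      20 * P.invRateOne * Real.log K * √((Real.log K)⁻¹ * (B.state P P.T ω).cumEntropy) := by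
  have hK := h.two_le_K
  have hT := h.two_le_T
  have hlam := h.exploration.lam_pos
  have hlK : 0 < Real.log K := Real.log_pos (by exact_mod_cast hK)
  -- In `D'`, the part `2 / P.lam` pays for exploration and `5 / 2 * d` for stability.
  have key := total_error_le (fun t => (B.state P t ω).invRate)
    (fun t => (Real.log K)⁻¹ * (B.state P t ω).cumEntropy)
    (fun t => (Real.log K)⁻¹ * B.roundEntropy P t ω) (K := K) (n := n)
    (D := 1 / P.lam + d) (D' := 2 / P.lam + 5 / 2 * d) hK (by omega) (h.invRate_pos 0 ω)
    (mul_zero _) ?_ ?_ ?_ (fun t => P.run_invRate_succ _ _ _ t) ?_ (fun t => h.invRate_pos t ω) ?_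
  · have e : ∀ t, ((B.state P (t + 1) ω).invRate - (B.state P t ω).invRate) *
        ((Real.log K)⁻¹ * B.roundEntropy P (t + 1) ω) =
        (Real.log K)⁻¹ * (((B.state P (t + 1) ω).invRate - (B.state P t ω).invRate) *
          B.roundEntropy P (t + 1) ω) := fun t => by ring
    simp only [e] at key
    rw [← Finset.mul_sum, ← mul_assoc (Real.log K), mul_inv_cancel₀ hlK.ne', one_mul] at key
    rw [hn]
    exact key
  · change (Real.log K)⁻¹ * entropy (fun _ : Fin K => 1 / (K : ℝ)) = 1
    rw [entropy_uniform h.K_pos, inv_mul_cancel₀ hlK.ne']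
  · intro t
    have h1 := entropy_nonneg (h.q_mem t ω (B.X (t + 1) ω))
    have h2 := entropy_le_log h.K_pos (h.q_mem t ω (B.X (t + 1) ω))
    exact ⟨mul_nonneg (inv_nonneg.2 hlK.le) h1, by
      rw [inv_mul_le_iff₀ hlK, mul_one]; exact h2⟩
  · intro t
    rw [← mul_add]
    rfl
  · rw [← hn]
    exact (P.invRateOne_sq hK hT hlam).1
  · have : 2 / P.lam ≤ 5 / 2 * (1 / P.lam) := by
      have := one_div_pos.2 hlam
      have e : 2 / P.lam = 2 * (1 / P.lam) := by ring
      rw [e]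
      linarith
    linarith

variable [IsProbabilityMeasure μ]

/-! ### The regret -/

theorem integrable_obs (h : B.IsRun P Z Θ ℱ μ) {t : ℕ} (ht : t < P.T) :
    Integrable (fun ω => B.loss P (t + 1) ω (B.A (t + 1) ω) (B.X (t + 1) ω)) μ :=
  Integrable.of_bound
    ((h.interaction.measurable_obs t ht).mono (ℱ.le _) le_rfl).aestronglyMeasurable 1
    ((h.interaction.loss_bound t ht).mono fun _ hω => hω _ _)

/-- The regret is at most the regret against an optimal policy. -/
theorem regret_le_of_isOptimal (h : B.IsRun P Z Θ ℱ μ) {ρ : 𝒳 → Fin K}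
    (hρ : B.IsOptimal P μ ρ) :
    B.regret P μ ≤ ∑ t ∈ range P.T,
      (∫ ω, B.loss P (t + 1) ω (B.A (t + 1) ω) (B.X (t + 1) ω) ∂μ -
        ∫ z, P.φ (ρ z.2) z.2 ⬝ᵥ B.θ (t + 1) z.1 ∂(μ.prod P.G)) := by
  have hopt : ∀ ρ' : 𝒳 → Fin K, Measurable ρ' →
      ∫ ω, ∑ t ∈ range P.T, P.φ (ρ' (B.X (t + 1) ω)) (B.X (t + 1) ω) ⬝ᵥ B.θ (t + 1) ω ∂μ =
      ∑ t ∈ range P.T, ∫ z, P.φ (ρ' z.2) z.2 ⬝ᵥ B.θ (t + 1) z.1 ∂(μ.prod P.G) := by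
    intro ρ' hρ'
    rw [integral_finsetSum _ fun t ht =>
      (h.integral_loss_policy (Finset.mem_range.1 ht) hρ').2.2.2.2]
    exact Finset.sum_congr rfl fun t ht =>
      (h.integral_loss_policy (Finset.mem_range.1 ht) hρ').2.2.2.1
  have : Nonempty {ρ : 𝒳 → Fin K // Measurable ρ} := ⟨⟨ρ, hρ.1⟩⟩
  refine ciSup_le fun ρ' => ?_
  have h1 := hρ.2 ρ'.1 ρ'.2
  rw [hopt ρ hρ.1, hopt ρ'.1 ρ'.2] at h1
  have hint : ∀ t ∈ range P.T, Integrable (fun ω =>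
      B.loss P (t + 1) ω (B.A (t + 1) ω) (B.X (t + 1) ω)
        - B.loss P (t + 1) ω (ρ'.1 (B.X (t + 1) ω)) (B.X (t + 1) ω)) μ := fun t ht =>
    (h.integrable_obs (Finset.mem_range.1 ht)).sub
      (h.integral_loss_policy (Finset.mem_range.1 ht) ρ'.2).1
  rw [integral_finsetSum _ hint]
  have h2 : ∀ t ∈ range P.T, ∫ ω, (B.loss P (t + 1) ω (B.A (t + 1) ω) (B.X (t + 1) ω)
        - B.loss P (t + 1) ω (ρ'.1 (B.X (t + 1) ω)) (B.X (t + 1) ω)) ∂μ =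
      ∫ ω, B.loss P (t + 1) ω (B.A (t + 1) ω) (B.X (t + 1) ω) ∂μ -
        ∫ z, P.φ (ρ'.1 z.2) z.2 ⬝ᵥ B.θ (t + 1) z.1 ∂(μ.prod P.G) := fun t ht => by
    have h3 := h.integral_loss_policy (Finset.mem_range.1 ht) ρ'.2
    rw [integral_sub (h.integrable_obs (Finset.mem_range.1 ht)) h3.1, h3.2.1]
  rw [Finset.sum_congr rfl h2, Finset.sum_sub_distrib, Finset.sum_sub_distrib]
  linarith

/-- In each round the regret is that of the FTRL iterate on the estimated losses, up to the cost of
exploration. -/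
theorem round_regret_le (h : B.IsRun P Z Θ ℱ μ) {t : ℕ} (ht : t < P.T) {ρ : 𝒳 → Fin K}
    (hρ : Measurable ρ) :
    Integrable (fun z : Ω × 𝒳 => (B.state P t z.1).q z.2 ⬝ᵥ B.estLoss P t z.1 z.2
      - B.estLoss P t z.1 z.2 (ρ z.2)) (μ.prod P.G) ∧
    ∫ ω, B.loss P (t + 1) ω (B.A (t + 1) ω) (B.X (t + 1) ω) ∂μ -
        ∫ z, P.φ (ρ z.2) z.2 ⬝ᵥ B.θ (t + 1) z.1 ∂(μ.prod P.G) ≤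
      ∫ z, ((B.state P t z.1).q z.2 ⬝ᵥ B.estLoss P t z.1 z.2
        - B.estLoss P t z.1 z.2 (ρ z.2)) ∂(μ.prod P.G)
      + 2 / P.lam * ∫ ω, 1 / (B.state P t ω).invRate ∂μ := by
  have := h.isProbabilityMeasure
  have hlam := h.exploration.lam_pos
  -- The signed weights `q - δ_ρ` are fixed by the past and the ghost context, so unbiasedness
  -- applies to each arm separately.
  set w : Fin K → Ω × 𝒳 → ℝ := fun a z => (B.state P t z.1).q z.2 a - if ρ z.2 = a then 1 else 0
    with hw
  have hwm : ∀ a, Measurable[(ℱ t).prod ‹MeasurableSpace 𝒳›] (w a) := by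
    intro a
    have h1 : Measurable fun x => if ρ x = a then (1 : ℝ) else 0 :=
      Measurable.ite (hρ (measurableSet_singleton a)) measurable_const measurable_const
    exact Measurable.sub (h.measurable_q ht.le a) (h1.comp (@measurable_snd Ω 𝒳 (ℱ t) _))
  have hwb : ∀ a z, |w a z| ≤ 1 := by
    intro a z
    have h1 := (h.q_mem t z.1 z.2).1 a
    have h2 := stdSimplex_apply_le_one (h.q_mem t z.1 z.2) a
    simp only [hw]
    rw [abs_le]
    split_ifs <;> constructor <;> linarith
  have hsum : ∀ (c : Fin K → ℝ) (z : Ω × 𝒳), ∑ a, w a z * c a =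
      (B.state P t z.1).q z.2 ⬝ᵥ c - c (ρ z.2) := by
    intro c z
    simp only [hw, sub_mul, Finset.sum_sub_distrib, dotProduct]
    simp
  have hwm' := fun a => measurable_prod_mono (ℱ.le t) (hwm a)
  have hi1 : ∀ a, Integrable (fun z => w a z * B.estLoss P t z.1 z.2 a) (μ.prod P.G) := fun a =>
    h.integrable_mul_estLoss ht a (hwm' a) (hwb a)
  have hi2 : ∀ a, Integrable (fun z => w a z * (P.φ a z.2 ⬝ᵥ B.θ (t + 1) z.1)) (μ.prod P.G) :=
    fun a => h.integrable_mul_inner ht a (hwm' a) (hwb a)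
  have hunb : ∫ z, ((B.state P t z.1).q z.2 ⬝ᵥ B.estLoss P t z.1 z.2
        - B.estLoss P t z.1 z.2 (ρ z.2)) ∂(μ.prod P.G) =
      ∫ z, ((B.state P t z.1).q z.2 ⬝ᵥ (fun a => P.φ a z.2 ⬝ᵥ B.θ (t + 1) z.1)
        - P.φ (ρ z.2) z.2 ⬝ᵥ B.θ (t + 1) z.1) ∂(μ.prod P.G) := by
    rw [← integral_congr_ae (.of_forall fun z => hsum (B.estLoss P t z.1 z.2) z),
      ← integral_congr_ae (.of_forall fun z => hsum (fun a => P.φ a z.2 ⬝ᵥ B.θ (t + 1) z.1) z),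
      integral_finsetSum _ fun a _ => hi1 a, integral_finsetSum _ fun a _ => hi2 a]
    exact Finset.sum_congr rfl fun a _ => h.integral_mul_estLoss ht a (hwm a) (hwb a)
  refine ⟨(integrable_finsetSum univ fun a _ => hi1 a).congr
    (.of_forall fun z => hsum (B.estLoss P t z.1 z.2) z), ?_⟩
  obtain ⟨h1, h2⟩ := h.integral_arm_loss ht (u := fun _ _ => 1)
    (fun _ => @measurable_const _ _ _ ((ℱ t).prod _) 1) (C := 1) (by simp)
  simp only [one_mul] at h1 h2
  have h3 := (h.integral_loss_policy ht hρ).2.2.1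
  have hinv := h.integrable_one_div_invRate ht.le
  have hinv2 : Integrable (fun z : Ω × 𝒳 => 2 / P.lam * (1 / (B.state P t z.1).invRate))
      (μ.prod P.G) := (hinv.comp_fst P.G).const_mul _
  have h4 : 2 / P.lam * ∫ ω, 1 / (B.state P t ω).invRate ∂μ =
      ∫ z, 2 / P.lam * (1 / (B.state P t z.1).invRate) ∂(μ.prod P.G) := by
    rw [integral_const_mul, integral_fun_fst (fun ω => 1 / (B.state P t ω).invRate)]
    simp
  have h5 : Integrable (fun z : Ω × 𝒳 =>
      (B.state P t z.1).q z.2 ⬝ᵥ (fun a => P.φ a z.2 ⬝ᵥ B.θ (t + 1) z.1)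
        - P.φ (ρ z.2) z.2 ⬝ᵥ B.θ (t + 1) z.1) (μ.prod P.G) :=
    (integrable_finsetSum univ fun a _ => hi2 a).congr
      (.of_forall fun z => hsum (fun a => P.φ a z.2 ⬝ᵥ B.θ (t + 1) z.1) z)
  rw [h2, hunb, h4, ← integral_sub h1 h3, ← integral_add h5 hinv2]
  refine integral_mono_ae (h1.sub h3) (h5.add hinv2) ?_
  filter_upwards [ae_prod_of_ae_fst (h.ae_inner_le ht)] with z hz
  -- Replacing `π` by `q` costs `γ` times a difference of two averages in `[-1, 1]`, hence at most
  -- `2γ = 2η/λ`.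
  have e : ∑ a, B.nextPolicy P t z.1 z.2 a * (P.φ a z.2 ⬝ᵥ B.θ (t + 1) z.1) =
      (B.state P t z.1).q z.2 ⬝ᵥ (fun a => P.φ a z.2 ⬝ᵥ B.θ (t + 1) z.1) +
      P.mixing (B.state P t z.1).invRate *
        (∑ a, P.eStar z.2 a * (P.φ a z.2 ⬝ᵥ B.θ (t + 1) z.1) -
          ∑ a, (B.state P t z.1).q z.2 a * (P.φ a z.2 ⬝ᵥ B.θ (t + 1) z.1)) := by
    rw [mul_sub, Finset.mul_sum, Finset.mul_sum, dotProduct, ← Finset.sum_sub_distrib,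
      ← Finset.sum_add_distrib]
    refine Finset.sum_congr rfl fun a _ => ?_
    rw [nextPolicy_eq, Input.policy]
    ring
  have h6 := abs_le.1 (abs_sum_mul_le (h.exploration.eStar_mem z.2) fun a => hz a z.2)
  have h7 := abs_le.1 (abs_sum_mul_le (h.q_mem t z.1 z.2) fun a => hz a z.2)
  have h8 : P.mixing (B.state P t z.1).invRate *
        (∑ a, P.eStar z.2 a * (P.φ a z.2 ⬝ᵥ B.θ (t + 1) z.1) -
          ∑ a, (B.state P t z.1).q z.2 a * (P.φ a z.2 ⬝ᵥ B.θ (t + 1) z.1)) ≤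
      P.mixing (B.state P t z.1).invRate * 2 :=
    mul_le_mul_of_nonneg_left (by linarith [h6.2, h7.1]) (h.mixing_pos t z.1).le
  have h9 : P.mixing (B.state P t z.1).invRate * 2 =
      2 / P.lam * (1 / (B.state P t z.1).invRate) := by
    unfold Input.mixing
    ring
  rw [e]
  linarith

theorem measurable_entropy (h : B.IsRun P Z Θ ℱ μ) {t : ℕ} (ht : t ≤ P.T) :
    Measurable[(ℱ t).prod ‹MeasurableSpace 𝒳›]
      fun z : Ω × 𝒳 => entropy ((B.state P t z.1).q z.2) :=
  Finset.measurable_sum _ fun a _ =>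
    Real.continuous_negMulLog.measurable.comp (h.measurable_q ht a)

/-- The penalty for the increase of the inverse learning rate after round `t + 1`. -/
theorem integral_penalty (h : B.IsRun P Z Θ ℱ μ) {t : ℕ} (ht : t + 1 < P.T) :
    Integrable (fun z => ((B.state P (t + 1) z.1).invRate - (B.state P t z.1).invRate) *
      entropy ((B.state P (t + 1) z.1).q z.2)) (μ.prod P.G) ∧
    Integrable (fun ω => ((B.state P (t + 1) ω).invRate - (B.state P t ω).invRate) *
      B.roundEntropy P (t + 1) ω) μ ∧
    ∫ z, ((B.state P (t + 1) z.1).invRate - (B.state P t z.1).invRate) *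
      entropy ((B.state P (t + 1) z.1).q z.2) ∂(μ.prod P.G) =
    ∫ ω, ((B.state P (t + 1) ω).invRate - (B.state P t ω).invRate) *
      B.roundEntropy P (t + 1) ω ∂μ := by
  have := h.isProbabilityMeasure
  -- The rate of round `t + 2` involves the contexts up to `X (t + 1)` only, so `X (t + 2)` may take
  -- the place of the ghost context.
  have hm : Measurable[(ℱ (t + 1)).prod ‹MeasurableSpace 𝒳›] fun z : Ω × 𝒳 =>
      ((B.state P (t + 1) z.1).invRate - (B.state P t z.1).invRate) *
      entropy ((B.state P (t + 1) z.1).q z.2) := by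
    have h1 : Measurable[ℱ (t + 1)] fun ω =>
        (B.state P (t + 1) ω).invRate - (B.state P t ω).invRate :=
      Measurable.sub (h.measurable_invRate ht.le)
        ((h.measurable_invRate (by omega)).mono (ℱ.mono (Nat.le_succ t)) le_rfl)
    exact Measurable.mul (h1.comp (@measurable_fst Ω 𝒳 (ℱ (t + 1)) _)) (h.measurable_entropy ht.le)
  have hb : ∀ (ω : Ω) (x : 𝒳), |((B.state P (t + 1) ω).invRate - (B.state P t ω).invRate) *
      entropy ((B.state P (t + 1) ω).q x)| ≤ (P.invRateOne * (t + 2)) * Real.log K := by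
    intro ω x
    have h1 := h.invRate_le (t + 1) ω
    have h2 := h.invRate_le t ω
    have h3 := h.invRate_pos (t + 1) ω
    have h4 := h.invRate_pos t ω
    have h5 := h.invRateOne_pos
    have h6 := entropy_nonneg (h.q_mem (t + 1) ω x)
    have h7 := entropy_le_log h.K_pos (h.q_mem (t + 1) ω x)
    push_cast at h1
    rw [abs_mul, abs_of_nonneg h6]
    refine mul_le_mul ?_ h7 h6 (by positivity)
    rw [abs_le]
    constructor <;> nlinarith
  refine ⟨integrable_prod_of_bound (measurable_prod_mono (ℱ.le _) hm) (.of_forall hb), ?_,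
    (h.integral_comp_X ht hm).symm⟩
  exact Integrable.of_bound ((measurable_comp_sup_comap (X := B.X (t + 1 + 1)) hm).mono
    (h.sigma_le ht) le_rfl).aestronglyMeasurable _ (.of_forall fun ω => hb ω (B.X (t + 1 + 1) ω))

theorem measurable_cumEntropy (h : B.IsRun P Z Θ ℱ μ) {t : ℕ} (ht : t ≤ P.T) :
    Measurable fun ω => (B.state P t ω).cumEntropy :=
  (@MeasurableState.cumEntropy 𝒳 _ K Ω (ℱ t) _ (h.measurableState ht)).mono (ℱ.le t) le_rfl

theorem integrable_cumEntropy (h : B.IsRun P Z Θ ℱ μ) {t : ℕ} (ht : t ≤ P.T) :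
    Integrable (fun ω => (B.state P t ω).cumEntropy) μ :=
  Integrable.of_bound (h.measurable_cumEntropy ht).aestronglyMeasurable (t * Real.log K)
    (.of_forall fun ω => by
      rw [Real.norm_eq_abs, abs_of_nonneg (h.cumEntropy_nonneg t ω)]
      exact h.cumEntropy_le t ω)

/-- The FTRL regret on the estimated losses. -/
theorem ae_ftrl_le (h : B.IsRun P Z Θ ℱ μ) {n : ℕ} (hn : P.T = n + 1) :
    ∀ᵐ ω ∂μ, ∀ x a₀, ∑ t ∈ range (n + 1),
      ((B.state P t ω).q x ⬝ᵥ B.estLoss P t ω x - B.estLoss P t ω x a₀) ≤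
      ∑ t ∈ range (n + 1), B.stability P t (ω, x) + P.invRateOne * Real.log K +
      ∑ t ∈ range n, ((B.state P (t + 1) ω).invRate - (B.state P t ω).invRate) *
        entropy ((B.state P (t + 1) ω).q x) := by
  have hall : ∀ᵐ ω ∂μ, ∀ t ∈ range (n + 1), ∀ x a,
      |B.estLoss P t ω x a| ≤ (B.state P t ω).invRate :=
    (ae_ball_iff (range (n + 1)).countable_toSet).2 fun t ht =>
      h.ae_abs_estLoss_le (by rw [hn]; exact Finset.mem_range.1 ht)
  filter_upwards [hall] with ω hω x a₀
  have hdiff : ∀ t, (B.state P (t + 1) ω).cumLoss x - (B.state P t ω).cumLoss x =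
      B.estLoss P t ω x := fun t => by
    ext a
    rw [Pi.sub_apply, cumLoss_succ]
    ring
  have hdiff' : ∀ t a, (B.state P (t + 1) ω).cumLoss x a - (B.state P t ω).cumLoss x a =
      B.estLoss P t ω x a := fun t a => by
    rw [cumLoss_succ]
    ring
  have key := ftrl_regret_le h.K_pos (fun t => (B.state P t ω).cumLoss x)
    (fun t => (B.state P t ω).invRate) n rfl (fun t => h.invRate_pos t ω)
    (fun t ht a => by
      rw [hdiff']
      exact hω t (Finset.mem_range.2 (by omega)) x a) a₀
  simp only [hdiff, hdiff', ← h.q_eq_gibbs] at key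
  exact key

theorem sum_integral_stability_le (h : B.IsRun P Z Θ ℱ μ) {n : ℕ} (hn : P.T = n + 1) :
    ∑ t ∈ range (n + 1), ∫ z, B.stability P t z ∂(μ.prod P.G) ≤
      P.invRateOne + 5 / 2 * d * ∑ t ∈ range (n + 1), ∫ ω, 1 / (B.state P t ω).invRate ∂μ := by
  have hnn : ∀ t, 0 ≤ 5 / 2 * (d : ℝ) * ∫ ω, 1 / (B.state P t ω).invRate ∂μ := fun t =>
    mul_nonneg (by positivity) (integral_nonneg fun ω => (one_div_pos.2 (h.invRate_pos t ω)).le)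
  rw [Finset.mul_sum, Finset.sum_range_succ', Finset.sum_range_succ' (fun t =>
    5 / 2 * (d : ℝ) * ∫ ω, 1 / (B.state P t ω).invRate ∂μ)]
  have h1 : ∑ t ∈ range n, ∫ z, B.stability P (t + 1) z ∂(μ.prod P.G) ≤
      ∑ t ∈ range n, 5 / 2 * (d : ℝ) * ∫ ω, 1 / (B.state P (t + 1) ω).invRate ∂μ :=
    Finset.sum_le_sum fun t ht => h.integral_stability_le (by omega) (by
      rw [Finset.mem_range] at ht; omega)
  linarith [h.integral_stability_zero_le, hnn 0]

/-- The regret in terms of the expected entropies of the iterates. -/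
theorem regret_le_sqrt (h : B.IsRun P Z Θ ℱ μ) {ρ : 𝒳 → Fin K} (hρ : B.IsOptimal P μ ρ) :
    B.regret P μ ≤ 20 * √((1 / P.lam + d) * Real.log P.T *
      ∫ ω, (B.state P P.T ω).cumEntropy ∂μ) := by
  have := h.isProbabilityMeasure
  have hlK : 0 < Real.log K := Real.log_pos (by exact_mod_cast h.two_le_K)
  have hlam := h.exploration.lam_pos
  have hb0 := h.invRateOne_pos
  obtain ⟨n, hn⟩ : ∃ n, P.T = n + 1 := ⟨P.T - 1, by have := h.two_le_T; omega⟩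
  have hlt : ∀ t ∈ range (n + 1), t < P.T := fun t ht => by rw [hn]; exact Finset.mem_range.1 ht
  have hlt' : ∀ t ∈ range n, t + 1 < P.T := fun t ht => by
    rw [Finset.mem_range] at ht; omega
  have hI1 : Integrable (fun z => ∑ t ∈ range (n + 1), B.stability P t z) (μ.prod P.G) :=
    integrable_finsetSum _ fun t ht => h.integrable_stability (hlt t ht)
  have hI2 : Integrable (fun z : Ω × 𝒳 => ∑ t ∈ range n,
      ((B.state P (t + 1) z.1).invRate - (B.state P t z.1).invRate) *
        entropy ((B.state P (t + 1) z.1).q z.2)) (μ.prod P.G) :=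
    integrable_finsetSum _ fun t ht => (h.integral_penalty (hlt' t ht)).1
  have hftrl : ∑ t ∈ range (n + 1), ∫ z, ((B.state P t z.1).q z.2 ⬝ᵥ B.estLoss P t z.1 z.2
        - B.estLoss P t z.1 z.2 (ρ z.2)) ∂(μ.prod P.G) ≤
      ∑ t ∈ range (n + 1), ∫ z, B.stability P t z ∂(μ.prod P.G) + P.invRateOne * Real.log K +
      ∑ t ∈ range n, ∫ ω, ((B.state P (t + 1) ω).invRate - (B.state P t ω).invRate) *
        B.roundEntropy P (t + 1) ω ∂μ := by
    rw [← integral_finsetSum _ fun t ht => (h.round_regret_le (hlt t ht) hρ.1).1,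
      ← integral_finsetSum _ fun t ht => h.integrable_stability (hlt t ht),
      ← Finset.sum_congr rfl fun t ht => (h.integral_penalty (hlt' t ht)).2.2,
      ← integral_finsetSum _ fun t ht => (h.integral_penalty (hlt' t ht)).1]
    have hc : P.invRateOne * Real.log K = ∫ _, P.invRateOne * Real.log K ∂(μ.prod P.G) := by simp
    have hI3 : Integrable (fun z => ∑ t ∈ range (n + 1), B.stability P t z +
        P.invRateOne * Real.log K) (μ.prod P.G) := hI1.add (integrable_const _)
    rw [hc, ← integral_add hI1 (integrable_const _), ← integral_add hI3 hI2]
    refine integral_mono_ae (integrable_finsetSum _ fun t ht =>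
      (h.round_regret_le (hlt t ht) hρ.1).1) (hI3.add hI2) ?_
    filter_upwards [ae_prod_of_ae_fst (h.ae_ftrl_le hn)] with z hz
    exact hz z.2 (ρ z.2)
  have hreg := h.regret_le_of_isOptimal hρ
  rw [hn] at hreg
  have hround := Finset.sum_le_sum fun t ht => (h.round_regret_le (hlt t ht) hρ.1).2
  rw [Finset.sum_add_distrib, ← Finset.mul_sum] at hround
  have hstab := h.sum_integral_stability_le hn
  have hinvI : ∀ t ∈ range (n + 1), Integrable (fun ω => 1 / (B.state P t ω).invRate) μ :=
    fun t ht => h.integrable_one_div_invRate (hlt t ht).le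
  have hpenI : ∀ t ∈ range n, Integrable (fun ω =>
      ((B.state P (t + 1) ω).invRate - (B.state P t ω).invRate) * B.roundEntropy P (t + 1) ω) μ :=
    fun t ht => (h.integral_penalty (hlt' t ht)).2.1
  -- The ghost context is gone, so the errors combine into one expectation over `Ω`, to which the
  -- pathwise bound applies.
  have hmean : (2 / P.lam + 5 / 2 * d) * ∑ t ∈ range (n + 1), ∫ ω, 1 / (B.state P t ω).invRate ∂μ
      + P.invRateOne + P.invRateOne * Real.log K
      + ∑ t ∈ range n, ∫ ω, ((B.state P (t + 1) ω).invRate - (B.state P t ω).invRate) *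
        B.roundEntropy P (t + 1) ω ∂μ =
      ∫ ω, ((2 / P.lam + 5 / 2 * d) * ∑ t ∈ range (n + 1), 1 / (B.state P t ω).invRate
      + P.invRateOne + P.invRateOne * Real.log K
      + ∑ t ∈ range n, ((B.state P (t + 1) ω).invRate - (B.state P t ω).invRate) *
        B.roundEntropy P (t + 1) ω) ∂μ := by
    have i1 : Integrable (fun ω => (2 / P.lam + 5 / 2 * d) *
        ∑ t ∈ range (n + 1), 1 / (B.state P t ω).invRate) μ :=
      (integrable_finsetSum _ hinvI).const_mul _
    have i2 : Integrable (fun ω => (2 / P.lam + 5 / 2 * d) *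
        ∑ t ∈ range (n + 1), 1 / (B.state P t ω).invRate + P.invRateOne) μ :=
      i1.add (integrable_const _)
    have i3 : Integrable (fun ω => (2 / P.lam + 5 / 2 * d) *
        ∑ t ∈ range (n + 1), 1 / (B.state P t ω).invRate + P.invRateOne
        + P.invRateOne * Real.log K) μ := i2.add (integrable_const _)
    rw [integral_add i3 (integrable_finsetSum _ hpenI),
      integral_add i2 (integrable_const _), integral_add i1 (integrable_const _),
      integral_const_mul, integral_finsetSum _ hinvI, integral_finsetSum _ hpenI]
    simp
  -- comparison of `E √S` with `√(E S)` through the arithmetic-geometric mean inequality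
  set E := ∫ ω, (B.state P P.T ω).cumEntropy ∂μ with hE
  have hcumI := h.integrable_cumEntropy (le_refl P.T)
  -- Round 1 alone contributes `log K`; positivity is needed to divide by `m` below.
  have hEpos : 0 < E := by
    have h1 : ∀ ω, Real.log K ≤ (B.state P P.T ω).cumEntropy := by
      intro ω
      have hmono : ∀ s, (B.state P s ω).cumEntropy ≤ (B.state P (s + 1) ω).cumEntropy := fun s =>
        le_add_of_nonneg_right (entropy_nonneg (h.q_mem s ω (B.X (s + 1) ω)))
      refine le_trans (le_of_eq ?_) (monotone_nat_of_le_succ hmono (by omega : 1 ≤ P.T))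
      change Real.log K = 0 + entropy (fun _ : Fin K => 1 / (K : ℝ))
      rw [entropy_uniform h.K_pos, zero_add]
    have h2 := integral_mono (integrable_const (Real.log K)) hcumI h1
    simp at h2
    linarith
  set m := √((Real.log K)⁻¹ * E) with hm
  have hmpos : 0 < m := Real.sqrt_pos.2 (by positivity)
  have hmsq : m ^ 2 = (Real.log K)⁻¹ * E := Real.sq_sqrt (by positivity)
  have hpath : ∀ ω, (2 / P.lam + 5 / 2 * d) * ∑ t ∈ range (n + 1), 1 / (B.state P t ω).invRate
      + P.invRateOne + P.invRateOne * Real.log K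
      + ∑ t ∈ range n, ((B.state P (t + 1) ω).invRate - (B.state P t ω).invRate) *
        B.roundEntropy P (t + 1) ω ≤
      20 * P.invRateOne * Real.log K *
        ((1 / (2 * m)) * ((Real.log K)⁻¹ * (B.state P P.T ω).cumEntropy) + m / 2) := by
    intro ω
    refine (h.pathwise_error_le hn ω).trans (mul_le_mul_of_nonneg_left ?_ (by positivity))
    have hS : 0 ≤ (Real.log K)⁻¹ * (B.state P P.T ω).cumEntropy :=
      mul_nonneg (inv_nonneg.2 hlK.le) (h.cumEntropy_nonneg _ _)
    set s := √((Real.log K)⁻¹ * (B.state P P.T ω).cumEntropy) with hs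
    have hss : (Real.log K)⁻¹ * (B.state P P.T ω).cumEntropy = s ^ 2 := (Real.sq_sqrt hS).symm
    rw [hss]
    have : (1 / (2 * m)) * s ^ 2 + m / 2 - s = (s - m) ^ 2 / (2 * m) := by field_simp; ring
    have : 0 ≤ (s - m) ^ 2 / (2 * m) := by positivity
    linarith
  have hfinal := integral_mono (μ := μ) ?_ ?_ hpath
  · rw [← hmean, integral_const_mul, integral_add ((hcumI.const_mul _).const_mul _)
      (integrable_const _), integral_const_mul, integral_const_mul, ← hE, ← hmsq] at hfinal
    have e1 : (1 / (2 * m)) * m ^ 2 + ∫ _, m / 2 ∂μ = m := by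
      simp
      field_simp
      ring
    rw [e1] at hfinal
    -- By the calibration of `η_1` and `m² = E / log K`, all factors `log K` cancel.
    have e2 : P.invRateOne * Real.log K * m =
        √((1 / P.lam + d) * Real.log P.T * E) := by
      rw [← (P.invRateOne_sq h.two_le_K h.two_le_T hlam).1]
      symm
      rw [Real.sqrt_eq_iff_mul_self_eq (by positivity) (by positivity)]
      have : P.invRateOne * Real.log K * m * (P.invRateOne * Real.log K * m) =
        P.invRateOne ^ 2 * Real.log K ^ 2 * m ^ 2 := by ring
      rw [this, hmsq]
      field_simp
    rw [← e2]
    linarith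
  · exact ((((integrable_finsetSum _ hinvI).const_mul _).add (integrable_const _)).add
      (integrable_const _)).add (integrable_finsetSum _ hpenI)
  · exact (((hcumI.const_mul _).const_mul _).add (integrable_const _)).const_mul _

end IsRun

end Bandit

end BobwFTRL

end

noncomputable section

namespace BobwFTRL

namespace Bandit

variable {𝒳 : Type*} [MeasurableSpace 𝒳] {K d : ℕ} {Ω : Type*} [mΩ : MeasurableSpace Ω]

namespace IsRun

variable {B : Bandit Ω 𝒳 K d} {P : Input 𝒳 K d} {Z Θ : Set (Fin d → ℝ)} {ℱ : Filtration ℕ mΩ}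
  {μ : Measure Ω}

/-! ### The self-bounding argument -/

/-- Since `e*(a) ≤ 1`, one has `1 - π(a) ≥ (1 - γ)(1 - q(a))`, and `1 - γ ≥ 2 / 5` from the second
round on. -/
theorem one_sub_q_le (h : B.IsRun P Z Θ ℱ μ) {t : ℕ} (ht : 1 ≤ t) (ω : Ω) (x : 𝒳) (a : Fin K) :
    1 - (B.state P t ω).q x a ≤ 5 / 2 * (1 - B.nextPolicy P t ω x a) := by
  have h1 := stdSimplex_apply_le_one (h.exploration.eStar_mem x) a
  have h2 := stdSimplex_apply_le_one (h.q_mem t ω x) a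
  have h3 := h.mixing_state_le ht ω
  have h4 := h.mixing_pos t ω
  rw [nextPolicy_eq, Input.policy]
  nlinarith

theorem log_mul_ge (h : B.IsRun P Z Θ ℱ μ) : 4 / 3 ≤ Real.log (K * P.T) := by
  have hK : (2 : ℝ) ≤ K := by exact_mod_cast h.two_le_K
  have hT : (2 : ℝ) ≤ P.T := by exact_mod_cast h.two_le_T
  rw [Real.log_mul (by positivity) (by positivity)]
  have h1 := Real.log_le_log (by norm_num) hK
  have h2 := Real.log_le_log (by norm_num) hT
  linarith [Real.log_two_gt_d9]

/-- The entropies of the iterates along a path, in terms of the probability of leaving the optimal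
arms. -/
theorem ae_cumEntropy_le (h : B.IsRun P Z Θ ℱ μ) [IsProbabilityMeasure μ] (ρ : 𝒳 → Fin K) :
    ∀ᵐ ω ∂μ, (B.state P P.T ω).cumEntropy ≤ 70 * Real.log (K * P.T) *
      ∑ t ∈ range P.T, (1 - B.nextPolicy P t ω (B.X (t + 1) ω) (ρ (B.X (t + 1) ω))) := by
  have hT := h.two_le_T
  have hT0 : (0 : ℝ) < P.T := by exact_mod_cast (by omega : 0 < P.T)
  filter_upwards [h.ae_abs_estLoss_le (by omega : 0 < P.T)] with ω hω
  have hlog := h.log_mul_ge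
  set l := Real.log (K * P.T)
  set p : ℕ → ℝ := fun t => 1 - B.nextPolicy P t ω (B.X (t + 1) ω) (ρ (B.X (t + 1) ω)) with hp
  have hp0 : ∀ t, 0 ≤ p t := fun t =>
    sub_nonneg.2 (stdSimplex_apply_le_one (h.policy_mem t ω _) _)
  have hterm : ∀ t, entropy ((B.state P t ω).q (B.X (t + 1) ω)) ≤
      2 / P.T + (if t = 0 then l else 0) + 5 / 2 * p t * l := by
    intro t
    have h1 := entropy_le_of_weight h.two_le_K hT (h.q_mem t ω (B.X (t + 1) ω))
      (ρ (B.X (t + 1) ω))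
    have h2 := (h.q_mem t ω (B.X (t + 1) ω)).1 (ρ (B.X (t + 1) ω))
    have h3 := hp0 t
    -- Round 1 has no useful comparison of `q` with `π`, so its entropy is charged `l` outright.
    split_ifs with h0
    · nlinarith [mul_nonneg h3 (by linarith : 0 ≤ l),
        mul_nonneg h2 (by linarith : 0 ≤ l)]
    · have h4 := h.one_sub_q_le (by omega : 1 ≤ t) ω (B.X (t + 1) ω) (ρ (B.X (t + 1) ω))
      have h5 := mul_le_mul_of_nonneg_right h4 (by linarith : 0 ≤ l)
      simp only [hp]
      linarith
  have hcum : ∀ n, (B.state P n ω).cumEntropy =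
      ∑ t ∈ range n, entropy ((B.state P t ω).q (B.X (t + 1) ω)) := by
    intro n
    induction n with
    | zero => rfl
    | succ n ih => rw [Finset.sum_range_succ, ← ih]; rfl
  have hsum : (B.state P P.T ω).cumEntropy ≤ 2 + l + 5 / 2 * l * ∑ t ∈ range P.T, p t := by
    rw [hcum]
    refine (Finset.sum_le_sum fun t _ => hterm t).trans (le_of_eq ?_)
    rw [Finset.sum_add_distrib, Finset.sum_add_distrib, Finset.sum_const, Finset.card_range,
      nsmul_eq_mul, mul_div_cancel₀ _ hT0.ne', Finset.sum_ite_eq' (range P.T) 0 fun _ => l,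
      if_pos (Finset.mem_range.2 (by omega)), ← Finset.sum_mul, ← Finset.mul_sum]
    ring
  -- Round 2, index `1`, suffices: its Gibbs losses consist of one estimate, bounded by the inverse
  -- rate, so `1 - q ≥ 1 / 10` and `1 - π ≥ (2 / 5) (1 / 10)`.
  have hone : 1 / 25 ≤ ∑ t ∈ range P.T, p t := by
    refine le_trans ?_ (Finset.single_le_sum (fun t _ => hp0 t)
      (Finset.mem_range.2 (by omega : 1 < P.T)))
    have h1 : ∀ a, |(B.state P 1 ω).cumLoss (B.X (1 + 1) ω) a| ≤ (B.state P 1 ω).invRate := by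
      intro a
      have e : (B.state P 1 ω).cumLoss (B.X (1 + 1) ω) a = B.estLoss P 0 ω (B.X (1 + 1) ω) a := by
        rw [cumLoss_succ]
        exact zero_add _
      rw [e]
      exact (hω _ a).trans (invRateOne_le_state P B 1 ω)
    have h2 := one_sub_gibbs_ge h.two_le_K _ (h.invRate_pos 1 ω) h1 (ρ (B.X (1 + 1) ω))
    rw [← h.q_eq_gibbs] at h2
    have h3 := h.one_sub_q_le le_rfl ω (B.X (1 + 1) ω) (ρ (B.X (1 + 1) ω))
    simp only [hp]
    linarith
  -- As `l ≥ 4 / 3`, `2 + l ≤ (5 / 2) l ≤ (125 / 2) l ∑ p`; with the remaining `(5 / 2) l ∑ p` the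
  -- factor is `65 ≤ 70`.
  nlinarith [mul_le_mul_of_nonneg_left hone (by linarith : 0 ≤ l)]

theorem integral_cumEntropy_le (h : B.IsRun P Z Θ ℱ μ) [IsProbabilityMeasure μ] {ρ : 𝒳 → Fin K}
    (hρ : Measurable ρ) :
    ∫ ω, (B.state P P.T ω).cumEntropy ∂μ ≤ 70 * Real.log (K * P.T) *
      ∫ ω, ∑ t ∈ range P.T,
        (1 - B.nextPolicy P t ω (B.X (t + 1) ω) (ρ (B.X (t + 1) ω))) ∂μ := by
  have hint : ∀ t ∈ range P.T, Integrable
      (fun ω => 1 - B.nextPolicy P t ω (B.X (t + 1) ω) (ρ (B.X (t + 1) ω))) μ := by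
    intro t ht
    have ht' := Finset.mem_range.1 ht
    refine (integrable_const (1 : ℝ)).sub (Integrable.of_bound (C := 1) ?_
      (.of_forall fun ω => h.abs_policy_le t ω _ _))
    have e : (fun ω => B.nextPolicy P t ω (B.X (t + 1) ω) (ρ (B.X (t + 1) ω))) = fun ω =>
        ∑ a, if ρ (B.X (t + 1) ω) = a then B.nextPolicy P t ω (B.X (t + 1) ω) a else 0 := by
      ext ω
      simp
    rw [e]
    refine (Finset.measurable_sum _ fun a _ =>
      Measurable.ite ?_ ?_ measurable_const).aestronglyMeasurable
    · exact (hρ.comp (h.measurable_X ht')) (measurableSet_singleton a)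
    · exact (measurable_comp_sup_comap (X := B.X (t + 1)) (h.measurable_policy ht'.le a)).mono
        (h.sigma_le ht') le_rfl
  rw [← integral_const_mul]
  exact integral_mono_ae (h.integrable_cumEntropy le_rfl)
    ((integrable_finsetSum _ hint).const_mul _) (h.ae_cumEntropy_le ρ)

end IsRun

end Bandit

theorem le_of_sq_le_mul_add {R a b : ℝ} (hb : 0 ≤ b) (ha : 0 ≤ a) (h : R ^ 2 ≤ a * R + b) :
    R ≤ a + √b := by
  by_contra! hR
  have h1 := Real.sqrt_nonneg b
  have h2 := Real.mul_self_sqrt hb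
  nlinarith

end BobwFTRL

end

/-! ### The quadratic inequality for the regret -/

open BobwFTRL in
theorem mainTheorem7 :
    ∃ c : ℝ, 0 < c ∧
      ∀ (𝒳 : Type*) [MeasurableSpace 𝒳] (Ω : Type*) [mΩ : MeasurableSpace Ω]
        (μ : Measure Ω) [IsProbabilityMeasure μ] (ℱ : Filtration ℕ mΩ)
        (K d : ℕ) (P : Input 𝒳 K d) (B : Bandit Ω 𝒳 K d) (Z Θ : Set (Fin d → ℝ))
        (ρ : 𝒳 → Fin K) (Δ C : ℝ),
        2 ≤ K → 2 ≤ P.T →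
        P.IsExploration Z →
        P.mixing P.invRateOne ≤ 1 →
        B.IsInteraction P Z Θ ℱ μ →
        B.IsOptimal P μ ρ →
        0 < Δ → 0 ≤ C →
        B.IsSelfBounding P μ ρ Δ C →
        B.regret P μ ≤
          c * ((1 / P.lam + d) * Real.log P.T * Real.log (K * P.T) / Δ
            + √(C * (1 / P.lam + d) * Real.log P.T * Real.log (K * P.T) / Δ)) := by
  -- `28000 = 20² · 70`, from squaring the regret bound and inserting the entropy bound.
  refine ⟨28000, by norm_num, ?_⟩
  intro 𝒳 _ Ω mΩ μ _ ℱ K d P B Z Θ ρ Δ C hK hT hE hmix hB hρ hΔ hC hself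
  have h : B.IsRun P Z Θ ℱ μ := ⟨hK, hT, hE, hmix, hB⟩
  have hlam := hE.lam_pos
  have hlT : 0 < Real.log P.T := Real.log_pos (by exact_mod_cast hT)
  have hl : 0 < Real.log (K * P.T) := by linarith [h.log_mul_ge]
  set D := 1 / P.lam + (d : ℝ) with hD
  have hD0 : 0 < D := by positivity
  set l := Real.log (K * P.T)
  set R := B.regret P μ
  set V := ∫ ω, ∑ t ∈ range P.T,
        (1 - B.nextPolicy P t ω (B.X (t + 1) ω) (ρ (B.X (t + 1) ω))) ∂μ with hV
  set G := D * Real.log P.T * l / Δ with hG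
  have hG0 : 0 < G := by positivity
  have hsqrt : C * D * Real.log P.T * l / Δ = G * C := by rw [hG]; ring
  rw [hsqrt]
  -- The squaring below needs `R` nonnegative; otherwise the bound is trivial.
  rcases le_or_gt R 0 with hR | hR
  · exact hR.trans (by positivity)
  have h1 := h.regret_le_sqrt hρ
  have h2 := h.integral_cumEntropy_le hρ.1
  rw [← hV] at h2
  have hVle : V ≤ (R + C) / Δ := by
    rw [le_div_iff₀ hΔ]
    have h3 : Δ * V - C ≤ R := hself
    linarith
  have h4 : D * Real.log P.T * ∫ ω, (B.state P P.T ω).cumEntropy ∂μ ≤ 70 * (G * (R + C)) := by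
    calc _ ≤ D * Real.log P.T * (70 * l * ((R + C) / Δ)) := by gcongr; exact h2.trans (by gcongr)
      _ = _ := by rw [hG]; ring
  have h5 : R ≤ 20 * √(70 * (G * (R + C))) :=
    h1.trans (mul_le_mul_of_nonneg_left (Real.sqrt_le_sqrt h4) (by norm_num))
  have h6 : R ^ 2 ≤ 28000 * G * R + 28000 * (G * C) := by
    have h7 : R ^ 2 ≤ (20 * √(70 * (G * (R + C)))) ^ 2 := pow_le_pow_left₀ hR.le h5 2
    rw [mul_pow, Real.sq_sqrt (by positivity)] at h7
    linarith
  have h8 := le_of_sq_le_mul_add (by positivity) (by positivity) h6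
  have h9 : √(28000 * (G * C)) ≤ 28000 * √(G * C) := by
    rw [Real.sqrt_mul (by norm_num)]
    refine mul_le_mul_of_nonneg_right ?_ (Real.sqrt_nonneg _)
    rw [Real.sqrt_le_left (by norm_num)]
    norm_num
  linarith
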